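/- Consider an episodic, time-homogeneous Markov decision process with finitely many non-terminal states $s$ and finitely many actions $a$, in which taking action $a$ in state $s$ yields a jointly distributed real reward $R$ with finite expectation and next state $S'$, where $S'$ is either a state or the terminal symbol $\dagger$ (end of the episode, after which rewards are $0$). Let $\pi(a\mid s)$ be a stationary stochastic policy under which, from every initial state, the episode ends almost surely. Let $0\le\gamma<1$, and let $0<\Phi(s)<1$ for every state $s$. At each time $t$ before the end of the episode, $Z_t\in\{0,1\}$ is drawn from $\mathrm{Bern}(\Phi(S_t))$, depending only on the state $S_t$; put $Z_t=0$ for all other $t$, $Z_t^\infty=\max\{Z_t,Z_{t+1},\dots\}$ and $G_t=\sum_{k\ge 0}\gamma^kR_{t+k+1}$. The true value functions under $\pi$ are $$v_\pi(s)=\mathbb E[G_t\mid S_t=s],\qquad v^\infty_\pi(s)=P(Z^\infty_t=1\mid S_t=s,Z_{t-1}=0),\qquad v^z_\pi(s)=\mathbb E[G_t\mid S_t=s,Z_t^\infty=z,Z_{t-1}=0]\quad(z=0,1),$$ for any initial state distribution and any $t$ such that $P(S_t=s)>0$. For tables of real estimates $V,V^\infty,V^1,V^0$, all extended by $0$ to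 $\dagger$, consider the operators that replace the four tables simultaneously by $$\begin{aligned} V(s)&\mapsto \mathbb E[R+\gamma V(S')\mid s],\\ V^\infty(s)&\mapsto\Phi(s)+(1-\Phi(s))\,\mathbb E[V^\infty(S')\mid s],\\ V^1(s)&\mapsto \frac{V(s)\Phi(s)}{V^\infty(s)}+\frac{1-\Phi(s)}{V^\infty(s)}\,\mathbb E\big[V^\infty(S')(R+\gamma V^1(S'))\mid s\big],\\ V^0(s)&\mapsto \frac{1-\Phi(s)}{1-V^\infty(s)}\,\mathbb E\big[(1-V^\infty(S'))(R+\gamma V^0(S'))\mid s\big], \end{aligned}$$ where all right-hand sides use the current estimates and the expectations are over $A\sim\pi(\cdot\mid s)$ and the resulting $(R,S')$. (A division by zero, which can occur only finitely often in the settings below, is given the value $0$.) (i) There is $r\in[0,1)$ such that, from arbitrary initial tables, the iterates of these operators converge to the true values at the geometric rate $r$: for some constant $C$ depending on the initial tables, after $k$ iterations the errors $|V^z-v^z_\pi|$ ($z=0,1$), as well as $|V-v_\pi|$ and $|V^\infty-v^\infty_\pi|$, are at most $Cr^k$ at every state. (ii) Assume in addition that the rewards have finite second moments. Consider the online method that starts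 from arbitrary (possibly random) initial tables and at step $n$ visits a state $s_n$ (determined by the information available at that time), draws $A_n\sim\pi(\cdot\mid s_n)$, observes the resulting $(R_n,S'_n)$, and simultaneously updates the entries at $s_n$ of the four tables by $x\leftarrow(1-\alpha_n)x+\alpha_n y$, where $y$ is the corresponding right-hand side above with the expectation replaced by its value at the single sample $(R_n,S'_n)$. The non-negative learning rates $\alpha_n$ are determined by the information available at step $n$ and may differ between the four tables. If almost surely every state is visited infinitely often and the learning rates satisfy the Robbins–Monro conditions $\sum_{n:\,s_n=s}\alpha_n=\infty$ and $\sum_{n:\,s_n=s}\alpha_n^2<\infty$ for every state $s$, then almost surely all four tables converge to the true values: $V^z\to v^z_\pi$ ($z=0,1$), $V\to v_\pi$ and $V^\infty\to v^\infty_\pi$. -/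

import Mathlib

open MeasureTheory ProbabilityTheory Filter Topology
open scoped ENNReal

/-- `Option S` is the (discrete) space of states, where `none` means that the episode has ended. -/
instance instMeasurableSpaceOptionState (S : Type*) : MeasurableSpace (Option S) := ⊤

instance instDiscreteMeasurableSpaceOptionState (S : Type*) :
    DiscreteMeasurableSpace (Option S) := ⟨fun _ => trivial⟩

/-- An episodic Markov decision process with (non-terminal) states `S` and actions `A`: taking
action `a` in state `s` produces a random pair (reward, next state) with law `step s a`; the next
state `none` means that the episode is over. Rewards have finite expectation. -/
structure EpisodicMDP (S A : Type*) where
  step : S → A → Measure (ℝ × Option S)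
  isProb : ∀ s a, IsProbabilityMeasure (step s a)
  integrable_reward : ∀ s a, Integrable (fun x : ℝ × Option S => x.1) (step s a)

namespace EpisodicMDP

/-- The joint law of (reward, next state) after a visit to `s`, when the action is drawn from the
policy `π`. -/
noncomputable def policyStep {S A : Type*} [Fintype A] (M : EpisodicMDP S A) (π : S → PMF A) (s : S) :
    Measure (ℝ × Option S) :=
  ∑ a, π s a • M.step s a

instance isProbabilityMeasure_policyStep {S A : Type*} [Fintype A] (M : EpisodicMDP S A)
    (π : S → PMF A) (s : S) : IsProbabilityMeasure (M.policyStep π s) := by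
  refine ⟨?_⟩
  have h := fun a => (M.isProb s a).measure_univ
  have h1 : ∑ a, π s a = 1 := by rw [← tsum_fintype (L := .unconditional A)]; exact (π s).tsum_coe
  simp [policyStep, h, h1]

/-! ### The law of an episode

At every time `t` we record `((R_t, S_t), Z_t)`: the reward received on entering the state, the
state, and the indicator of whether the event took place at time `t`. The time-`0` reward is a
dummy `0`. After the end of the episode the state is `none`, rewards are `0` and `Z_t` is false. -/

/-- What is recorded at one time step. -/
abbrev Rec (S : Type*) : Type _ := (ℝ × Option S) × Bool

/-- The law of (reward, next state) from a possibly terminal state. -/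
noncomputable def stepOrStop {S A : Type*} [Fintype A] (M : EpisodicMDP S A)
    (π : S → PMF A) : Option S → Measure (ℝ × Option S)
  | none => Measure.dirac (0, none)
  | some s => M.policyStep π s

/-- The law of `Z_t` given the state at time `t`: Bernoulli with parameter `Φ s` in state `s`. -/
noncomputable def markLaw {S : Type*} (Φ : S → unitInterval) : Option S → Measure Bool
  | none => Measure.dirac false
  | some s => bernoulliMeasure true false (Φ s)

/-- `stepOrStop` as a kernel. -/
noncomputable def stepKernel {S A : Type*} [Fintype S] [Fintype A] (M : EpisodicMDP S A)
    (π : S → PMF A) : Kernel (Option S) (ℝ × Option S) :=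
  Kernel.ofFunOfCountable (M.stepOrStop π)

/-- `markLaw` as a kernel from the pair (reward, state). -/
noncomputable def markKernel {S : Type*} [Fintype S] (Φ : S → unitInterval) :
    Kernel (ℝ × Option S) Bool :=
  (Kernel.ofFunOfCountable (markLaw Φ)).comap Prod.snd measurable_snd

instance isMarkovKernel_stepKernel {S A : Type*} [Fintype S] [Fintype A] (M : EpisodicMDP S A)
    (π : S → PMF A) : IsMarkovKernel (M.stepKernel π) := by
  refine ⟨fun o => ?_⟩
  cases o with
  | none => exact Measure.dirac.isProbabilityMeasure
  | some s => exact M.isProbabilityMeasure_policyStep π s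

instance isMarkovKernel_markKernel {S : Type*} [Fintype S] (Φ : S → unitInterval) :
    IsMarkovKernel (markKernel Φ) := by
  refine ⟨fun x => ?_⟩
  obtain ⟨r, o⟩ := x
  cases o with
  | none => exact Measure.dirac.isProbabilityMeasure
  | some s => exact inferInstanceAs (IsProbabilityMeasure (bernoulliMeasure true false (Φ s)))

/-- The transition kernel of the record process; it only uses the current state. -/
noncomputable def recKernel {S A : Type*} [Fintype S] [Fintype A] (M : EpisodicMDP S A)
    (π : S → PMF A) (Φ : S → unitInterval) (n : ℕ) :
    Kernel ((i : Finset.Iic n) → (fun _ : ℕ => Rec S) i) (Rec S) :=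
  (M.stepKernel π ⊗ₖ Kernel.prodMkLeft (Option S) (markKernel Φ)).comap
    (fun h => (h ⟨n, Finset.mem_Iic.2 le_rfl⟩).1.2) (by fun_prop)

instance isMarkovKernel_recKernel {S A : Type*} [Fintype S] [Fintype A] (M : EpisodicMDP S A)
    (π : S → PMF A) (Φ : S → unitInterval) (n : ℕ) : IsMarkovKernel (M.recKernel π Φ n) := by
  unfold recKernel
  infer_instance

/-- The law of the record at time `0`, when the initial state has law `ρ`. -/
noncomputable def initLaw {S : Type*} [Fintype S] (Φ : S → unitInterval) (ρ : PMF S) :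
    Measure (Rec S) :=
  (∑ s, ρ s • Measure.dirac ((0 : ℝ), some s)) ⊗ₘ markKernel Φ

instance isProbabilityMeasure_initLaw {S : Type*} [Fintype S] (Φ : S → unitInterval) (ρ : PMF S) :
    IsProbabilityMeasure (initLaw Φ ρ) := by
  have : IsProbabilityMeasure (∑ s, ρ s • Measure.dirac ((0 : ℝ), some s)) := by
    refine ⟨?_⟩
    have h1 : ∑ s, ρ s = 1 := by rw [← tsum_fintype (L := .unconditional S)]; exact ρ.tsum_coe
    simp [h1]
  unfold initLaw
  infer_instance

/-- The law of a whole episode under the policy `π`, with initial state law `ρ`. -/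
noncomputable def law {S A : Type*} [Fintype S] [Fintype A] (M : EpisodicMDP S A)
    (π : S → PMF A) (Φ : S → unitInterval) (ρ : PMF S) : Measure (ℕ → Rec S) :=
  Kernel.trajMeasure (X := fun _ => Rec S) (initLaw Φ ρ) (M.recKernel π Φ)

end EpisodicMDP

/-! ### Random variables on the space of episodes -/

namespace Episode

/-- The state `S_t` (`none` after the end of the episode). -/
def state {S : Type*} (t : ℕ) (τ : ℕ → EpisodicMDP.Rec S) : Option S := (τ t).1.2

/-- The reward `R_t`. -/
def reward {S : Type*} (t : ℕ) (τ : ℕ → EpisodicMDP.Rec S) : ℝ := (τ t).1.1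

/-- The return `G_t = ∑ γ^k R_{t+k+1}`. -/
noncomputable def ret {S : Type*} (γ : ℝ) (t : ℕ) (τ : ℕ → EpisodicMDP.Rec S) : ℝ :=
  ∑' k : ℕ, γ ^ k * reward (t + k + 1) τ

/-- The event `S_t = s`. -/
def inState {S : Type*} (t : ℕ) (s : S) : Set (ℕ → EpisodicMDP.Rec S) :=
  {τ | state t τ = some s}

/-- The event `Z_{t-1} = 0` (the sure event if `t = 0`). -/
def notJustBefore {S : Type*} : ℕ → Set (ℕ → EpisodicMDP.Rec S)
  | 0 => Set.univ
  | t + 1 => {τ | (τ t).2 = false}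

/-- The event `Z_t^∞ = max {Z_t, Z_{t+1}, …} = 1`. -/
def eventually {S : Type*} (t : ℕ) : Set (ℕ → EpisodicMDP.Rec S) :=
  {τ | ∃ k, t ≤ k ∧ (τ k).2 = true}

end Episode

/-- Indices of the four value functions: `v`, `v^∞`, `v^1` and `v^0`. -/
inductive ValueKind
  | v
  | vinf
  | v1
  | v0

/-- A table of (estimates of) the four value functions. -/
abbrev ValueTable (S : Type*) : Type _ := ValueKind → S → ℝ

namespace EpisodicMDP

/-- Under `π`, the episode ends almost surely, whatever the initial state. -/
def Terminates {S A : Type*} [Fintype S] [Fintype A] (M : EpisodicMDP S A)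
    (π : S → PMF A) (Φ : S → unitInterval) : Prop :=
  ∀ s : S, ∀ᵐ τ ∂(M.law π Φ (PMF.pure s)), ∃ t, Episode.state t τ = none

/-- The true value functions at time `t`, for episodes with initial state law `ρ`:
`v_t(s) = E[G_t | S_t = s]`, `v^∞_t(s) = P(Z_t^∞ = 1 | S_t = s, Z_{t-1} = 0)` and
`v^z_t(s) = E[G_t | S_t = s, Z_t^∞ = z, Z_{t-1} = 0]`. -/
noncomputable def trueValue {S A : Type*} [Fintype S] [Fintype A] (M : EpisodicMDP S A)
    (π : S → PMF A) (Φ : S → unitInterval) (γ : ℝ) (ρ : PMF S) (t : ℕ) : ValueTable S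
  | .v, s => ∫ τ, Episode.ret γ t τ ∂((M.law π Φ ρ)[|Episode.inState t s])
  | .vinf, s =>
      ((M.law π Φ ρ)[|Episode.inState t s ∩ Episode.notJustBefore t]).real (Episode.eventually t)
  | .v1, s => ∫ τ, Episode.ret γ t τ
      ∂((M.law π Φ ρ)[|Episode.inState t s ∩ Episode.eventually t ∩ Episode.notJustBefore t])
  | .v0, s => ∫ τ, Episode.ret γ t τ
      ∂((M.law π Φ ρ)[|Episode.inState t s ∩ (Episode.eventually t)ᶜ ∩ Episode.notJustBefore t])

end EpisodicMDP

/-- Every entry of a value table is `0` once the episode has ended. -/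
def atNext {S : Type*} (f : S → ℝ) : Option S → ℝ
  | none => 0
  | some s => f s

/-- One simultaneous application of the four recursions to a table of estimates, with every value
function on the right-hand sides replaced by its current estimate. -/
noncomputable def EpisodicMDP.bellman {S A : Type*} [Fintype A] (M : EpisodicMDP S A)
    (π : S → PMF A) (Φ : S → unitInterval) (γ : ℝ) (V : ValueTable S) : ValueTable S
  | .v, s => ∫ x, (x.1 + γ * atNext (V .v) x.2) ∂(M.policyStep π s)
  | .vinf, s => Φ s + (1 - Φ s) * ∫ x, atNext (V .vinf) x.2 ∂(M.policyStep π s)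
  | .v1, s => V .v s * Φ s / V .vinf s + (1 - Φ s) / V .vinf s *
      ∫ x, atNext (V .vinf) x.2 * (x.1 + γ * atNext (V .v1) x.2) ∂(M.policyStep π s)
  | .v0, s => (1 - Φ s) / (1 - V .vinf s) *
      ∫ x, (1 - atNext (V .vinf) x.2) * (x.1 + γ * atNext (V .v0) x.2) ∂(M.policyStep π s)

/-- The right-hand sides of the four recursions at the state `s`, with the expectations replaced by
a single observed reward `r` and next state `s'`. -/
noncomputable def sampleTarget {S : Type*} (Φ : S → unitInterval) (γ : ℝ) (V : ValueTable S)
    (s : S) (r : ℝ) (s' : Option S) : ValueKind → ℝ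
  | .v => r + γ * atNext (V .v) s'
  | .vinf => Φ s + (1 - Φ s) * atNext (V .vinf) s'
  | .v1 => V .v s * Φ s / V .vinf s + (1 - Φ s) / V .vinf s *
      (atNext (V .vinf) s' * (r + γ * atNext (V .v1) s'))
  | .v0 => (1 - Φ s) / (1 - V .vinf s) *
      ((1 - atNext (V .vinf) s') * (r + γ * atNext (V .v0) s'))

/-- The online method. At step `n` the state `St n` is visited, the reward `Rew n` and the next
state `Nxt n` are observed, and the entries at `St n` of the four tables are moved towards their
sample targets, `x ← (1 - α) x + α y`, where `α i n` is the learning rate of table `i`. -/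
noncomputable def onlineIterate {S Ω : Type*} [DecidableEq S] (Φ : S → unitInterval) (γ : ℝ)
    (α : ValueKind → ℕ → Ω → ℝ) (St : ℕ → Ω → S) (Rew : ℕ → Ω → ℝ) (Nxt : ℕ → Ω → Option S)
    (V₀ : Ω → ValueTable S) : ℕ → Ω → ValueTable S
  | 0, ω => V₀ ω
  | n + 1, ω => fun i s =>
      let V := onlineIterate Φ γ α St Rew Nxt V₀ n ω
      if St n ω = s then
        (1 - α i n ω) * V i s + α i n ω * sampleTarget Φ γ V s (Rew n ω) (Nxt n ω) i
      else V i s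

/-- Experience `(S_n, A_n, R_n, S'_n)` generated by the policy `π` in the process `M`: given the
information `ℱ n` available when the state `St n` is visited, the action has law `π (St n)`, and
reward and next state are generated by `M`. Between two steps the state may be reset in any
non-anticipating way (for instance, a new episode is started when `Nxt n = none`; as long as the
episode goes on, `some (St (n + 1)) = Nxt n`). -/
structure IsExperience {S A Ω : Type*} {mΩ : MeasurableSpace Ω} (M : EpisodicMDP S A)
    (π : S → PMF A) (P : Measure Ω) (ℱ : Filtration ℕ mΩ) (St : ℕ → Ω → S) (Act : ℕ → Ω → A)
    (Rew : ℕ → Ω → ℝ) (Nxt : ℕ → Ω → Option S) : Prop where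
  measurableSet_state : ∀ n s, MeasurableSet[ℱ n] {ω | St n ω = s}
  measurableSet_action : ∀ n a, MeasurableSet[ℱ (n + 1)] {ω | Act n ω = a}
  measurable_reward : ∀ n, Measurable[ℱ (n + 1)] (Rew n)
  measurable_next : ∀ n, Measurable[ℱ (n + 1)] (Nxt n)
  cond_law : ∀ n (B : Set Ω), MeasurableSet[ℱ n] B → ∀ s a (C : Set (ℝ × Option S)),
    MeasurableSet C →
      P (B ∩ {ω | St n ω = s ∧ Act n ω = a ∧ (Rew n ω, Nxt n ω) ∈ C}) =
        P (B ∩ {ω | St n ω = s}) * π s a * M.step s a C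

/-- The Robbins–Monro conditions for the learning rates `α n` used at the visited states `St n`:
they are chosen from the available information, are non-negative, and along the visits to each
state their sum is infinite and the sum of their squares is finite. -/
structure RobbinsMonro {S Ω : Type*} [DecidableEq S] {mΩ : MeasurableSpace Ω} (P : Measure Ω)
    (ℱ : Filtration ℕ mΩ) (St : ℕ → Ω → S) (α : ℕ → Ω → ℝ) : Prop where
  measurable : ∀ n, Measurable[ℱ n] (α n)
  nonneg : ∀ n ω, 0 ≤ α n ω
  sum_eq_top : ∀ᵐ ω ∂P, ∀ s,
    Tendsto (fun N => ∑ n ∈ Finset.range N, if St n ω = s then α n ω else 0) atTop atTop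
  sum_sq_lt_top : ∀ᵐ ω ∂P, ∀ s, Summable (fun n => if St n ω = s then α n ω ^ 2 else 0)

/-! All four recursions are instances of one equation, `D(s) X(s) = h(s) + κ(s) E[D(S') (lam R +
disc X(S'))]`, with weight `D` equal to `1`, `1`, `v^∞`, `1 - v^∞`. If the true `D` and `h` were
used, the weighted error `D (X - Xs)` would contract in the sup norm by `max κ·disc`, because the
next-state probabilities sum to one. The factor is `γ`, `1 - Φ`, `(1 - Φ) γ`, `(1 - Φ) γ` for the
four tables, hence at most some `β < 1`. The operators use estimates of `D` and `h`, but the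
dependence is triangular: `V` and `V^∞` have constant weights and offsets, and they supply those of
`V^1` and `V^0`. Estimates within `ε` of the truth spoil the contraction only by `O(ε)`
(`IsWeightedFixedPoint.exists_error_le`). For the iterated operators, `ε` decays geometrically and
`exists_geometric_bound` gives the rate.

Online, the target is its mean plus martingale noise. The noise has coefficients that involve the
current estimates, which are not known to be bounded. It is therefore normalised by the running
maximum of its coefficients: the normalised martingale converges in L², and averaging makes it
negligible relative to that maximum (`IsBoundedNoise.tendsto_average_div`). A contraction with such
noise first stays bounded and then tends to zero (`tendsto_zero_of_asynchronous_contraction`).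

It remains to identify the fixed point. The quantity `w(s) = E[G; Z^∞ = 0]` satisfies an affine
equation without divisions, so `v`, `v^∞` and `w` exist by Banach's theorem. Iterating their
equations along the episode shows that they are the intended expectations, and `v^1 = (v - w) /
v^∞`, `v^0 = w / (1 - v^∞)` (`IsValueSolution.trueValue_eq`). The denominators are positive: `v^∞ >
0` since `Φ > 0`, and `v^∞ < 1` since episodes end and `Φ < 1`. -/

/-! ### Averaging recursions for real sequences -/

/-- Since `1 - a ≤ exp (-a)`, the product of the factors is at most the exponential of minus a
divergent sum. -/
theorem tendsto_zero_of_le_one_sub_mul {a z : ℕ → ℝ} {N : ℕ}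
    (hz : ∀ n, 0 ≤ z n)
    (hstep : ∀ n, N ≤ n → z (n + 1) ≤ (1 - a n) * z n)
    (hsum : Tendsto (fun n => ∑ k ∈ Finset.range n, a k) atTop atTop) :
    Tendsto z atTop (𝓝 0) := by
  have key : ∀ n, N ≤ n → z n ≤ z N * Real.exp
      (∑ k ∈ Finset.range N, a k - ∑ k ∈ Finset.range n, a k) := by
    intro n hn
    induction n, hn using Nat.le_induction with
    | base => simp
    | succ n hn ih =>
      have h1 : 1 - a n ≤ Real.exp (-a n) := by
        have := Real.add_one_le_exp (-a n); linarith
      calc z (n + 1) ≤ (1 - a n) * z n := hstep n hn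
        _ ≤ Real.exp (-a n) * z n := by gcongr; exact hz n
        _ ≤ Real.exp (-a n) * (z N * Real.exp
            (∑ k ∈ Finset.range N, a k - ∑ k ∈ Finset.range n, a k)) := by gcongr
        _ = _ := by
          rw [Finset.sum_range_succ, mul_left_comm, ← Real.exp_add]; congr 2; ring
  have hlim : Tendsto (fun n => z N * Real.exp
      (∑ k ∈ Finset.range N, a k - ∑ k ∈ Finset.range n, a k)) atTop (𝓝 (z N * 0)) := by
    refine Tendsto.const_mul _ (Real.tendsto_exp_atBot.comp ?_)
    exact tendsto_atBot_add_const_left _ _ (tendsto_neg_atTop_atBot.comp hsum)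
  rw [mul_zero] at hlim
  exact tendsto_of_tendsto_of_tendsto_of_le_of_le' tendsto_const_nhds hlim
    (Eventually.of_forall hz) (eventually_atTop.2 ⟨N, key⟩)

/-- A sequence that is repeatedly averaged with values of size at most `c` is eventually at most
`c + ε`. -/
theorem eventually_abs_le_of_averaging {a y : ℕ → ℝ} {c ε : ℝ} (hε : 0 < ε)
    (ha1 : Tendsto a atTop (𝓝 0))
    (hsum : Tendsto (fun n => ∑ k ∈ Finset.range n, a k) atTop atTop)
    (hstep : ∀ᶠ n in atTop, |y (n + 1)| - c ≤ (1 - a n) * max (|y n| - c) 0) :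
    ∀ᶠ n in atTop, |y n| ≤ c + ε := by
  obtain ⟨N, hN⟩ := eventually_atTop.1 (hstep.and (ha1.eventually_le_const zero_lt_one))
  have h := tendsto_zero_of_le_one_sub_mul (z := fun n => max (|y n| - c) 0) (N := N)
    (fun n => le_max_right _ _) (fun n hn => by
      refine max_le (hN n hn).1 (mul_nonneg ?_ (le_max_right _ _))
      linarith [(hN n hn).2]) hsum
  filter_upwards [h.eventually_le_const hε] with n hn
  linarith [le_max_left (|y n| - c) 0]

/-- Averages of convergent noise are negligible, relative to a growing scale `g`. -/
theorem tendsto_div_zero_of_averaging_noise {a U g M : ℕ → ℝ} {L : ℝ}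
    (ha0 : ∀ n, 0 ≤ a n) (ha1 : Tendsto a atTop (𝓝 0))
    (hsum : Tendsto (fun n => ∑ k ∈ Finset.range n, a k) atTop atTop)
    (hg : Monotone g) (hg1 : ∀ n, 0 < g n) (hM : Tendsto M atTop (𝓝 L))
    (hU : ∀ n, U (n + 1) = (1 - a n) * U n + g n * (M (n + 1) - M n)) :
    Tendsto (fun n => U n / g n) atTop (𝓝 0) := by
  rw [Metric.tendsto_nhds]
  intro ε hε
  have hM' : ∀ᶠ n in atTop, |M n - L| ≤ ε / 4 := by
    filter_upwards [Metric.tendsto_nhds.1 hM (ε / 4) (by positivity)] with n hn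
    exact hn.le
  have hM'' : ∀ᶠ n in atTop, |M (n + 1) - L| ≤ ε / 4 := (tendsto_add_atTop_nat 1).eventually hM'
  -- Subtracting `M - L` cancels the noise increments. What is left is a convex combination, with
  -- weights `ρ(1 - a)`, `ρ a`, `1 - ρ`, of the old value and small tails of `M`; the ratio `ρ ≤ 1`
  -- accounts for the change of scale.
  have key := eventually_abs_le_of_averaging (y := fun n => U n / g n - (M n - L))
    (c := ε / 4) (ε := ε / 4) (by positivity) ha1 hsum (by
      filter_upwards [hM', hM'', ha1.eventually_le_const zero_lt_one] with n h1 h2 h3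
      set ρ := g n / g (n + 1) with hρ
      have hρ0 : 0 ≤ ρ := div_nonneg (hg1 _).le (hg1 _).le
      have hρ1 : ρ ≤ 1 := (div_le_one (hg1 _)).2 (hg (Nat.le_succ n))
      have hgn := (hg1 n).ne'
      have hgn' := (hg1 (n + 1)).ne'
      have e : U (n + 1) / g (n + 1) - (M (n + 1) - L)
          = ρ * (1 - a n) * (U n / g n - (M n - L)) + -(ρ * a n * (M n - L))
            + -((1 - ρ) * (M (n + 1) - L)) := by
        rw [hU, hρ]; field_simp; ring
      rw [e]
      have b1 : |ρ * (1 - a n) * (U n / g n - (M n - L))|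
          = ρ * (1 - a n) * |U n / g n - (M n - L)| := by
        rw [abs_mul, abs_of_nonneg (mul_nonneg hρ0 (by linarith))]
      have b2 : |-(ρ * a n * (M n - L))| ≤ ρ * a n * (ε / 4) := by
        rw [abs_neg, abs_mul, abs_of_nonneg (mul_nonneg hρ0 (ha0 n))]
        exact mul_le_mul_of_nonneg_left h1 (mul_nonneg hρ0 (ha0 n))
      have b3 : |-((1 - ρ) * (M (n + 1) - L))| ≤ (1 - ρ) * (ε / 4) := by
        rw [abs_neg, abs_mul, abs_of_nonneg (by linarith : 0 ≤ 1 - ρ)]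
        exact mul_le_mul_of_nonneg_left h2 (by linarith)
      have b4 := (abs_add_le (ρ * (1 - a n) * (U n / g n - (M n - L)) + -(ρ * a n * (M n - L)))
        (-((1 - ρ) * (M (n + 1) - L))))
      have b5 := abs_add_le (ρ * (1 - a n) * (U n / g n - (M n - L))) (-(ρ * a n * (M n - L)))
      have b6 : ρ * (1 - a n) * (|U n / g n - (M n - L)| - ε / 4)
          ≤ (1 - a n) * max (|U n / g n - (M n - L)| - ε / 4) 0 := by
        calc _ ≤ ρ * (1 - a n) * max (|U n / g n - (M n - L)| - ε / 4) 0 := 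
              mul_le_mul_of_nonneg_left (le_max_left _ _) (mul_nonneg hρ0 (by linarith))
          _ = ρ * ((1 - a n) * max (|U n / g n - (M n - L)| - ε / 4) 0) := by ring
          _ ≤ _ := mul_le_of_le_one_left
              (mul_nonneg (by linarith) (le_max_right _ _)) hρ1
      nlinarith)
  filter_upwards [key, hM'] with n h1 h2
  rw [Real.dist_eq, sub_zero]
  have := abs_add_le (U n / g n - (M n - L)) (M n - L)
  rw [sub_add_cancel] at this
  linarith

/-! ### Asynchronous contractions with noise -/

section Asynchronous

variable {S : Type*} [Fintype S]

/-- Asynchronous averaging towards values that contract the sup norm up to vanishing errors,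
perturbed by noise whose averages `U` are negligible compared with the running maximum. -/
theorem tendsto_zero_of_asynchronous_contraction {x U f a : ℕ → S → ℝ} {β : ℝ}
    (hβ0 : 0 ≤ β) (hβ : β < 1) (ha0 : ∀ n s, 0 ≤ a n s)
    (ha1 : ∀ s, Tendsto (fun n => a n s) atTop (𝓝 0))
    (hsum : ∀ s, Tendsto (fun n => ∑ k ∈ Finset.range n, a k s) atTop atTop)
    (hstep : ∀ n s, x (n + 1) s - U (n + 1) s = (1 - a n s) * (x n s - U n s) + a n s * f n s)
    (hf : ∀ δ > 0, ∀ᶠ n in atTop, ∀ s, |f n s| ≤ (β + δ) * ‖x n‖ + δ)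
    (hU : ∀ ε > 0, ∀ᶠ n in atTop, ∀ s,
      |U n s| ≤ ε * partialSups (fun k => 1 + ‖x k‖) n) :
    Tendsto x atTop (𝓝 0) := by
  set m : ℕ → ℝ := fun n => partialSups (fun k => 1 + ‖x k‖) n with hm
  have hmono : Monotone m := (partialSups _).monotone
  have hxm : ∀ n, 1 + ‖x n‖ ≤ m n := fun n => le_partialSups (fun k => 1 + ‖x k‖) n
  have hm0 : ∀ n, 0 ≤ m n := fun n => by linarith [hxm n, norm_nonneg (x n)]
  -- This leaves room for two perturbations of size `d`: `β + 2 * d = (1 + β) / 2 < 1`.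
  set d := (1 - β) / 4 with hd
  have hd0 : 0 < d := by rw [hd]; linarith
  have ha1' : ∀ᶠ n in atTop, ∀ s, a n s ≤ 1 :=
    eventually_all.2 fun s => (ha1 s).eventually_le_const zero_lt_one
  -- boundedness
  obtain ⟨N, hN⟩ := eventually_atTop.1 ((hf d hd0).and ((hU d hd0).and ha1'))
  have hbound : ∃ B, ∀ n, ‖x n‖ ≤ B := by
    set y : ℕ → S → ℝ := fun n => x n - U n with hy
    set B := ‖y N‖ + d with hB
    have hB0 : 0 ≤ B := by positivity
    -- The noise-free part `y = x - U` is averaged with values obeying the same bound, and the bound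
    -- can only grow with `m`.
    have hyb : ∀ n, N ≤ n → ∀ s, |y n s| ≤ (β + d) * m n + B := by
      intro n hn
      induction n, hn using Nat.le_induction with
      | base =>
        intro s
        have h1 : |y N s| ≤ ‖y N‖ := by simpa using norm_le_pi_norm (y N) s
        have : 0 ≤ (β + d) * m N := mul_nonneg (by linarith) (hm0 N)
        linarith
      | succ n hn ih =>
        intro s
        obtain ⟨h1, -, h3⟩ := hN n hn
        have e : y (n + 1) s = (1 - a n s) * y n s + a n s * f n s := hstep n s
        have h4 : |f n s| ≤ (β + d) * m n + B := by
          have := hxm n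
          have : (β + d) * ‖x n‖ ≤ (β + d) * m n :=
            mul_le_mul_of_nonneg_left (by linarith) (by linarith)
          linarith [h1 s, norm_nonneg (y N)]
        calc |y (n + 1) s| ≤ (1 - a n s) * |y n s| + a n s * |f n s| := by
              rw [e]
              refine (abs_add_le _ _).trans (le_of_eq ?_)
              rw [abs_mul, abs_mul, abs_of_nonneg (ha0 n s),
                abs_of_nonneg (by linarith [h3 s] : 0 ≤ 1 - a n s)]
          _ ≤ (1 - a n s) * ((β + d) * m n + B) + a n s * ((β + d) * m n + B) :=
              add_le_add (mul_le_mul_of_nonneg_left (ih s) (by linarith [h3 s]))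
                (mul_le_mul_of_nonneg_left h4 (ha0 n s))
          _ = (β + d) * m n + B := by ring
          _ ≤ (β + d) * m (n + 1) + B := by
              gcongr
              exact hmono (Nat.le_succ n)
    have hxb : ∀ n, N ≤ n → ‖x n‖ ≤ (β + 2 * d) * m n + B := by
      intro n hn
      have hr : 0 ≤ (β + 2 * d) * m n + B :=
        add_nonneg (mul_nonneg (by linarith) (hm0 n)) hB0
      refine (pi_norm_le_iff_of_nonneg hr).2 fun s => ?_
      have h1 := hyb n hn s
      have h2 := (hN n hn).2.1 s
      have h3 := abs_add_le (y n s) (U n s)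
      have h4 : y n s + U n s = x n s := by simp [hy]
      rw [h4] at h3
      rw [Real.norm_eq_abs]
      have h2' : |U n s| ≤ d * m n := h2
      nlinarith
    -- At a new record, `m (n + 1) = 1 + ‖x (n + 1)‖ ≤ 1 + (β + 2 * d) * m (n + 1) + B`; solving for
    -- `m (n + 1)` gives the second entry.
    set K := max (m N) ((B + 1) / (1 - (β + 2 * d))) with hK
    have h2d : 0 < 1 - (β + 2 * d) := by rw [hd]; linarith
    have hmK : ∀ n, N ≤ n → m n ≤ K := by
      intro n hn
      induction n, hn using Nat.le_induction with
      | base => exact le_max_left _ _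
      | succ n hn ih =>
        have hs : m (n + 1) = max (m n) (1 + ‖x (n + 1)‖) := by
          simp only [hm]; exact partialSups_add_one _ n
        rcases le_total (1 + ‖x (n + 1)‖) (m n) with hle | hle
        · rw [hs, max_eq_left hle]; exact ih
        · refine le_trans ?_ (le_max_right _ _)
          rw [le_div_iff₀ h2d]
          have := hxb (n + 1) (by omega)
          have h5 : m (n + 1) = 1 + ‖x (n + 1)‖ := by rw [hs, max_eq_right hle]
          linarith
    refine ⟨K, fun n => ?_⟩
    have h1 := hxm n
    have h2 := hmono (le_max_left n N)
    have h3 := hmK (max n N) (le_max_right _ _)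
    linarith
  obtain ⟨B, hB⟩ := hbound
  have hB0 : 0 ≤ B := (norm_nonneg _).trans (hB 0)
  have hmB : ∀ n, m n ≤ 1 + B := fun n => partialSups_le _ _ _ fun k _ => by linarith [hB k]
  have hU0 : ∀ ε > 0, ∀ᶠ n in atTop, ∀ s, |U n s| ≤ ε := by
    intro ε hε
    filter_upwards [hU (ε / (1 + B)) (by positivity)] with n hn s
    refine (hn s).trans ?_
    have : ε / (1 + B) * m n ≤ ε / (1 + B) * (1 + B) := by gcongr; exact hmB n
    rwa [div_mul_cancel₀ _ (by positivity)] at this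
  -- one contraction of an eventual bound
  have improve : ∀ b > 0, (∀ᶠ n in atTop, ‖x n‖ ≤ b) →
      ∀ᶠ n in atTop, ‖x n‖ ≤ (1 + β) / 2 * b := by
    intro b hb hxb
    -- The factor and the additive error in `hf` cost `d / 2 * b` each, and so do the averaging
    -- lemma and `U`. The total is `(β + 2 * d) * b`.
    set δ := min (d / 2) (d / 2 * b) with hδ
    have hδ0 : 0 < δ := by positivity
    set c := (β + d) * b with hc
    have hfc : ∀ᶠ n in atTop, ∀ s, |f n s| ≤ c := by
      filter_upwards [hxb, hf δ hδ0] with n h1 h2 s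
      refine (h2 s).trans ?_
      have h3 : δ ≤ d / 2 := min_le_left _ _
      have h4 : δ ≤ d / 2 * b := min_le_right _ _
      have : (β + δ) * ‖x n‖ ≤ (β + d / 2) * b := by gcongr
      rw [hc]; linarith
    have hy : ∀ s, ∀ᶠ n in atTop, |x n s - U n s| ≤ c + d / 2 * b := fun s =>
      eventually_abs_le_of_averaging (by positivity) (ha1 s) (hsum s) (by
        filter_upwards [hfc, ha1'] with n h1 h2
        rw [hstep]
        have h3 : |(1 - a n s) * (x n s - U n s) + a n s * f n s|
            ≤ (1 - a n s) * |x n s - U n s| + a n s * |f n s| := by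
          refine (abs_add_le _ _).trans (le_of_eq ?_)
          rw [abs_mul, abs_mul, abs_of_nonneg (ha0 n s),
            abs_of_nonneg (by linarith [h2 s] : 0 ≤ 1 - a n s)]
        have h4 : a n s * |f n s| ≤ a n s * c := mul_le_mul_of_nonneg_left (h1 s) (ha0 n s)
        have h5 : (1 - a n s) * (|x n s - U n s| - c)
            ≤ (1 - a n s) * max (|x n s - U n s| - c) 0 :=
          mul_le_mul_of_nonneg_left (le_max_left _ _) (by linarith [h2 s])
        linarith)
    filter_upwards [eventually_all.2 hy, hU0 (d / 2 * b) (by positivity)] with n h1 h2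
    refine (pi_norm_le_iff_of_nonneg (by positivity)).2 fun s => ?_
    have h3 := abs_add_le (x n s - U n s) (U n s)
    rw [sub_add_cancel] at h3
    rw [Real.norm_eq_abs]
    have : (1 + β) / 2 * b = (β + 2 * d) * b := by rw [hd]; ring
    rw [this]
    have := h1 s
    have := h2 s
    rw [hc] at *
    linarith
  have iter : ∀ k : ℕ, ∀ᶠ n in atTop, ‖x n‖ ≤ ((1 + β) / 2) ^ k * (B + 1) := by
    intro k
    induction k with
    | zero => exact Eventually.of_forall fun n => by simpa using (hB n).trans (by linarith)
    | succ k ih =>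
      have := improve _ (by positivity) ih
      simpa only [pow_succ', mul_assoc] using this
  have hpow : Tendsto (fun k : ℕ => ((1 + β) / 2) ^ k * (B + 1)) atTop (𝓝 0) := by
    simpa using (tendsto_pow_atTop_nhds_zero_of_lt_one (by linarith : 0 ≤ (1 + β) / 2)
      (by linarith)).mul_const (B + 1)
  rw [Metric.tendsto_nhds]
  intro ε hε
  obtain ⟨k, hk⟩ := (hpow.eventually_lt_const hε).exists
  filter_upwards [iter k] with n hn
  rw [dist_zero_right]
  exact hn.trans_lt hk

end Asynchronous

/-! ### Geometric rates -/

/-- A perturbed linear recursion decays at the rate of the perturbation. -/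
theorem exists_geometric_bound {x : ℕ → ℝ} {b c r : ℝ} (hb : 0 ≤ b) (hr : b < r)
    (h : ∀ᶠ k in atTop, x (k + 1) ≤ b * x k + c * r ^ k) :
    ∃ C, 0 ≤ C ∧ ∀ k, x k ≤ C * r ^ k := by
  have hr0 : 0 < r := hb.trans_lt hr
  obtain ⟨N, hN⟩ := eventually_atTop.1 h
  -- The sum covers the times up to `N`, before the recursion is available; the second term gives `c
  -- ≤ A * (r - b)`, which closes the induction.
  set A := (∑ k ∈ Finset.range (N + 1), |x k| / r ^ k) + |c| / (r - b) with hA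
  have hs : ∀ k ≤ N, x k ≤ A * r ^ k := by
    intro k hk
    have h1 : |x k| / r ^ k ≤ ∑ k ∈ Finset.range (N + 1), |x k| / r ^ k :=
      Finset.single_le_sum (f := fun k => |x k| / r ^ k) (fun i _ => by positivity)
        (Finset.mem_range.2 (by omega))
    have h2 : 0 ≤ |c| / (r - b) := div_nonneg (abs_nonneg _) (by linarith)
    calc x k ≤ |x k| := le_abs_self _
      _ = |x k| / r ^ k * r ^ k := by field_simp
      _ ≤ A * r ^ k := by gcongr; linarith
  refine ⟨A, add_nonneg (Finset.sum_nonneg fun i _ => by positivity)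
    (div_nonneg (abs_nonneg _) (by linarith)), fun k => ?_⟩
  rcases le_total k N with hk | hk
  · exact hs k hk
  · induction k, hk using Nat.le_induction with
    | base => exact hs N le_rfl
    | succ k hk ih =>
      have h3 : |c| ≤ A * (r - b) := by
        have : |c| / (r - b) ≤ A := by
          rw [hA]; linarith [Finset.sum_nonneg (s := Finset.range (N + 1))
            (f := fun k => |x k| / r ^ k) fun i _ => by positivity]
        rwa [div_le_iff₀ (by linarith)] at this
      have h4 : c ≤ A * (r - b) := (le_abs_self c).trans h3
      calc x (k + 1) ≤ b * x k + c * r ^ k := hN k hk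
        _ ≤ b * (A * r ^ k) + A * (r - b) * r ^ k := by gcongr
        _ = A * r ^ (k + 1) := by ring

/-! ### Observations with a conditional law given a finite-valued state -/

section ConditionalLaw

variable {Ω O E : Type*} {mE : MeasurableSpace E}

/-- Given the information in `m`, the variable `Y` has law `ν o` on the event `St = o`. -/
structure HasCondLaw (m : MeasurableSpace Ω) {mΩ : MeasurableSpace Ω} (P : Measure Ω)
    (St : Ω → O) (Y : Ω → E)
    (ν : O → Measure E) : Prop where
  le : m ≤ mΩ
  measurableSet_state : ∀ o, MeasurableSet[m] {ω | St ω = o}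
  measurable : Measurable Y
  measure_inter : ∀ o (B : Set Ω), MeasurableSet[m] B → ∀ C : Set E, MeasurableSet C →
    P (B ∩ {ω | St ω = o} ∩ Y ⁻¹' C) = P (B ∩ {ω | St ω = o}) * ν o C

namespace HasCondLaw

variable {m mΩ : MeasurableSpace Ω} {P : Measure Ω} {St : Ω → O} {Y : Ω → E} {ν : O → Measure E}

theorem map_restrict (H : HasCondLaw m P St Y ν) (o : O) {B : Set Ω} (hB : MeasurableSet[m] B) :
    (P.restrict (B ∩ {ω | St ω = o})).map Y = P (B ∩ {ω | St ω = o}) • ν o := by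
  ext C hC
  rw [Measure.map_apply H.measurable hC, Measure.restrict_apply (H.measurable hC),
    Set.inter_comm, H.measure_inter o B hB C hC, Measure.smul_apply, smul_eq_mul]

theorem integrable [Fintype O] [IsFiniteMeasure P] (H : HasCondLaw m P St Y ν) {h : E → ℝ}
    (hh : ∀ o, Integrable h (ν o)) : Integrable (fun ω => h (Y ω)) P := by
  have h1 : ∀ o, IntegrableOn (fun ω => h (Y ω)) {ω | St ω = o} P := by
    intro o
    have e := H.map_restrict o (B := Set.univ) (@MeasurableSet.univ _ m)
    rw [Set.univ_inter] at e
    have : Integrable h ((P.restrict {ω | St ω = o}).map Y) := by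
      rw [e]; exact (hh o).smul_measure (measure_ne_top _ _)
    exact this.comp_measurable H.measurable
  have h2 : IntegrableOn (fun ω => h (Y ω)) (⋃ o, {ω | St ω = o}) P :=
    integrableOn_finite_iUnion.2 h1
  rwa [show (⋃ o, {ω | St ω = o}) = Set.univ by ext ω; simp, integrableOn_univ] at h2

theorem setIntegral_inter [IsFiniteMeasure P] (H : HasCondLaw m P St Y ν) {h : E → ℝ}
    (hm : Measurable h) (o : O) {B : Set Ω} (hB : MeasurableSet[m] B) :
    ∫ ω in B ∩ {ω | St ω = o}, h (Y ω) ∂P = P.real (B ∩ {ω | St ω = o}) * ∫ e, h e ∂(ν o) := by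
  rw [← integral_map (φ := Y) H.measurable.aemeasurable hm.aestronglyMeasurable,
    H.map_restrict o hB, integral_smul_measure]
  rfl

theorem stronglyMeasurable [Fintype O] (H : HasCondLaw m P St Y ν) (g : O → ℝ) :
    StronglyMeasurable[m] fun ω => g (St ω) := by
  classical
  have : (fun ω => g (St ω)) = fun ω => ∑ o, {ω | St ω = o}.indicator (fun _ => g o) ω := by
    ext ω; simp [Set.indicator_apply]
  rw [this]
  exact Finset.stronglyMeasurable_fun_sum _ fun o _ =>
    (@stronglyMeasurable_const _ _ m _ _).indicator (H.measurableSet_state o)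

theorem setIntegral_eq_sum [Fintype O] (H : HasCondLaw m P St Y ν) {f : Ω → ℝ} (hf : Integrable f P)
    (B : Set Ω) : ∫ ω in B, f ω ∂P = ∑ o, ∫ ω in B ∩ {ω | St ω = o}, f ω ∂P := by
  classical
  have : f = fun ω => ∑ o, {ω | St ω = o}.indicator f ω := by
    ext ω; simp [Set.indicator_apply]
  conv_lhs => rw [this]
  rw [integral_finsetSum _ fun o _ =>
    (hf.integrableOn.indicator (H.le _ (H.measurableSet_state o)))]
  refine Finset.sum_congr rfl fun o _ => ?_
  rw [integral_indicator (H.le _ (H.measurableSet_state o)),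
    Measure.restrict_restrict (H.le _ (H.measurableSet_state o)), Set.inter_comm]

/-- Conditional expectations are tested on sets `B` of `m`, cut into the finitely many pieces `St =
o`. On each piece the law of `Y` is a multiple of `ν o`, by `map_restrict`. -/
theorem condExp_eq [Fintype O] [IsFiniteMeasure P] (H : HasCondLaw m P St Y ν) {h : E → ℝ}
    (hm : Measurable h) (hh : ∀ o, Integrable h (ν o)) :
    P[fun ω => h (Y ω) | m] =ᵐ[P] fun ω => ∫ e, h e ∂(ν (St ω)) := by
  have hg := H.stronglyMeasurable fun o => ∫ e, h e ∂(ν o)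
  have hgi : Integrable (fun ω => ∫ e, h e ∂(ν (St ω))) P := by
    refine Integrable.of_bound (hg.mono H.le).aestronglyMeasurable
      (∑ o, ‖∫ e, h e ∂(ν o)‖) (Eventually.of_forall fun ω => ?_)
    exact Finset.single_le_sum (f := fun o => ‖∫ e, h e ∂(ν o)‖) (fun _ _ => norm_nonneg _)
      (Finset.mem_univ (St ω))
  refine (ae_eq_condExp_of_forall_setIntegral_eq H.le (H.integrable hh)
    (fun _ _ _ => hgi.integrableOn) (fun B hB _ => ?_) hg.aestronglyMeasurable).symm
  rw [H.setIntegral_eq_sum hgi, H.setIntegral_eq_sum (H.integrable hh)]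
  refine Finset.sum_congr rfl fun o _ => ?_
  rw [H.setIntegral_inter hm o hB, setIntegral_congr_fun (g := fun _ => ∫ e, h e ∂(ν o))
    (H.le _ (hB.inter (H.measurableSet_state o))) fun ω hω => by
      simp only [show St ω = o from hω.2]]
  simp

end HasCondLaw

end ConditionalLaw

/-! ### Martingale noise -/

section Noise

variable {Ω : Type*} {mΩ : MeasurableSpace Ω} {P : Measure Ω} [IsProbabilityMeasure P]
  {ℱ : Filtration ℕ mΩ}

/-- Square-integrable martingale differences with bounded conditional variance. -/
structure IsBoundedNoise (P : Measure Ω) (ℱ : Filtration ℕ mΩ) (ξ : ℕ → Ω → ℝ) (K : ℝ) : Prop where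
  measurable : ∀ n, Measurable[ℱ (n + 1)] (ξ n)
  memLp : ∀ n, MemLp (ξ n) 2 P
  condExp_eq_zero : ∀ n, P[ξ n | ℱ n] =ᵐ[P] 0
  condExp_sq_le : ∀ n, P[fun ω => ξ n ω ^ 2 | ℱ n] ≤ᵐ[P] fun _ => K

/-- The sums form a martingale. Its increments are orthogonal, so its second moments are at most
`|K|` times the expected sum of squares of `b`. Hence it is bounded in L¹, and Doob's theorem
applies. -/
theorem IsBoundedNoise.exists_tendsto_of_bounded {ξ b : ℕ → Ω → ℝ} {K C : ℝ}
    (hξ : IsBoundedNoise P ℱ ξ K) (hb : ∀ n, Measurable[ℱ n] (b n))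
    (hC : ∀ n ω, ∑ k ∈ Finset.range n, b k ω ^ 2 ≤ C) :
    ∀ᵐ ω ∂P, ∃ L, Tendsto (fun n => ∑ k ∈ Finset.range n, b k ω * ξ k ω) atTop (𝓝 L) := by
  have hbC : ∀ n ω, b n ω ^ 2 ≤ C := fun n ω =>
    (Finset.single_le_sum (f := fun k => b k ω ^ 2) (fun _ _ => sq_nonneg _)
      (Finset.self_mem_range_succ n)).trans (hC (n + 1) ω)
  have hbd : ∀ n, ∀ ω, ‖b n ω‖ ≤ √C := fun n ω => Real.abs_le_sqrt (hbC n ω)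
  have hbm : ∀ n, StronglyMeasurable[ℱ n] (b n) := fun n => (hb n).stronglyMeasurable
  have hbm0 : ∀ n, StronglyMeasurable (b n) := fun n => (hbm n).mono (ℱ.le n)
  have hbξ : ∀ n, MemLp (fun ω => b n ω * ξ n ω) 2 P := fun n => by
    have h1 : MemLp (b n) ∞ P := memLp_top_of_bound (hbm0 n).aestronglyMeasurable (√C)
      (Eventually.of_forall (hbd n))
    exact (hξ.memLp n).mul h1
  set M : ℕ → Ω → ℝ := fun n ω => ∑ k ∈ Finset.range n, b k ω * ξ k ω with hM
  have hM2 : ∀ n, MemLp (M n) 2 P := fun n => memLp_finsetSum _ fun k _ => hbξ k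
  have hMm : ∀ n, StronglyMeasurable[ℱ n] (M n) := by
    intro n
    refine Finset.stronglyMeasurable_fun_sum _ fun k hk => ?_
    have hk' := Finset.mem_range.1 hk
    exact ((hbm k).mono (ℱ.mono hk'.le)).mul
      ((hξ.measurable k).stronglyMeasurable.mono (ℱ.mono hk'))
  have hMi : ∀ n, Integrable (M n) P := fun n => (hM2 n).integrable one_le_two
  have hstep : ∀ n, M (n + 1) = M n + fun ω => b n ω * ξ n ω := by
    intro n; ext ω; simp [hM, Finset.sum_range_succ]
  have hmart : Martingale M ℱ P := by
    refine martingale_of_condExp_sub_eq_zero_nat hMm hMi fun n => ?_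
    rw [hstep, add_sub_cancel_left]
    have := condExp_mul_of_stronglyMeasurable_left (hbm n) (g := ξ n)
      ((hbξ n).integrable one_le_two) ((hξ.memLp n).integrable one_le_two)
    refine (this.trans ?_)
    filter_upwards [hξ.condExp_eq_zero n] with ω hω
    simp [hω]
  have hsq : ∀ n, ∫ ω, M n ω ^ 2 ∂P ≤ |K| * ∫ ω, ∑ k ∈ Finset.range n, b k ω ^ 2 ∂P := by
    have hbi : ∀ n, Integrable (fun ω => b n ω ^ 2) P := fun n =>
      Integrable.of_bound ((hbm0 n).pow 2).aestronglyMeasurable C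
        (Eventually.of_forall fun ω => by
          rw [Real.norm_of_nonneg (sq_nonneg _)]; exact hbC n ω)
    intro n
    induction n with
    | zero => simp [hM]
    | succ n ih =>
      have e : (fun ω => M (n + 1) ω ^ 2) = fun ω => M n ω ^ 2 +
          2 * (M n ω * b n ω * ξ n ω) + b n ω ^ 2 * ξ n ω ^ 2 := by
        rw [hstep]; ext ω; simp only [Pi.add_apply]; ring
      have i1 : Integrable (fun ω => M n ω ^ 2) P := (hM2 n).integrable_sq
      have i2 : Integrable (fun ω => M n ω * b n ω * ξ n ω) P := by
        simpa only [Pi.mul_def, mul_assoc] using (hM2 n).integrable_mul (hbξ n)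
      have i3 : Integrable (fun ω => b n ω ^ 2 * ξ n ω ^ 2) P := by
        simpa only [mul_pow] using (hbξ n).integrable_sq
      have z2 : ∫ ω, M n ω * b n ω * ξ n ω ∂P = 0 := by
        rw [← integral_condExp (ℱ.le n)]
        have := condExp_mul_of_stronglyMeasurable_left ((hMm n).mul (hbm n)) (g := ξ n) i2
          ((hξ.memLp n).integrable one_le_two)
        rw [integral_eq_zero_of_ae]
        refine (this.trans ?_)
        filter_upwards [hξ.condExp_eq_zero n] with ω hω
        simp [hω]
      have z3 : ∫ ω, b n ω ^ 2 * ξ n ω ^ 2 ∂P ≤ |K| * ∫ ω, b n ω ^ 2 ∂P := by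
        rw [← integral_condExp (ℱ.le n), ← integral_const_mul]
        have := condExp_mul_of_stronglyMeasurable_left ((hbm n).pow 2)
          (g := fun ω => ξ n ω ^ 2) i3 (hξ.memLp n).integrable_sq
        refine integral_mono_ae integrable_condExp ((hbi n).const_mul _) ?_
        filter_upwards [this, hξ.condExp_sq_le n] with ω h1 h2
        have h3 : P[fun ω => b n ω ^ 2 * ξ n ω ^ 2 | ℱ n] ω = _ := h1
        rw [h3]
        simp only [Pi.mul_apply, Pi.pow_apply]
        rw [mul_comm]
        exact mul_le_mul_of_nonneg_right (h2.trans (le_abs_self K)) (sq_nonneg _)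
      have e1 := integral_add (i1.add (i2.const_mul 2)) i3
      have e2 := integral_add i1 (i2.const_mul 2)
      simp only [Pi.add_apply] at e1
      rw [e, e1, e2, integral_const_mul, z2]
      simp only [Finset.sum_range_succ]
      rw [integral_add (integrable_finsetSum _ fun k _ => hbi k) (hbi n), mul_add]
      linarith
  have hL1 : ∀ n, eLpNorm (M n) 1 P ≤ ((1 + |K| * |C|).toNNReal : ℝ≥0∞) := by
    intro n
    rw [eLpNorm_one_eq_lintegral_enorm, ← ofReal_integral_norm_eq_lintegral_enorm (hMi n)]
    refine ENNReal.ofReal_le_ofReal ?_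
    have h1 : ∫ ω, ‖M n ω‖ ∂P ≤ ∫ ω, (1 + M n ω ^ 2) ∂P := by
      refine integral_mono (hMi n).norm ((integrable_const 1).add (hM2 n).integrable_sq)
        fun ω => ?_
      rw [Real.norm_eq_abs]
      nlinarith [sq_nonneg (|M n ω| - 1), sq_abs (M n ω)]
    rw [integral_add (integrable_const 1) (hM2 n).integrable_sq] at h1
    have h2 : ∫ ω, ∑ k ∈ Finset.range n, b k ω ^ 2 ∂P ≤ |C| := by
      refine (integral_mono_of_nonneg (g := fun _ => |C|)
        (Eventually.of_forall fun ω => Finset.sum_nonneg fun _ _ => sq_nonneg _)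
        (integrable_const _)
        (Eventually.of_forall fun ω => (hC n ω).trans (le_abs_self C))).trans ?_
      simp
    have h3 := mul_le_mul_of_nonneg_left h2 (abs_nonneg K)
    have := hsq n
    simp only [integral_const, probReal_univ, smul_eq_mul, mul_one] at h1
    linarith
  exact hmart.submartingale.exists_ae_tendsto_of_bdd hL1

/-- Localisation: the coefficients are switched off once their sum of squares exceeds `j`, and
almost every path is unaffected for large `j`. -/
theorem IsBoundedNoise.exists_tendsto {ξ b : ℕ → Ω → ℝ} {K : ℝ}
    (hξ : IsBoundedNoise P ℱ ξ K) (hb : ∀ n, Measurable[ℱ n] (b n))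
    (hsum : ∀ᵐ ω ∂P, Summable fun n => b n ω ^ 2) :
    ∀ᵐ ω ∂P, ∃ L, Tendsto (fun n => ∑ k ∈ Finset.range n, b k ω * ξ k ω) atTop (𝓝 L) := by
  classical
  -- The sum includes the term `n`, which is already known at time `n`; so the bound `j` is never
  -- overshot and `c j n` stays adapted.
  set c : ℕ → ℕ → Ω → ℝ := fun j n ω =>
    if ∑ k ∈ Finset.range (n + 1), b k ω ^ 2 ≤ j then b n ω else 0 with hc
  have hcm : ∀ j n, Measurable[ℱ n] (c j n) := by
    intro j n
    refine Measurable.ite ?_ (hb n) measurable_const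
    refine measurableSet_le (Finset.measurable_fun_sum _ fun k hk => ?_) measurable_const
    exact ((hb k).mono (ℱ.mono (Nat.lt_succ_iff.1 (Finset.mem_range.1 hk))) le_rfl).pow_const 2
  have hcb : ∀ (j n : ℕ) ω, ∑ k ∈ Finset.range n, c j k ω ^ 2 ≤ j := by
    intro j n ω
    induction n with
    | zero => simp
    | succ n ih =>
      by_cases h : ∑ k ∈ Finset.range (n + 1), b k ω ^ 2 ≤ j
      · refine (Finset.sum_le_sum fun k _ => ?_).trans h
        simp only [hc]
        split_ifs
        · exact le_rfl
        · simpa using sq_nonneg (b k ω)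
      · rw [Finset.sum_range_succ]
        simp only [hc, if_neg h]
        simpa [hc] using ih
  have hall : ∀ᵐ ω ∂P, ∀ j : ℕ, ∃ L,
      Tendsto (fun n => ∑ k ∈ Finset.range n, c j k ω * ξ k ω) atTop (𝓝 L) :=
    ae_all_iff.2 fun j => hξ.exists_tendsto_of_bounded (hcm j) (hcb j)
  filter_upwards [hall, hsum] with ω h1 h2
  obtain ⟨j, hj⟩ := exists_nat_ge (∑' n, b n ω ^ 2)
  have e : ∀ n, c j n ω = b n ω := fun n =>
    if_pos ((h2.sum_le_tsum _ fun _ _ => sq_nonneg _).trans hj)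
  simpa only [e] using h1 j

/-- Averaged martingale noise with adapted coefficients `c` is negligible compared with the running
maximum of the coefficients. -/
theorem IsBoundedNoise.tendsto_average_div {ξ a c U : ℕ → Ω → ℝ} {K : ℝ}
    (hξ : IsBoundedNoise P ℱ ξ K) (ha : ∀ n, Measurable[ℱ n] (a n))
    (hc : ∀ n, Measurable[ℱ n] (c n)) (ha0 : ∀ n ω, 0 ≤ a n ω)
    (hsum : ∀ᵐ ω ∂P, Tendsto (fun n => ∑ k ∈ Finset.range n, a k ω) atTop atTop)
    (hsq : ∀ᵐ ω ∂P, Summable fun n => a n ω ^ 2)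
    (hU : ∀ n ω, U (n + 1) ω = (1 - a n ω) * U n ω + a n ω * (c n ω * ξ n ω)) :
    ∀ᵐ ω ∂P, Tendsto (fun n => U n ω / partialSups (fun k => 1 + |c k ω|) n) atTop (𝓝 0) := by
  set g : ℕ → Ω → ℝ := fun n ω => partialSups (fun k => 1 + |c k ω|) n with hg
  have hgc : ∀ n ω, 1 + |c n ω| ≤ g n ω := fun n ω => le_partialSups (fun k => 1 + |c k ω|) n
  have hg0 : ∀ n ω, 0 < g n ω := fun n ω => by linarith [hgc n ω, abs_nonneg (c n ω)]
  have hgm : ∀ n, Measurable[ℱ n] (g n) := by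
    intro n
    induction n with
    | zero =>
      have e : g 0 = fun ω => 1 + |c 0 ω| := by ext ω; simp [hg]
      rw [e]
      exact continuous_abs.measurable.comp (hc 0) |>.const_add 1
    | succ n ih =>
      have e : g (n + 1) = fun ω => max (g n ω) (1 + |c (n + 1) ω|) := by
        ext ω; simp only [hg]; exact partialSups_add_one _ n
      rw [e]
      exact (ih.mono (ℱ.mono n.le_succ) le_rfl).max
        ((continuous_abs.measurable.comp (hc (n + 1))).const_add 1)
  -- Dividing by the running maximum makes the coefficients at most `a n` in size, hence
  -- square-summable. The recursion for `U` then has increments `g n * (M (n + 1) - M n)` with `M`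
  -- convergent.
  have hconv := hξ.exists_tendsto (b := fun n ω => a n ω * (c n ω / g n ω))
    (fun n => (ha n).mul ((hc n).div (hgm n))) (by
      filter_upwards [hsq] with ω hω
      refine Summable.of_nonneg_of_le (fun n => sq_nonneg _) (fun n => ?_) hω
      rw [mul_pow]
      refine mul_le_of_le_one_right (sq_nonneg _) ?_
      rw [sq_le_one_iff_abs_le_one, abs_div, abs_of_pos (hg0 n ω), div_le_one (hg0 n ω)]
      linarith [hgc n ω])
  filter_upwards [hconv, hsum, hsq] with ω ⟨L, hL⟩ h1 h2
  have h3 : Tendsto (fun n => a n ω) atTop (𝓝 0) := by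
    have := h2.tendsto_atTop_zero.sqrt
    simpa [Real.sqrt_sq (ha0 _ ω)] using this
  refine tendsto_div_zero_of_averaging_noise (fun n => ha0 n ω) h3 h1
    (partialSups _).monotone (fun n => hg0 n ω) hL fun n => ?_
  rw [hU, Finset.sum_range_succ]
  have := (hg0 n ω).ne'
  have e : partialSups (fun k => 1 + |c k ω|) n = g n ω := rfl
  rw [e]
  field_simp
  ring

/-- Centred functions of observations with a conditional law are noise. -/
theorem isBoundedNoise_of_hasCondLaw {O E : Type*} [Fintype O] {mE : MeasurableSpace E}
    {St : ℕ → Ω → O} {Y : ℕ → Ω → E} {ν : O → Measure E} [∀ o, IsProbabilityMeasure (ν o)]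
    (H : ∀ n, HasCondLaw (ℱ n) P (St n) (Y n) ν) (hY : ∀ n, Measurable[ℱ (n + 1)] (Y n))
    {h : E → ℝ} (hm : Measurable h) (hh : ∀ o, MemLp h 2 (ν o)) :
    ∃ K, IsBoundedNoise P ℱ (fun n ω => h (Y n ω) - ∫ e, h e ∂(ν (St n ω))) K := by
  have hi : ∀ o, Integrable h (ν o) := fun o => (hh o).integrable one_le_two
  have hi2 : ∀ o, Integrable (fun e => h e ^ 2) (ν o) := fun o => (hh o).integrable_sq
  set I : O → ℝ := fun o => ∫ e, h e ∂(ν o) with hI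
  set Q : O → ℝ := fun o => ∫ e, h e ^ 2 ∂(ν o) with hQ
  have hIm : ∀ n, StronglyMeasurable[ℱ n] fun ω => I (St n ω) :=
    fun n => (H n).stronglyMeasurable I
  have hIb : ∀ o, |I o| ≤ ∑ o, |I o| := fun o =>
    Finset.single_le_sum (f := fun o => |I o|) (fun _ _ => abs_nonneg _) (Finset.mem_univ o)
  have hL : ∀ n, MemLp (fun ω => h (Y n ω)) 2 P := fun n =>
    (memLp_two_iff_integrable_sq (hm.comp (H n).measurable).aestronglyMeasurable).2
      (show Integrable (fun ω => h (Y n ω) ^ 2) P from (H n).integrable hi2)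
  have hIL : ∀ n, MemLp (fun ω => I (St n ω)) 2 P := fun n =>
    MemLp.of_bound ((hIm n).mono (ℱ.le n)).aestronglyMeasurable (∑ o, |I o|)
      (Eventually.of_forall fun ω => hIb _)
  have hIi : ∀ n, Integrable (fun ω => I (St n ω)) P := fun n => (hIL n).integrable one_le_two
  have hξL : ∀ n, MemLp (fun ω => h (Y n ω) - I (St n ω)) 2 P := fun n => (hL n).sub (hIL n)
  -- From `(h - I) ^ 2 ≤ 2 * h ^ 2 + 2 * I ^ 2`; the sum over the finitely many states bounds the
  -- value at any one of them.
  refine ⟨∑ o, (2 * Q o + 2 * I o ^ 2), fun n => ?_, hξL, fun n => ?_, fun n => ?_⟩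
  · exact (hm.comp (hY n)).sub ((hIm n).measurable.mono (ℱ.mono n.le_succ) le_rfl)
  · have h1 := condExp_sub ((hL n).integrable one_le_two) (hIi n) (ℱ n)
    rw [condExp_of_stronglyMeasurable (ℱ.le n) (hIm n) (hIi n)] at h1
    refine (show _ =ᵐ[P] _ from h1).trans ?_
    filter_upwards [(H n).condExp_eq hm hi] with ω hω
    simp [hω, hI]
  · have hi3 : Integrable (fun ω => 2 * h (Y n ω) ^ 2 + 2 * I (St n ω) ^ 2) P :=
      ((hL n).integrable_sq.const_mul 2).add ((hIL n).integrable_sq.const_mul 2)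
    have h0 : ∀ o, Integrable (fun e => 2 * h e ^ 2) (ν o) := fun o => (hi2 o).const_mul 2
    have h1 : P[fun ω => (h (Y n ω) - I (St n ω)) ^ 2 | ℱ n] ≤ᵐ[P]
        P[fun ω => 2 * h (Y n ω) ^ 2 + 2 * I (St n ω) ^ 2 | ℱ n] := by
      refine condExp_mono (hξL n).integrable_sq hi3 (Eventually.of_forall fun ω => ?_)
      simp only
      nlinarith [sq_nonneg (h (Y n ω) + I (St n ω))]
    have h2 := condExp_add ((H n).integrable h0)
      ((hIL n).integrable_sq.const_mul 2) (ℱ n)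
    have hIm2 : StronglyMeasurable[ℱ n] fun ω => 2 * I (St n ω) ^ 2 :=
      (H n).stronglyMeasurable fun o => 2 * I o ^ 2
    rw [condExp_of_stronglyMeasurable (ℱ.le n) hIm2 ((hIL n).integrable_sq.const_mul 2)] at h2
    filter_upwards [h1, (show _ =ᵐ[P] _ from h2), (H n).condExp_eq ((hm.pow_const 2).const_mul 2) h0]
      with ω a1 a2 a3
    refine a1.trans ?_
    have a2' : P[fun ω => 2 * h (Y n ω) ^ 2 + 2 * I (St n ω) ^ 2 | ℱ n] ω = _ := a2
    rw [a2', Pi.add_apply, a3, integral_const_mul]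
    have hQ0 : ∀ o, 0 ≤ Q o := fun o => integral_nonneg fun _ => sq_nonneg _
    exact Finset.single_le_sum (f := fun o => 2 * Q o + 2 * I o ^ 2)
      (fun o _ => by have := hQ0 o; positivity) (Finset.mem_univ (St n ω))

end Noise

/-! ### The weighted fixed-point equation and its contraction -/

/-- The error of a table, weighted by `D`. -/
def weightedError {S : Type*} (D : Option S → ℝ) (Xs X : S → ℝ) (s : S) : ℝ := D (some s) * (X s - Xs s)

theorem abs_sub_le_of_weightedError {S : Type*} [Fintype S] {D : Option S → ℝ} {Xs : S → ℝ}
    (hD : ∀ s, 0 < D (some s)) (X : S → ℝ) (s : S) :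
    |X s - Xs s| ≤ (D (some s))⁻¹ * ‖weightedError D Xs X‖ := by
  have h1 : |weightedError D Xs X s| ≤ ‖weightedError D Xs X‖ :=
    norm_le_pi_norm (weightedError D Xs X) s
  rw [weightedError, abs_mul, abs_of_pos (hD s)] at h1
  rwa [inv_mul_eq_div, le_div_iff₀' (hD s)]

section Target

variable {S : Type*} [DecidableEq S]

/-- The observations at one step on which the targets depend linearly: the reward and the
indicator on each of the possible next states. -/
noncomputable def stepObs : Option S × Bool → ℝ × Option S → ℝ
  | (o, true), x => if x.2 = o then x.1 else 0
  | (o, false), x => if x.2 = o then 1 else 0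

/-- The coefficients of `stepObs` in the target with weights `D` and estimates `X`. -/
def obsCoef (lam disc : ℝ) (D : Option S → ℝ) (X : S → ℝ) : Option S × Bool → ℝ
  | (o, true) => D o * lam
  | (o, false) => D o * (disc * atNext X o)

theorem measurable_stepObs [Fintype S] (j : Option S × Bool) : Measurable (stepObs j) := by
  obtain ⟨o, b⟩ := j
  have : MeasurableSet {x : ℝ × Option S | x.2 = o} :=
    measurable_snd (MeasurableSet.of_discrete (s := {o}))
  cases b
  · exact Measurable.ite this measurable_const measurable_const
  · exact Measurable.ite this measurable_fst measurable_const

/-- This separates the sample from the estimates: the estimates appear only in coefficients known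
before the step, and the sample only through a fixed finite family of functions. The noise is thus a
combination of fixed centred observations with adapted coefficients. -/
theorem weighted_eq_sum_stepObs [Fintype S] (lam disc : ℝ) (D : Option S → ℝ) (X : S → ℝ)
    (x : ℝ × Option S) : D x.2 * (lam * x.1 + disc * atNext X x.2) =
      ∑ j, obsCoef lam disc D X j * stepObs j x := by
  simp only [Fintype.sum_prod_type, Fintype.sum_bool, obsCoef, stepObs, Finset.sum_add_distrib,
    mul_ite, mul_one, mul_zero, Finset.sum_ite_eq, Finset.mem_univ, if_true]
  ring

theorem memLp_stepObs [Fintype S] {p : ℝ≥0∞} {μ : Measure (ℝ × Option S)} [IsProbabilityMeasure μ]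
    (hμ : MemLp (fun x : ℝ × Option S => x.1) p μ) (j : Option S × Bool) :
    MemLp (stepObs j) p μ := by
  obtain ⟨o, b⟩ := j
  cases b
  · refine MemLp.of_bound (measurable_stepObs _).aestronglyMeasurable 1
      (Eventually.of_forall fun x => ?_)
    simp only [stepObs]; split_ifs <;> simp
  · refine hμ.of_le (measurable_stepObs _).aestronglyMeasurable (Eventually.of_forall fun x => ?_)
    simp only [stepObs]; split_ifs <;> simp

theorem integral_stepObs_false_nonneg (μ : Measure (ℝ × Option S)) (o : Option S) :
    0 ≤ ∫ x, stepObs (o, false) x ∂μ :=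
  integral_nonneg fun x => by simp only [stepObs]; split_ifs <;> simp

variable [Fintype S]

theorem integrable_stepObs {μ : Measure (ℝ × Option S)} [IsProbabilityMeasure μ]
    (hμ : Integrable (fun x : ℝ × Option S => x.1) μ) (j : Option S × Bool) :
    Integrable (stepObs j) μ :=
  memLp_one_iff_integrable.1 (memLp_stepObs (memLp_one_iff_integrable.2 hμ) j)

theorem integral_weighted_eq_sum {μ : Measure (ℝ × Option S)} [IsProbabilityMeasure μ]
    (hμ : Integrable (fun x : ℝ × Option S => x.1) μ) (lam disc : ℝ) (D : Option S → ℝ)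
    (X : S → ℝ) : ∫ x, D x.2 * (lam * x.1 + disc * atNext X x.2) ∂μ =
      ∑ j, obsCoef lam disc D X j * ∫ x, stepObs j x ∂μ := by
  simp only [weighted_eq_sum_stepObs, ← integral_const_mul]
  exact integral_finsetSum _ fun j _ => (integrable_stepObs hμ j).const_mul _

theorem sum_integral_stepObs_false (μ : Measure (ℝ × Option S)) [IsProbabilityMeasure μ] :
    ∑ o, ∫ x, stepObs (o, false) x ∂μ = 1 := by
  rw [← integral_finsetSum]
  · simp [stepObs]
  · intro o _
    refine Integrable.of_bound (measurable_stepObs _).aestronglyMeasurable 1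
      (Eventually.of_forall fun x => ?_)
    simp only [stepObs]; split_ifs <;> simp

/-- The expected target `(h + κ E[D(S') (lam R + disc X(S'))]) / D` of one table, where `ν s` is the
law of (reward, next state) after a visit to `s`. -/
noncomputable def meanTarget (ν : S → Measure (ℝ × Option S)) (κ : S → ℝ) (lam disc : ℝ)
    (D : Option S → ℝ) (h X : S → ℝ) (s : S) : ℝ :=
  (h s + κ s * ∫ x, D x.2 * (lam * x.1 + disc * atNext X x.2) ∂(ν s)) / D (some s)

/-- The data of a weighted fixed-point equation with contraction factor `β`. -/
structure IsWeightedFixedPoint (ν : S → Measure (ℝ × Option S)) (κ : S → ℝ) (lam disc β : ℝ)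
    (D : Option S → ℝ) (h Xs : S → ℝ) : Prop where
  integrable : ∀ s, Integrable (fun x : ℝ × Option S => x.1) (ν s)
  κ_nonneg : ∀ s, 0 ≤ κ s
  κ_le_one : ∀ s, κ s ≤ 1
  disc_nonneg : 0 ≤ disc
  mul_le : ∀ s, κ s * disc ≤ β
  β_nonneg : 0 ≤ β
  weight_pos : ∀ s, 0 < D (some s)
  eq : ∀ s, D (some s) * Xs s =
    h s + κ s * ∫ x, D x.2 * (lam * x.1 + disc * atNext Xs x.2) ∂(ν s)

variable {ν : S → Measure (ℝ × Option S)} [∀ s, IsProbabilityMeasure (ν s)] {κ : S → ℝ}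
  {lam disc β : ℝ} {D : Option S → ℝ} {h Xs : S → ℝ}

set_option maxHeartbeats 800000 in
/-- With weights and offsets `ε`-close to their limits, the weighted error contracts up to `O(ε)`. -/
theorem IsWeightedFixedPoint.exists_error_le (F : IsWeightedFixedPoint ν κ lam disc β D h Xs) :
    ∃ C, 0 ≤ C ∧ ∃ ε₀ > 0, ∀ ε, 0 ≤ ε → ε ≤ ε₀ → ∀ (D' : Option S → ℝ) (h' X : S → ℝ),
      (∀ o, |D' o - D o| ≤ ε) → (∀ s, |h' s - h s| ≤ ε) → ∀ s,
        |weightedError D Xs (meanTarget ν κ lam disc D' h' X) s|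
          ≤ (β + C * ε) * ‖weightedError D Xs X‖ + C * ε := by
  set m : S → Option S × Bool → ℝ := fun s j => ∫ x, stepObs j x ∂(ν s) with hm
  set e : S → Option S → ℝ := fun s o => |lam * m s (o, true) + disc * atNext Xs o * m s (o, false)|
    with he
  -- A single constant that dominates all fixed data, including the inverse weights.
  set B := 1 + ∑ o, |D o| + ∑ s, |h s| + ∑ s, (D (some s))⁻¹ + ∑ s, ∑ o, e s o with hB
  have s1 : 0 ≤ ∑ o, |D o| := Finset.sum_nonneg fun _ _ => abs_nonneg _
  have s2 : 0 ≤ ∑ s, |h s| := Finset.sum_nonneg fun _ _ => abs_nonneg _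
  have s3 : 0 ≤ ∑ s, (D (some s))⁻¹ :=
    Finset.sum_nonneg fun s _ => (inv_pos.2 (F.weight_pos s)).le
  have he0 : ∀ s, 0 ≤ ∑ o, e s o := fun s => Finset.sum_nonneg fun _ _ => abs_nonneg _
  have s4 : 0 ≤ ∑ s, ∑ o, e s o := Finset.sum_nonneg fun s _ => he0 s
  have hB1 : 1 ≤ B := by rw [hB]; linarith
  have hBD : ∀ o, |D o| ≤ B := fun o => by
    have := Finset.single_le_sum (f := fun o => |D o|) (fun _ _ => abs_nonneg _) (Finset.mem_univ o)
    rw [hB]; linarith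
  have hBh : ∀ s, |h s| ≤ B := fun s => by
    have := Finset.single_le_sum (f := fun s => |h s|) (fun _ _ => abs_nonneg _) (Finset.mem_univ s)
    rw [hB]; linarith
  have hBi : ∀ s, (D (some s))⁻¹ ≤ B := fun s => by
    have := Finset.single_le_sum (f := fun s => (D (some s))⁻¹)
      (fun s _ => (inv_pos.2 (F.weight_pos s)).le) (Finset.mem_univ s)
    rw [hB]; linarith
  have hBe : ∀ s, ∑ o, e s o ≤ B := fun s => by
    have := Finset.single_le_sum (f := fun s => ∑ o, e s o) (fun s _ => he0 s) (Finset.mem_univ s)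
    rw [hB]; linarith
  have hβ := F.β_nonneg
  have hB0 : 0 < B := by linarith
  -- As `D ≥ 1 / B` at states, `ε ≤ 1 / (2 * B)` keeps `D' ≥ 1 / (2 * B)`, so no division by zero
  -- occurs.
  refine ⟨10 * B ^ 3 * (1 + β), by positivity, 1 / (2 * B), by positivity, ?_⟩
  intro ε hε0 hε D' h' X hD' hh' s
  have hε1 : ε ≤ 1 := hε.trans (by rw [div_le_one (by positivity)]; linarith)
  have hDs := F.weight_pos s
  have hDinv : 1 / B ≤ D (some s) := by
    rw [div_le_iff₀ hB0]
    have := hBi s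
    rwa [inv_le_iff_one_le_mul₀ hDs, mul_comm] at this
  have hD's : 1 / (2 * B) ≤ D' (some s) := by
    have h1 := (abs_le.1 (hD' (some s))).1
    have h2 : 1 / B = 1 / (2 * B) + 1 / (2 * B) := by field_simp; norm_num
    linarith
  have hD'pos : 0 < D' (some s) := lt_of_lt_of_le (by positivity) hD's
  -- The error is weighted by `D`, while the target is divided by `D'`; `q` is the mismatch, within
  -- `O(ε)` of `1`.
  set q := D (some s) / D' (some s) with hq
  have hq1 : |q - 1| ≤ 2 * B * ε := by
    have e1 : q - 1 = -(D' (some s) - D (some s)) / D' (some s) := by rw [hq]; field_simp; ring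
    rw [e1, abs_div, abs_neg, abs_of_pos hD'pos, div_le_iff₀ hD'pos]
    have : 1 ≤ 2 * B * D' (some s) := by rwa [div_le_iff₀' (by positivity)] at hD's
    calc _ ≤ ε := hD' (some s)
      _ = ε * 1 := by ring
      _ ≤ ε * (2 * B * D' (some s)) := by gcongr
      _ = _ := by ring
  have hB2 : 1 ≤ B ^ 2 := one_le_pow₀ hB1
  have close : ∀ u u' : ℝ, |u| ≤ B → |u' - u| ≤ ε → |q * u' - u| ≤ 5 * B ^ 2 * ε := by
    intro u u' hu huu
    have e1 : q * u' - u = (q - 1) * u' + (u' - u) := by ring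
    have h1 : |u'| ≤ 2 * B := by
      have := abs_add_le (u' - u) u
      rw [sub_add_cancel] at this; linarith
    calc |q * u' - u| ≤ |q - 1| * |u'| + |u' - u| := by
          rw [e1, ← abs_mul]; exact abs_add_le _ _
      _ ≤ 2 * B * ε * (2 * B) + ε := by gcongr
      _ = 4 * (B ^ 2 * ε) + 1 * ε := by ring
      _ ≤ 4 * (B ^ 2 * ε) + B ^ 2 * ε := by gcongr
      _ = 5 * B ^ 2 * ε := by ring
  set N := ‖weightedError D Xs X‖ with hN
  have hN0 : 0 ≤ N := norm_nonneg _
  -- decomposition of the error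
  have expand : ∀ (D₁ : Option S → ℝ) (X₁ : S → ℝ),
      ∫ x, D₁ x.2 * (lam * x.1 + disc * atNext X₁ x.2) ∂(ν s) =
        ∑ o, D₁ o * (lam * m s (o, true) + disc * atNext X₁ o * m s (o, false)) := by
    intro D₁ X₁
    rw [integral_weighted_eq_sum (F.integrable s), Fintype.sum_prod_type]
    simp only [Fintype.sum_bool, obsCoef, hm]
    exact Finset.sum_congr rfl fun o _ => by ring
  -- The first two terms measure wrong offsets and weights at the true fixed point, and are `O(ε)`.
  -- Only the third involves the current error, and it carries the factor `κ s * disc ≤ β`.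
  have dec : weightedError D Xs (meanTarget ν κ lam disc D' h' X) s = (q * h' s - h s)
      + κ s * ∑ o, (q * D' o - D o) * (lam * m s (o, true) + disc * atNext Xs o * m s (o, false))
      + κ s * disc * ∑ o, q * D' o * (atNext X o - atNext Xs o) * m s (o, false) := by
    have e1 : weightedError D Xs (meanTarget ν κ lam disc D' h' X) s
        = q * (h' s + κ s * ∑ o, D' o *
            (lam * m s (o, true) + disc * atNext X o * m s (o, false)))
          - (h s + κ s * ∑ o, D o *
            (lam * m s (o, true) + disc * atNext Xs o * m s (o, false))) := by
      rw [← expand, ← expand, ← F.eq s, weightedError, meanTarget, hq]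
      ring
    have e2 : q * ∑ o, D' o * (lam * m s (o, true) + disc * atNext X o * m s (o, false))
        - ∑ o, D o * (lam * m s (o, true) + disc * atNext Xs o * m s (o, false))
        = ∑ o, (q * D' o - D o) * (lam * m s (o, true) + disc * atNext Xs o * m s (o, false))
          + disc * ∑ o, q * D' o * (atNext X o - atNext Xs o) * m s (o, false) := by
      rw [Finset.mul_sum, Finset.mul_sum, ← Finset.sum_sub_distrib, ← Finset.sum_add_distrib]
      exact Finset.sum_congr rfl fun o _ => by ring
    rw [e1]
    linear_combination κ s * e2
  have b1 : |q * h' s - h s| ≤ 5 * B ^ 2 * ε := close _ _ (hBh s) (hh' s)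
  have b2 : |κ s * ∑ o, (q * D' o - D o) *
      (lam * m s (o, true) + disc * atNext Xs o * m s (o, false))| ≤ 5 * B ^ 2 * ε * B := by
    rw [abs_mul, abs_of_nonneg (F.κ_nonneg s)]
    refine (mul_le_of_le_one_left (abs_nonneg _) (F.κ_le_one s)).trans ?_
    refine (Finset.abs_sum_le_sum_abs _ _).trans ?_
    calc _ ≤ ∑ o, 5 * B ^ 2 * ε * e s o := by
          refine Finset.sum_le_sum fun o _ => ?_
          rw [abs_mul]
          exact mul_le_mul_of_nonneg_right (close _ _ (hBD o) (hD' o)) (abs_nonneg _)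
      _ ≤ 5 * B ^ 2 * ε * B := by
          rw [← Finset.mul_sum]
          exact mul_le_mul_of_nonneg_left (hBe s) (by positivity)
  have b3 : |κ s * disc * ∑ o, q * D' o * (atNext X o - atNext Xs o) * m s (o, false)|
      ≤ β * ((1 + 5 * B ^ 3 * ε) * N) := by
    rw [abs_mul, abs_of_nonneg (mul_nonneg (F.κ_nonneg s) F.disc_nonneg)]
    refine mul_le_mul (F.mul_le s) ?_ (abs_nonneg _) hβ
    refine (Finset.abs_sum_le_sum_abs _ _).trans ?_
    calc _ ≤ ∑ o, (1 + 5 * B ^ 3 * ε) * N * m s (o, false) := by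
          refine Finset.sum_le_sum fun o _ => ?_
          have hp : 0 ≤ m s (o, false) := integral_stepObs_false_nonneg _ _
          rw [abs_mul, abs_of_nonneg hp]
          refine mul_le_mul_of_nonneg_right ?_ hp
          cases o with
          -- After the end of the episode the value is exact, so no positivity of `D none` is
          -- required; for `v^1` it is `0`.
          | none =>
            simp only [atNext, sub_self, mul_zero, abs_zero]
            positivity
          | some t =>
            have hDt := F.weight_pos t
            have e1 : q * D' (some t) * (atNext X (some t) - atNext Xs (some t))
                = (1 + (q * D' (some t) - D (some t)) * (D (some t))⁻¹)
                  * weightedError D Xs X t := by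
              simp only [atNext, weightedError]
              field_simp
              ring
            have h1 : |(q * D' (some t) - D (some t)) * (D (some t))⁻¹| ≤ 5 * B ^ 2 * ε * B := by
              rw [abs_mul, abs_of_pos (inv_pos.2 hDt)]
              exact mul_le_mul (close _ _ (hBD _) (hD' _)) (hBi t) (inv_pos.2 hDt).le
                (by positivity)
            have h2 : |weightedError D Xs X t| ≤ N := norm_le_pi_norm (weightedError D Xs X) t
            rw [e1, abs_mul]
            refine mul_le_mul ((abs_add_le _ _).trans ?_) h2 (abs_nonneg _) (by positivity)
            rw [abs_one]
            linarith
      _ = (1 + 5 * B ^ 3 * ε) * N := by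
          rw [← Finset.mul_sum, sum_integral_stepObs_false, mul_one]
  rw [dec]
  clear_value B q N m
  have t1 := abs_add_le ((q * h' s - h s) + κ s * ∑ o, (q * D' o - D o) *
      (lam * m s (o, true) + disc * atNext Xs o * m s (o, false)))
      (κ s * disc * ∑ o, q * D' o * (atNext X o - atNext Xs o) * m s (o, false))
  have t2 := abs_add_le (q * h' s - h s) (κ s * ∑ o, (q * D' o - D o) *
      (lam * m s (o, true) + disc * atNext Xs o * m s (o, false)))
  have hB3 : B ^ 2 ≤ B ^ 3 := pow_le_pow_right₀ hB1 (by norm_num)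
  have t3 : 5 * B ^ 2 * ε + 5 * B ^ 2 * ε * B ≤ 10 * B ^ 3 * (1 + β) * ε := by
    have h1 : 0 ≤ B ^ 3 * ε * β := by positivity
    have h2 := mul_le_mul_of_nonneg_right hB3 hε0
    have h3 : 5 * B ^ 2 * ε + 5 * B ^ 2 * ε * B = 5 * (B ^ 2 * ε) + 5 * (B ^ 3 * ε) := by ring
    have h4 : 10 * B ^ 3 * (1 + β) * ε = 10 * (B ^ 3 * ε) + 10 * (B ^ 3 * ε * β) := by ring
    rw [h3, h4]
    linarith only [h1, h2]
  have t4 : β * ((1 + 5 * B ^ 3 * ε) * N) ≤ (β + 10 * B ^ 3 * (1 + β) * ε) * N := by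
    have h1 : β * (1 + 5 * B ^ 3 * ε) ≤ β + 10 * B ^ 3 * (1 + β) * ε := by
      have h1 : 0 ≤ B ^ 3 * ε * β := by positivity
      have h2 : 0 ≤ B ^ 3 * ε := by positivity
      have h3 : β * (1 + 5 * B ^ 3 * ε) = β + 5 * (B ^ 3 * ε * β) := by ring
      have h4 : β + 10 * B ^ 3 * (1 + β) * ε = β + 10 * (B ^ 3 * ε) + 10 * (B ^ 3 * ε * β) := by
        ring
      rw [h3, h4]
      linarith only [h1, h2]
    calc _ = β * (1 + 5 * B ^ 3 * ε) * N := by ring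
      _ ≤ _ := by gcongr
  linarith only [t1, t2, t3, t4, b1, b2, b3]

/-- Iterating the expected target with geometrically converging weights and offsets. -/
theorem IsWeightedFixedPoint.exists_rate (F : IsWeightedFixedPoint ν κ lam disc β D h Xs)
    {r c : ℝ} (hβr : β < r) (hr : r < 1) {D' : ℕ → Option S → ℝ} {h' X : ℕ → S → ℝ}
    (hX : ∀ k, X (k + 1) = meanTarget ν κ lam disc (D' k) (h' k) (X k))
    (hD' : ∀ k o, |D' k o - D o| ≤ c * r ^ k) (hh' : ∀ k s, |h' k s - h s| ≤ c * r ^ k) :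
    ∃ C, 0 ≤ C ∧ ∀ k s, |X k s - Xs s| ≤ C * r ^ k := by
  obtain ⟨C, hC0, ε₀, hε₀, H⟩ := F.exists_error_le
  have hβ := F.β_nonneg
  have hr0 : 0 < r := hβ.trans_lt hβr
  have hc0 : 0 ≤ c := by simpa using (abs_nonneg _).trans (hD' 0 none)
  have hlim : Tendsto (fun k : ℕ => c * r ^ k) atTop (𝓝 0) := by
    simpa using (tendsto_pow_atTop_nhds_zero_of_lt_one hr0.le hr).const_mul c
  have hlim2 : Tendsto (fun k : ℕ => C * (c * r ^ k)) atTop (𝓝 0) := by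
    simpa using hlim.const_mul C
  -- Once `C * (c * r ^ k) ≤ (r - β) / 2`, the perturbed factor is at most the midpoint of `β` and
  -- `r`, still strictly below `r`. Early steps, possibly with zero weights, only affect the
  -- constant.
  obtain ⟨A, hA0, hA⟩ := exists_geometric_bound (x := fun k => ‖weightedError D Xs (X k)‖)
    (b := (β + r) / 2) (c := C * c) (r := r) (by linarith) (by linarith) (by
      filter_upwards [hlim.eventually_le_const hε₀,
        hlim2.eventually_le_const (by linarith : 0 < (r - β) / 2)] with k h1 h2
      have hn : 0 ≤ (β + r) / 2 * ‖weightedError D Xs (X k)‖ + C * c * r ^ k := by positivity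
      refine (pi_norm_le_iff_of_nonneg hn).2 fun s => ?_
      rw [hX, Real.norm_eq_abs]
      refine (H (c * r ^ k) (by positivity) h1 _ _ (X k) (hD' k) (hh' k) s).trans ?_
      rw [mul_assoc C c]
      gcongr
      linarith)
  have hsum0 : 0 ≤ ∑ s, (D (some s))⁻¹ :=
    Finset.sum_nonneg fun s _ => (inv_pos.2 (F.weight_pos s)).le
  refine ⟨(∑ s, (D (some s))⁻¹) * A, by positivity, fun k s => ?_⟩
  refine (abs_sub_le_of_weightedError F.weight_pos (X k) s).trans ?_
  rw [mul_assoc]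
  exact mul_le_mul (Finset.single_le_sum (f := fun s => (D (some s))⁻¹)
    (fun s _ => (inv_pos.2 (F.weight_pos s)).le) (Finset.mem_univ s)) (hA k) (norm_nonneg _) hsum0

end Target

/-! ### Almost sure convergence of one online table -/

/-- Running averages of `w` with weights `a`, started from `0`. -/
def runningAverage (a w : ℕ → ℝ) : ℕ → ℝ
  | 0 => 0
  | n + 1 => (1 - a n) * runningAverage a w n + a n * w n

theorem exists_abs_le_of_tendsto {u : ℕ → ℝ} {l : ℝ} (h : Tendsto u atTop (𝓝 l)) :
    ∃ B, 0 ≤ B ∧ ∀ n, |u n| ≤ B := by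
  obtain ⟨B, hB⟩ := h.abs.bddAbove_range
  exact ⟨B, (abs_nonneg _).trans (hB ⟨0, rfl⟩), fun n => hB ⟨n, rfl⟩⟩

section OnlineTable

variable {S Ω : Type*} [Fintype S] [DecidableEq S] {mΩ : MeasurableSpace Ω} {P : Measure Ω}
  [IsProbabilityMeasure P] {ℱ : Filtration ℕ mΩ}

/-- Almost sure convergence of one table of the online method, on the event that the weights and
offsets it uses converge. -/
theorem IsWeightedFixedPoint.tendsto_online {ν : S → Measure (ℝ × Option S)}
    [∀ s, IsProbabilityMeasure (ν s)] {κ : S → ℝ} {lam disc β : ℝ} {D : Option S → ℝ}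
    {h Xs : S → ℝ} (F : IsWeightedFixedPoint ν κ lam disc β D h Xs) (hβ : β < 1)
    (hν : ∀ s, MemLp (fun x : ℝ × Option S => x.1) 2 (ν s))
    {St : ℕ → Ω → S} {Rew : ℕ → Ω → ℝ} {Nxt : ℕ → Ω → Option S} {α : ℕ → Ω → ℝ}
    (H : ∀ n, HasCondLaw (ℱ n) P (St n) (fun ω => (Rew n ω, Nxt n ω)) ν)
    (hY : ∀ n, Measurable[ℱ (n + 1)] fun ω => (Rew n ω, Nxt n ω))
    (hα : RobbinsMonro P ℱ St α)
    {D' : ℕ → Ω → Option S → ℝ} {h' X : ℕ → Ω → S → ℝ}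
    (hD'm : ∀ n o, Measurable[ℱ n] fun ω => D' n ω o)
    (hXm : ∀ n s, Measurable[ℱ n] fun ω => X n ω s)
    (hX : ∀ n ω s, X (n + 1) ω s = if St n ω = s then
      (1 - α n ω) * X n ω s + α n ω * ((h' n ω s + κ s * (D' n ω (Nxt n ω) *
        (lam * Rew n ω + disc * atNext (X n ω) (Nxt n ω)))) / D' n ω (some s)) else X n ω s) :
    ∀ᵐ ω ∂P, (∀ o, Tendsto (fun n => D' n ω o) atTop (𝓝 (D o))) →
      (∀ s, Tendsto (fun n => h' n ω s) atTop (𝓝 (h s))) →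
        ∀ s, Tendsto (fun n => X n ω s) atTop (𝓝 (Xs s)) := by
  -- With rate `0` at the states not visited, every entry obeys an averaging recursion at every
  -- time.
  set a : S → ℕ → Ω → ℝ := fun s n ω => if St n ω = s then α n ω else 0 with ha
  set ξ : Option S × Bool → ℕ → Ω → ℝ := fun j n ω =>
    stepObs j (Rew n ω, Nxt n ω) - ∫ x, stepObs j x ∂(ν (St n ω)) with hξ
  set e : S → ℕ → Ω → ℝ := fun s n ω => D (some s) * κ s / D' n ω (some s) with he
  set c : S → Option S × Bool → ℕ → Ω → ℝ := fun s j n ω =>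
    e s n ω * obsCoef lam disc (D' n ω) (X n ω) j with hc
  -- The noise is averaged separately for each observation `j`; the sum over `j` is the noise in the
  -- weighted error at `s`.
  set U : S → Option S × Bool → ℕ → Ω → ℝ := fun s j n ω =>
    runningAverage (fun n => a s n ω) (fun n => c s j n ω * ξ j n ω) n with hU
  have ham : ∀ s n, Measurable[ℱ n] (a s n) := fun s n =>
    Measurable.ite ((H n).measurableSet_state s) (hα.measurable n) measurable_const
  have ha0 : ∀ s n ω, 0 ≤ a s n ω := fun s n ω => by
    simp only [ha]; split_ifs
    · exact hα.nonneg n ω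
    · exact le_rfl
  have hasq : ∀ᵐ ω ∂P, ∀ s, Summable fun n => a s n ω ^ 2 := by
    filter_upwards [hα.sum_sq_lt_top] with ω hω s
    refine (hω s).congr fun n => ?_
    simp only [ha]; split_ifs <;> simp
  have hem : ∀ s n, Measurable[ℱ n] (e s n) := fun s n => (hD'm n (some s)).const_div _
  have hcm : ∀ s j n, Measurable[ℱ n] (c s j n) := by
    rintro s ⟨o, b⟩ n
    refine (hem s n).mul ?_
    cases b
    · refine (hD'm n o).mul (Measurable.const_mul ?_ disc)
      cases o
      · exact measurable_const
      · exact hXm n _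
    · exact (hD'm n o).mul_const lam
  have hnoise : ∀ᵐ ω ∂P, ∀ s j, Tendsto
      (fun n => U s j n ω / partialSups (fun k => 1 + |c s j k ω|) n) atTop (𝓝 0) := by
    refine ae_all_iff.2 fun s => ae_all_iff.2 fun j => ?_
    obtain ⟨K, hK⟩ := isBoundedNoise_of_hasCondLaw H hY (measurable_stepObs j)
      fun s => memLp_stepObs (hν s) j
    refine hK.tendsto_average_div (ham s) (hcm s j) (ha0 s) ?_ ?_ fun n ω => rfl
    · filter_upwards [hα.sum_eq_top] with ω hω using hω s
    · filter_upwards [hasq] with ω hω using hω s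
  -- The exceptional null set is fixed before convergence of weights and offsets is assumed. The
  -- noise bound is relative to the running maximum of the coefficients, so the rest is a pathwise
  -- argument.
  filter_upwards [hnoise, hα.sum_eq_top, hasq] with ω hN hsum hsq hDlim hhlim
  have hDs := F.weight_pos
  set x : ℕ → S → ℝ := fun n => weightedError D Xs (X n ω) with hx
  set m : ℕ → ℝ := fun n => partialSups (fun k => 1 + ‖x k‖) n with hm
  have hxm : ∀ n, 1 + ‖x n‖ ≤ m n := fun n => le_partialSups (fun k => 1 + ‖x k‖) n
  have hm1 : ∀ n, 0 < m n := fun n => by linarith [hxm n, norm_nonneg (x n)]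
  -- the coefficients of the noise grow at most like the running maximum of the errors
  have helim : ∀ s, Tendsto (fun n => e s n ω) atTop (𝓝 (D (some s) * κ s / D (some s))) :=
    fun s => tendsto_const_nhds.div (hDlim (some s)) (hDs s).ne'
  have hcb : ∀ s j, ∃ C, 0 < C ∧ ∀ n, 1 + |c s j n ω| ≤ C * (1 + ‖x n‖) := by
    rintro s ⟨o, b⟩
    -- A convergent sequence is bounded at all times, including those where the weight in `e` is
    -- zero and `e` has the value `0`.
    obtain ⟨B, hB0, hB⟩ := exists_abs_le_of_tendsto ((helim s).mul (hDlim o))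
    have hz : ∃ Z, 0 ≤ Z ∧ ∀ n, |(if b then lam else disc * atNext (X n ω) o)|
        ≤ Z * (1 + ‖x n‖) := by
      cases b
      · cases o with
        | none => exact ⟨0, le_rfl, fun n => by simp [atNext]⟩
        | some t =>
          have hi := inv_pos.2 (hDs t)
          refine ⟨|disc| * ((D (some t))⁻¹ + |Xs t|), by positivity, fun n => ?_⟩
          have h1 := abs_sub_le_of_weightedError hDs (Xs := Xs) (X n ω) t
          have h2 := abs_add_le (X n ω t - Xs t) (Xs t)
          rw [sub_add_cancel] at h2
          simp only [atNext, Bool.false_eq_true, if_false]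
          rw [abs_mul, mul_assoc]
          refine mul_le_mul_of_nonneg_left ?_ (abs_nonneg _)
          have h3 : 0 ≤ |Xs t| * ‖x n‖ := by positivity
          have h4 : (D (some t))⁻¹ * ‖weightedError D Xs (X n ω)‖ = (D (some t))⁻¹ * ‖x n‖ := rfl
          linarith
      · refine ⟨|lam|, abs_nonneg _, fun n => ?_⟩
        simp only [if_true]
        exact le_mul_of_one_le_right (abs_nonneg _) (by linarith [norm_nonneg (x n)])
    obtain ⟨Z, hZ0, hZ⟩ := hz
    refine ⟨1 + B * Z, by positivity, fun n => ?_⟩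
    have e1 : c s (o, b) n ω
        = (e s n ω * D' n ω o) * (if b then lam else disc * atNext (X n ω) o) := by
      cases b <;> simp [hc, obsCoef, mul_assoc]
    rw [e1, abs_mul]
    have h1 := mul_le_mul (hB n) (hZ n) (abs_nonneg _) hB0
    linarith [norm_nonneg (x n)]
  have hUj : ∀ s j, Tendsto (fun n => U s j n ω / m n) atTop (𝓝 0) := by
    intro s j
    obtain ⟨C, hC0, hC⟩ := hcb s j
    have h1 := (hN s j).abs.const_mul C
    rw [abs_zero, mul_zero] at h1
    refine squeeze_zero_norm (fun n => ?_) h1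
    have hg0 : 0 < partialSups (fun k => 1 + |c s j k ω|) n := by
      have := le_partialSups (fun k => 1 + |c s j k ω|) n
      linarith [abs_nonneg (c s j n ω)]
    have hgm : partialSups (fun k => 1 + |c s j k ω|) n ≤ C * m n := by
      refine partialSups_le _ _ _ fun k hk => (hC k).trans ?_
      exact mul_le_mul_of_nonneg_left ((hxm k).trans ((partialSups _).monotone hk)) hC0.le
    rw [Real.norm_eq_abs, abs_div, abs_div, abs_of_pos (hm1 n), abs_of_pos hg0, ← mul_div_assoc,
      div_le_div_iff₀ (hm1 n) hg0]
    calc |U s j n ω| * partialSups (fun k => 1 + |c s j k ω|) n ≤ |U s j n ω| * (C * m n) := by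
          gcongr
      _ = C * |U s j n ω| * m n := by ring
  obtain ⟨C, hC0, ε₀, hε₀, hF⟩ := F.exists_error_le
  have hconv : Tendsto x atTop (𝓝 0) := by
    refine tendsto_zero_of_asynchronous_contraction (U := fun n s => ∑ j, U s j n ω)
      (f := fun n s => weightedError D Xs
        (meanTarget ν κ lam disc (D' n ω) (h' n ω) (X n ω)) s)
      (a := fun n s => a s n ω) F.β_nonneg hβ (fun n s => ha0 s n ω) (fun s => ?_) hsum
      (fun n s => ?_) (fun δ hδ => ?_) (fun ε hε => ?_)
    · have := (hsq s).tendsto_atTop_zero.sqrt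
      simpa [Real.sqrt_sq (ha0 s _ ω)] using this
    · have hUs : ∑ j, U s j (n + 1) ω = (1 - a s n ω) * ∑ j, U s j n ω
          + a s n ω * ∑ j, c s j n ω * ξ j n ω := by
        simp only [hU, runningAverage, Finset.sum_add_distrib, Finset.mul_sum]
      rw [hUs]
      by_cases hs : St n ω = s
      · have h1 : a s n ω = α n ω := by simp [ha, hs]
        have h2 : x (n + 1) s = D (some s) * ((1 - α n ω) * X n ω s + α n ω *
            ((h' n ω s + κ s * (D' n ω (Nxt n ω) * (lam * Rew n ω +
              disc * atNext (X n ω) (Nxt n ω)))) / D' n ω (some s)) - Xs s) := by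
          simp only [hx, weightedError]; rw [hX, if_pos hs]
        -- The noise sum is the sample target minus `meanTarget`, in weighted form. Hence `x - U` is
        -- averaged towards the mean target alone.
        have h3 : ∑ j, c s j n ω * ξ j n ω = e s n ω *
            (D' n ω (Nxt n ω) * (lam * Rew n ω + disc * atNext (X n ω) (Nxt n ω)) -
              ∫ y, D' n ω y.2 * (lam * y.1 + disc * atNext (X n ω) y.2) ∂(ν s)) := by
          rw [integral_weighted_eq_sum (F.integrable s),
            weighted_eq_sum_stepObs lam disc (D' n ω) (X n ω) (Rew n ω, Nxt n ω),
            ← Finset.sum_sub_distrib, Finset.mul_sum]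
          refine Finset.sum_congr rfl fun j _ => ?_
          simp only [hc, hξ, hs]
          ring
        rw [h1, h2, h3]
        simp only [hx, weightedError, meanTarget, he]
        ring
      · have h1 : a s n ω = 0 := by simp [ha, hs]
        have h2 : x (n + 1) s = x n s := by
          simp only [hx, weightedError]; rw [hX, if_neg hs]
        rw [h1, h2]
        ring
    · set ε := min ε₀ (δ / (C + 1)) with hε
      have hε0 : 0 < ε := by positivity
      have hCε : C * ε ≤ δ := by
        have h1 : ε ≤ δ / (C + 1) := min_le_right _ _
        rw [le_div_iff₀ (by positivity)] at h1
        linarith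
      have e1 : ∀ᶠ n in atTop, ∀ o, |D' n ω o - D o| ≤ ε := eventually_all.2 fun o => by
        filter_upwards [Metric.tendsto_nhds.1 (hDlim o) ε hε0] with n hn using hn.le
      have e2 : ∀ᶠ n in atTop, ∀ s, |h' n ω s - h s| ≤ ε := eventually_all.2 fun s => by
        filter_upwards [Metric.tendsto_nhds.1 (hhlim s) ε hε0] with n hn using hn.le
      filter_upwards [e1, e2] with n h1 h2 s
      refine (hF ε hε0.le (min_le_left _ _) _ _ (X n ω) h1 h2 s).trans ?_
      gcongr
    · have hsumU : ∀ s, Tendsto (fun n => (∑ j, U s j n ω) / m n) atTop (𝓝 0) := fun s => by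
        simpa only [Finset.sum_div, Finset.sum_const_zero] using
          tendsto_finsetSum Finset.univ fun j _ => hUj s j
      refine eventually_all.2 fun s => ?_
      filter_upwards [Metric.tendsto_nhds.1 (hsumU s) ε hε] with n hn
      rw [Real.dist_eq, sub_zero, abs_div, abs_of_pos (hm1 n), div_lt_iff₀ (hm1 n)] at hn
      exact hn.le
  intro s
  have h1 : Tendsto (fun n => x n s) atTop (𝓝 0) := (tendsto_pi_nhds.1 hconv) s
  have h2 := (h1.const_mul (D (some s))⁻¹).add_const (Xs s)
  rw [mul_zero, zero_add] at h2
  refine h2.congr fun n => ?_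
  have := (hDs s).ne'
  simp only [hx, weightedError]
  field_simp
  ring

end OnlineTable

/-! ### The Markov property of the law of an episode -/

namespace EpisodicMDP

section Records

variable {S : Type*} {Φ : S → unitInterval}

/-- The information contained in the records up to time `n`. -/
noncomputable def history (S : Type*) : Filtration ℕ (MeasurableSpace.pi (X := fun _ : ℕ => Rec S)) :=
  Filtration.piLE (X := fun _ : ℕ => Rec S)

theorem measurable_history {E : Type*} [MeasurableSpace E] {g : Rec S → E} (hg : Measurable g)
    {k n : ℕ} (hk : k ≤ n) : Measurable[history S n] fun τ : ℕ → Rec S => g (τ k) := by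
  rw [history, Filtration.piLE_eq_comap_frestrictLe]
  have : (fun τ : ℕ → Rec S => g (τ k)) =
      (fun h : (i : Finset.Iic n) → Rec S => g (h ⟨k, Finset.mem_Iic.2 hk⟩)) ∘
        Preorder.frestrictLe (π := fun _ => Rec S) n := rfl
  rw [this]
  exact Measurable.comp (by fun_prop) (comap_measurable _)

theorem measurableSet_history {C : Set (Rec S)} (hC : MeasurableSet C) {k n : ℕ} (hk : k ≤ n) :
    MeasurableSet[history S n] {τ : ℕ → Rec S | τ k ∈ C} :=
  measurable_history measurable_id hk hC

theorem measurableSet_state_eq (o : Option S) : MeasurableSet {y : Rec S | y.1.2 = o} :=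
  (measurable_snd.comp measurable_fst) (MeasurableSet.of_discrete (s := {o}))

theorem measurableSet_unmarked : MeasurableSet {y : Rec S | y.2 = false} :=
  measurable_snd (MeasurableSet.of_discrete (s := {false}))

/-- The probability that no mark is made in the given state. -/
noncomputable def unmarkedProb (Φ : S → unitInterval) : Option S → ℝ
  | none => 1
  | some s => 1 - Φ s

theorem integral_markLaw (g : Bool → ℝ) (o : Option S) : ∫ z, g z ∂(markLaw Φ o) =
    (1 - unmarkedProb Φ o) * g true + unmarkedProb Φ o * g false := by
  cases o with
  | none => simp [markLaw, unmarkedProb]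
  | some s =>
    simp only [markLaw, unmarkedProb]
    rw [integral_bernoulliMeasure]
    simp

end Records

theorem integrable_policyStep {S A : Type*} [Fintype A] (M : EpisodicMDP S A) (π : S → PMF A) (s : S) :
    Integrable (fun x : ℝ × Option S => x.1) (M.policyStep π s) := by
  unfold policyStep
  exact integrable_finsetSum_measure.2 fun a _ =>
    (M.integrable_reward s a).smul_measure (PMF.apply_ne_top _ _)

variable {S A : Type*} [Fintype S] [Fintype A] (M : EpisodicMDP S A) (π : S → PMF A)
  (Φ : S → unitInterval)

/-- The law of the next record, given the current state. -/
noncomputable def nextLaw (o : Option S) : Measure (Rec S) :=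
  (M.stepKernel π ⊗ₖ Kernel.prodMkLeft (Option S) (markKernel Φ)) o

instance isProbabilityMeasure_nextLaw (o : Option S) : IsProbabilityMeasure (M.nextLaw π Φ o) := by
  unfold nextLaw; infer_instance

instance isProbabilityMeasure_stepOrStop (o : Option S) :
    IsProbabilityMeasure (M.stepOrStop π o) :=
  (isMarkovKernel_stepKernel M π).isProbabilityMeasure o

instance isProbabilityMeasure_law (ρ : PMF S) : IsProbabilityMeasure (M.law π Φ ρ) := by
  unfold law; infer_instance

variable {M π Φ}

/-- The joint law of the first records and the next one is the composition product with `recKernel`,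
and this kernel is constant where the current state is `o`. -/
theorem hasCondLaw_law (ρ : PMF S) (n : ℕ) : HasCondLaw (history S n) (M.law π Φ ρ)
    (Episode.state n) (fun τ => τ (n + 1)) (M.nextLaw π Φ) where
  le := (history S).le n
  measurableSet_state o := measurableSet_history (measurableSet_state_eq o) le_rfl
  measurable := measurable_pi_apply (n + 1)
  measure_inter o B hB C hC := by
    rw [history, Filtration.piLE_eq_comap_frestrictLe] at hB
    obtain ⟨B', hB', rfl⟩ := hB
    have hm : Measurable fun h : (i : Finset.Iic n) → Rec S => h ⟨n, Finset.mem_Iic.2 le_rfl⟩ :=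
      measurable_pi_apply _
    set G : Set ((i : Finset.Iic n) → Rec S) :=
      B' ∩ {h | (h ⟨n, Finset.mem_Iic.2 le_rfl⟩).1.2 = o} with hG
    have hGm : MeasurableSet G := hB'.inter (hm (measurableSet_state_eq o))
    have e1 : Preorder.frestrictLe (π := fun _ => Rec S) n ⁻¹' B' ∩ {τ | Episode.state n τ = o}
        = Preorder.frestrictLe (π := fun _ => Rec S) n ⁻¹' G := rfl
    rw [e1]
    have hmap := Kernel.map_frestrictLe_trajMeasure_compProd_eq_map_trajMeasure
      (X := fun _ => Rec S) (μ₀ := initLaw Φ ρ) (κ := M.recKernel π Φ) (a := n)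
    have h2 := congrArg (fun m => m (G ×ˢ C)) hmap
    rw [Measure.compProd_apply_prod hGm hC, Measure.map_apply (by fun_prop) (hGm.prod hC)] at h2
    have e2 : (fun x : ℕ → Rec S => (Preorder.frestrictLe (π := fun _ => Rec S) n x, x (n + 1)))
        ⁻¹' (G ×ˢ C) = Preorder.frestrictLe (π := fun _ => Rec S) n ⁻¹' G
          ∩ (fun τ => τ (n + 1)) ⁻¹' C := rfl
    rw [e2] at h2
    rw [law, ← h2, setLIntegral_congr_fun (g := fun _ => M.nextLaw π Φ o C) hGm, setLIntegral_const,
      Measure.map_apply (by fun_prop) hGm, mul_comm]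
    intro h hh
    have : (h ⟨n, Finset.mem_Iic.2 le_rfl⟩).1.2 = o := hh.2
    simp only [recKernel, Kernel.comap_apply, this, nextLaw]

theorem map_zero_law (ρ : PMF S) : (M.law π Φ ρ).map (fun τ => τ 0) = initLaw Φ ρ := by
  have h0 : (fun τ : ℕ → Rec S => τ 0) =
      (MeasurableEquiv.piUnique fun _ : Finset.Iic 0 => Rec S) ∘
        Preorder.frestrictLe (π := fun _ => Rec S) 0 := rfl
  rw [law, Kernel.trajMeasure, h0, ← Measure.map_map (by fun_prop) (by fun_prop),
    Measure.map_comp _ _ (by fun_prop), Kernel.traj_map_frestrictLe, Kernel.partialTraj_self,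
    Measure.id_comp, Measure.map_map (by fun_prop) (by fun_prop)]
  exact (congrArg (fun f => Measure.map f _) (by ext x <;> rfl)).trans Measure.map_id

theorem integrable_stepOrStop (M : EpisodicMDP S A) (π : S → PMF A) (o : Option S) :
    Integrable (fun x : ℝ × Option S => x.1) (M.stepOrStop π o) := by
  cases o with
  | none => exact integrable_dirac (by simp)
  | some s => exact integrable_policyStep M π s

theorem map_fst_nextLaw (o : Option S) : (M.nextLaw π Φ o).map Prod.fst = M.stepOrStop π o := by
  have h := Kernel.fst_compProd (M.stepKernel π) (Kernel.prodMkLeft (Option S) (markKernel Φ))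
  exact (Kernel.fst_apply _ _).symm.trans (congrArg (fun κ => κ o) h)

theorem integrable_nextLaw {g : ℝ × Option S → ℝ} {o : Option S}
    (hg : Integrable g (M.stepOrStop π o)) :
    Integrable (fun y : Rec S => g y.1) (M.nextLaw π Φ o) := by
  rw [← map_fst_nextLaw (Φ := Φ)] at hg
  exact hg.comp_measurable measurable_fst

theorem integral_nextLaw {g : ℝ × Option S → ℝ} {o : Option S}
    (hg : Integrable g (M.stepOrStop π o)) :
    ∫ y, g y.1 ∂(M.nextLaw π Φ o) = ∫ x, g x ∂(M.stepOrStop π o) := by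
  rw [← map_fst_nextLaw (Φ := Φ)] at hg ⊢
  exact (integral_map measurable_fst.aemeasurable hg.aestronglyMeasurable).symm

/-- Given reward and next state, the mark depends on the next state only, so integrating it out
leaves the factor `unmarkedProb`. -/
theorem integral_nextLaw_unmarked {g : ℝ × Option S → ℝ} {o : Option S}
    (hg : Integrable g (M.stepOrStop π o)) :
    ∫ y, {y : Rec S | y.2 = false}.indicator (fun y => g y.1) y ∂(M.nextLaw π Φ o) =
      ∫ x, unmarkedProb Φ x.2 * g x ∂(M.stepOrStop π o) := by
  have hi := (integrable_nextLaw (Φ := Φ) hg).indicator measurableSet_unmarked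
  unfold nextLaw at hi ⊢
  rw [integral_compProd hi]
  refine integral_congr_ae (Eventually.of_forall fun x => ?_)
  have : Kernel.prodMkLeft (Option S) (markKernel Φ) (o, x) = markLaw Φ x.2 := rfl
  simp only [this]
  rw [integral_markLaw fun z => {y : Rec S | y.2 = false}.indicator (fun y => g y.1) (x, z)]
  simp

variable (ρ : PMF S)

theorem setIntegral_next {n : ℕ} {B : Set (ℕ → Rec S)} (hB : MeasurableSet[history S n] B)
    {g : Rec S → ℝ} (hm : Measurable g) (hg : ∀ o, Integrable g (M.nextLaw π Φ o)) :
    ∫ τ in B, g (τ (n + 1)) ∂(M.law π Φ ρ) =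
      ∫ τ in B, (∫ y, g y ∂(M.nextLaw π Φ (Episode.state n τ))) ∂(M.law π Φ ρ) := by
  have H := hasCondLaw_law (M := M) (π := π) (Φ := Φ) ρ n
  rw [← setIntegral_condExp H.le (H.integrable hg) hB]
  exact setIntegral_congr_ae (H.le _ hB) ((H.condExp_eq hm hg).mono fun _ h _ => h)

/-- One step of the episode, on an event of the past. -/
theorem setIntegral_step {n : ℕ} {B : Set (ℕ → Rec S)} (hB : MeasurableSet[history S n] B)
    {g : ℝ × Option S → ℝ} (hm : Measurable g) (hg : ∀ o, Integrable g (M.stepOrStop π o)) :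
    ∫ τ in B, g (τ (n + 1)).1 ∂(M.law π Φ ρ) =
      ∫ τ in B, (∫ x, g x ∂(M.stepOrStop π (Episode.state n τ))) ∂(M.law π Φ ρ) := by
  have h := setIntegral_next (Φ := Φ) ρ hB (g := fun y => g y.1) (hm.comp measurable_fst)
    fun o => integrable_nextLaw (hg o)
  simpa only [integral_nextLaw (hg _)] using h

/-- One step of the episode without a mark, on an event of the past. -/
theorem setIntegral_step_unmarked {n : ℕ} {B : Set (ℕ → Rec S)}
    (hB : MeasurableSet[history S n] B) {g : ℝ × Option S → ℝ} (hm : Measurable g)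
    (hg : ∀ o, Integrable g (M.stepOrStop π o)) :
    ∫ τ in B ∩ {τ | (τ (n + 1)).2 = false}, g (τ (n + 1)).1 ∂(M.law π Φ ρ) =
      ∫ τ in B, (∫ x, unmarkedProb Φ x.2 * g x ∂(M.stepOrStop π (Episode.state n τ)))
        ∂(M.law π Φ ρ) := by
  have h := setIntegral_next (M := M) (π := π) (Φ := Φ) ρ hB
    (g := {y : Rec S | y.2 = false}.indicator fun y => g y.1)
    ((hm.comp measurable_fst).indicator measurableSet_unmarked)
    fun o => (integrable_nextLaw (hg o)).indicator measurableSet_unmarked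
  simp only [integral_nextLaw_unmarked (hg _)] at h
  rw [← h]
  have hC : MeasurableSet {τ : ℕ → Rec S | (τ (n + 1)).2 = false} :=
    (measurable_pi_apply (X := fun _ : ℕ => Rec S) (n + 1)) measurableSet_unmarked
  rw [Set.inter_comm, ← Measure.restrict_restrict hC, ← integral_indicator hC]
  rfl

theorem integrable_reward_law (k : ℕ) : Integrable (Episode.reward (k + 1)) (M.law π Φ ρ) :=
  (hasCondLaw_law ρ k).integrable (h := fun y => y.1.1)
    fun o => integrable_nextLaw (integrable_stepOrStop M π o)

/-- A bound on the expected absolute rewards. -/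
theorem integral_abs_reward_le : ∃ K, 0 ≤ K ∧ ∀ k,
    ∫ τ, |Episode.reward (k + 1) τ| ∂(M.law π Φ ρ) ≤ K := by
  set I : Option S → ℝ := fun o => ∫ x, |x.1| ∂(M.stepOrStop π o) with hI
  have hI0 : ∀ o, 0 ≤ I o := fun o => integral_nonneg fun _ => abs_nonneg _
  have hIK : ∀ o, I o ≤ ∑ o, I o := fun o =>
    Finset.single_le_sum (fun o _ => hI0 o) (Finset.mem_univ o)
  refine ⟨∑ o, I o, Finset.sum_nonneg fun o _ => hI0 o, fun k => ?_⟩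
  have h := setIntegral_step (M := M) (π := π) (Φ := Φ) ρ (n := k) (B := Set.univ)
    (@MeasurableSet.univ _ (history S k)) (g := fun x => |x.1|) measurable_fst.abs
    fun o => (integrable_stepOrStop M π o).abs
  rw [setIntegral_univ, setIntegral_univ] at h
  calc ∫ τ, |Episode.reward (k + 1) τ| ∂(M.law π Φ ρ)
      = ∫ τ, I (Episode.state k τ) ∂(M.law π Φ ρ) := h
    _ ≤ ∫ _, (∑ o, I o) ∂(M.law π Φ ρ) :=
        integral_mono_of_nonneg (Eventually.of_forall fun _ => hI0 _) (integrable_const _)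
          (Eventually.of_forall fun _ => hIK _)
    _ = ∑ o, I o := by simp

/-- Sum and integral may be exchanged because the expected absolute rewards are uniformly bounded
and the discounts are summable. -/
theorem hasSum_setIntegral_ret {γ : ℝ} (hγ0 : 0 ≤ γ) (hγ1 : γ < 1) (t : ℕ)
    (B : Set (ℕ → Rec S)) :
    HasSum (fun k => γ ^ k * ∫ τ in B, Episode.reward (t + k + 1) τ ∂(M.law π Φ ρ))
      (∫ τ in B, Episode.ret γ t τ ∂(M.law π Φ ρ)) := by
  obtain ⟨K, hK0, hK⟩ := integral_abs_reward_le (M := M) (π := π) (Φ := Φ) ρ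
  have hi : ∀ k, Integrable (fun τ => γ ^ k * Episode.reward (t + k + 1) τ)
      ((M.law π Φ ρ).restrict B) := fun k =>
    ((integrable_reward_law ρ (t + k)).const_mul _).integrableOn
  have h := hasSum_integral_of_summable_integral_norm (μ := (M.law π Φ ρ).restrict B) hi (by
    refine Summable.of_nonneg_of_le (fun k => integral_nonneg fun _ => norm_nonneg _) (fun k => ?_)
      ((summable_geometric_of_lt_one hγ0 hγ1).mul_right K)
    calc ∫ τ in B, ‖γ ^ k * Episode.reward (t + k + 1) τ‖ ∂(M.law π Φ ρ)
        ≤ ∫ τ, ‖γ ^ k * Episode.reward (t + k + 1) τ‖ ∂(M.law π Φ ρ) :=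
          setIntegral_le_integral ((integrable_reward_law ρ (t + k)).const_mul _).norm
            (Eventually.of_forall fun _ => norm_nonneg _)
      _ = γ ^ k * ∫ τ, |Episode.reward (t + k + 1) τ| ∂(M.law π Φ ρ) := by
          rw [← integral_const_mul]
          simp only [norm_mul, norm_pow, Real.norm_eq_abs, abs_of_nonneg hγ0]
      _ ≤ γ ^ k * K := mul_le_mul_of_nonneg_left (hK (t + k)) (pow_nonneg hγ0 k))
  simp only [integral_const_mul] at h
  exact h

end EpisodicMDP

/-! ### Affine fixed points and telescoping sums -/

theorem exists_lt_one_forall_le {S : Type*} [Finite S] (f : S → ℝ) (hf : ∀ s, f s < 1) :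
    ∃ β, 0 ≤ β ∧ β < 1 ∧ ∀ s, f s ≤ β := by
  obtain ⟨m, hm⟩ := Finite.exists_le fun s =>
    (⟨max (f s) 0, le_max_right _ _, max_lt (hf s) one_pos⟩ : Set.Ico (0 : ℝ) 1)
  exact ⟨m, m.2.1, m.2.2, fun s => (le_max_left _ _).trans (Subtype.coe_le_coe.2 (hm s))⟩

section NextState

variable {S : Type*}

theorem measurable_comp_next (g : Option S → ℝ) : Measurable fun x : ℝ × Option S => g x.2 :=
  (Measurable.of_discrete (f := g)).comp measurable_snd

variable [Fintype S]

theorem abs_le_sum_abs (g : Option S → ℝ) (o : Option S) : |g o| ≤ ∑ o, |g o| :=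
  Finset.single_le_sum (f := fun o => |g o|) (fun _ _ => abs_nonneg _) (Finset.mem_univ o)

theorem integrable_comp_next (μ : Measure (ℝ × Option S)) [IsFiniteMeasure μ] (g : Option S → ℝ) :
    Integrable (fun x : ℝ × Option S => g x.2) μ :=
  Integrable.of_bound (measurable_comp_next g).aestronglyMeasurable _
    (Eventually.of_forall fun x => abs_le_sum_abs g x.2)

theorem integrable_comp_next_mul_fst {μ : Measure (ℝ × Option S)} [IsFiniteMeasure μ]
    (hμ : Integrable (fun x : ℝ × Option S => x.1) μ) (g : Option S → ℝ) :
    Integrable (fun x : ℝ × Option S => g x.2 * x.1) μ :=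
  hμ.bdd_mul (measurable_comp_next g).aestronglyMeasurable
    (Eventually.of_forall fun x => abs_le_sum_abs g x.2)

/-- Banach's theorem: averaging over the next state does not increase the sup distance, and finitely
many `κ s < 1` have a common bound below `1`. -/
theorem exists_affine_fixedPoint (ν : S → Measure (ℝ × Option S)) [∀ s, IsProbabilityMeasure (ν s)]
    (h κ : S → ℝ) (hκ0 : ∀ s, 0 ≤ κ s) (hκ1 : ∀ s, κ s < 1) :
    ∃ X : S → ℝ, ∀ s, X s = h s + κ s * ∫ x, atNext X x.2 ∂(ν s) := by
  obtain ⟨β, hβ0, hβ1, hβ⟩ := exists_lt_one_forall_le κ hκ1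
  set T : (S → ℝ) → S → ℝ := fun X s => h s + κ s * ∫ x, atNext X x.2 ∂(ν s) with hT
  have hc : ContractingWith ⟨β, hβ0⟩ T := by
    refine ⟨hβ1, LipschitzWith.of_dist_le_mul fun X Y => ?_⟩
    rw [dist_pi_le_iff (by positivity)]
    intro s
    have e : T X s - T Y s = κ s * ∫ x, (atNext X x.2 - atNext Y x.2) ∂(ν s) := by
      rw [integral_sub (integrable_comp_next _ _) (integrable_comp_next _ _)]
      simp only [hT]; ring
    have hd : ∀ o, ‖atNext X o - atNext Y o‖ ≤ dist X Y := fun o => by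
      cases o with
      | none => simp [atNext]
      | some s => exact dist_le_pi_dist X Y s
    have hi := norm_integral_le_of_norm_le_const (μ := ν s)
      (Eventually.of_forall fun x : ℝ × Option S => hd x.2)
    rw [probReal_univ, mul_one] at hi
    rw [Real.dist_eq, e, abs_mul, abs_of_nonneg (hκ0 s)]
    exact mul_le_mul (hβ s) hi (abs_nonneg _) hβ0
  exact ⟨_, fun s => (congrFun hc.fixedPoint_isFixedPt s).symm⟩

end NextState

/-- The partial sums are `b 0 - γ ^ K * b K`. This is how a solution of a Bellman equation is
recognised as an expected return. -/
theorem eq_of_hasSum_telescoping {e b : ℕ → ℝ} {γ C L : ℝ} (hγ0 : 0 ≤ γ) (hγ1 : γ < 1)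
    (hstep : ∀ k, b k = e k + γ * b (k + 1)) (hb : ∀ k, |b k| ≤ C)
    (hs : HasSum (fun k => γ ^ k * e k) L) : L = b 0 := by
  have h1 : ∀ K, ∑ k ∈ Finset.range K, γ ^ k * e k = b 0 - γ ^ K * b K := by
    intro K
    induction K with
    | zero => simp
    | succ K ih =>
      rw [Finset.sum_range_succ, ih, pow_succ]
      linear_combination -γ ^ K * hstep K
  have h2 : Tendsto (fun K => γ ^ K * b K) atTop (𝓝 0) := by
    have h3 := (tendsto_pow_atTop_nhds_zero_of_lt_one hγ0 hγ1).mul_const C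
    rw [zero_mul] at h3
    refine squeeze_zero_norm (fun K => ?_) h3
    rw [norm_mul, norm_pow, Real.norm_eq_abs, Real.norm_eq_abs, abs_of_nonneg hγ0]
    exact mul_le_mul_of_nonneg_left (hb K) (pow_nonneg hγ0 K)
  refine tendsto_nhds_unique hs.tendsto_sum_nat ?_
  simp only [h1]
  simpa using h2.const_sub (b 0)

/-! ### Linear value equations and events without marks -/

namespace EpisodicMDP

/-- Solutions of the recursions for `v`, `v^∞` and `w(s) = E[G; Z^∞ = 0 | s]`. -/
structure IsValueSolution {S A : Type*} [Fintype A] (M : EpisodicMDP S A) (π : S → PMF A)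
    (Φ : S → unitInterval) (γ : ℝ) (v vinf w : S → ℝ) : Prop where
  v_eq : ∀ s, v s = ∫ x, (x.1 + γ * atNext v x.2) ∂(M.policyStep π s)
  vinf_eq : ∀ s, vinf s = Φ s + (1 - Φ s) * ∫ x, atNext vinf x.2 ∂(M.policyStep π s)
  w_eq : ∀ s, w s = (1 - Φ s) *
    ∫ x, ((1 - atNext vinf x.2) * x.1 + γ * atNext w x.2) ∂(M.policyStep π s)

/-- The probability of no mark after the present time, given the present state. -/
noncomputable def noMarkProb {S A : Type*} [Fintype A] (M : EpisodicMDP S A) (π : S → PMF A)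
    (vinf : S → ℝ) (o : Option S) : ℝ := ∫ x, (1 - atNext vinf x.2) ∂(M.stepOrStop π o)

/-- The expected return on the event of no mark after the present time, given the present state. -/
noncomputable def noMarkReturn {S A : Type*} [Fintype A] (M : EpisodicMDP S A) (π : S → PMF A)
    (γ : ℝ) (vinf w : S → ℝ) (o : Option S) : ℝ :=
  ∫ x, ((1 - atNext vinf x.2) * x.1 + γ * atNext w x.2) ∂(M.stepOrStop π o)

/-- No mark at the times `n + 1, …, n + k`. -/
def noMarkWithin {S : Type*} (n k : ℕ) : Set (ℕ → Rec S) :=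
  {τ | ∀ j, n < j → j ≤ n + k → (τ j).2 = false}

/-- No mark after time `n`. -/
def noMarkAfter {S : Type*} (n : ℕ) : Set (ℕ → Rec S) := {τ | ∀ j, n < j → (τ j).2 = false}

theorem integral_stepOrStop_none {S A : Type*} [Fintype A] (M : EpisodicMDP S A) (π : S → PMF A)
    (g : ℝ × Option S → ℝ) : ∫ x, g x ∂(M.stepOrStop π none) = g (0, none) :=
  integral_dirac _ _

section Events

variable {S : Type*}

theorem noMarkWithin_zero (n : ℕ) : noMarkWithin (S := S) n 0 = Set.univ :=
  Set.eq_univ_of_forall fun τ j h1 h2 => by omega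

theorem noMarkWithin_succ (n k : ℕ) : noMarkWithin (S := S) n (k + 1) =
    noMarkWithin n k ∩ {τ | (τ (n + k + 1)).2 = false} := by
  ext τ
  constructor
  · exact fun h => ⟨fun j h1 h2 => h j h1 (by omega), h _ (by omega) (by omega)⟩
  · rintro ⟨h1, h2⟩ j h3 h4
    rcases Nat.lt_or_ge (n + k) j with h5 | h5
    · obtain rfl : j = n + k + 1 := by omega
      exact h2
    · exact h1 j h3 h5

theorem noMarkWithin_inter_noMarkAfter (n k : ℕ) :
    noMarkWithin (S := S) n k ∩ noMarkAfter (n + k) = noMarkAfter n := by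
  ext τ
  constructor
  · rintro ⟨h1, h2⟩ j h3
    rcases Nat.lt_or_ge (n + k) j with h5 | h5
    · exact h2 j h5
    · exact h1 j h3 h5
  · exact fun h => ⟨fun j h1 _ => h j h1, fun j h1 => h j (by omega)⟩

theorem iInter_noMarkWithin (n : ℕ) : ⋂ k, noMarkWithin (S := S) n k = noMarkAfter n := by
  ext τ
  simp only [Set.mem_iInter]
  exact ⟨fun h j hj => h j j hj (by omega), fun h k j h1 _ => h j h1⟩

theorem measurableSet_history_noMarkWithin (n k : ℕ) :
    MeasurableSet[history S (n + k)] (noMarkWithin n k) := by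
  induction k with
  | zero => rw [noMarkWithin_zero]; exact @MeasurableSet.univ _ (history S _)
  | succ k ih =>
    rw [noMarkWithin_succ]
    exact @MeasurableSet.inter _ (history S _) _ _ ((history S).mono (by omega) _ ih)
      (measurableSet_history measurableSet_unmarked (by omega))

theorem measurableSet_noMarkAfter (n : ℕ) : MeasurableSet (noMarkAfter (S := S) n) := by
  rw [← iInter_noMarkWithin]
  exact MeasurableSet.iInter fun k => (history S).le _ _ (measurableSet_history_noMarkWithin n k)

end Events

variable {S A : Type*} [Fintype A] {M : EpisodicMDP S A} {π : S → PMF A}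
  {Φ : S → unitInterval} {γ : ℝ} {v vinf w : S → ℝ}

/-- The contraction factors are `γ`, `1 - Φ` and `(1 - Φ) γ`. The equation for `w` comes last, since
`vinf` enters its inhomogeneous term. -/
theorem exists_isValueSolution [Fintype S] (M : EpisodicMDP S A) (π : S → PMF A) {Φ : S → unitInterval}
    {γ : ℝ} (hγ0 : 0 ≤ γ) (hγ1 : γ < 1) (hΦ : ∀ s, 0 < Φ s) :
    ∃ v vinf w, IsValueSolution M π Φ γ v vinf w := by
  have hκ0 : ∀ s, 0 ≤ 1 - (Φ s : ℝ) := fun s => sub_nonneg.2 (Φ s).2.2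
  have hκ1 : ∀ s, 1 - (Φ s : ℝ) < 1 := fun s => sub_lt_self _ (hΦ s)
  obtain ⟨v, hv⟩ := exists_affine_fixedPoint (M.policyStep π)
    (fun s => ∫ x, x.1 ∂(M.policyStep π s)) (fun _ => γ) (fun _ => hγ0) fun _ => hγ1
  obtain ⟨vinf, hvinf⟩ := exists_affine_fixedPoint (M.policyStep π)
    (fun s => (Φ s : ℝ)) (fun s => 1 - Φ s) hκ0 hκ1
  obtain ⟨w, hw⟩ := exists_affine_fixedPoint (M.policyStep π)
    (fun s => (1 - Φ s) * ∫ x, (1 - atNext vinf x.2) * x.1 ∂(M.policyStep π s))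
    (fun s => (1 - Φ s) * γ) (fun s => mul_nonneg (hκ0 s) hγ0)
    fun s => (mul_le_of_le_one_left hγ0 (hκ1 s).le).trans_lt hγ1
  refine ⟨v, vinf, w, fun s => ?_, hvinf, fun s => ?_⟩
  · rw [integral_add (integrable_policyStep M π s) ((integrable_comp_next _ _).const_mul γ),
      integral_const_mul]
    exact hv s
  · rw [integral_add (integrable_comp_next_mul_fst (integrable_policyStep M π s)
      fun o => 1 - atNext vinf o) ((integrable_comp_next _ _).const_mul γ), integral_const_mul,
      hw s]
    ring

namespace IsValueSolution

theorem integral_v (h : IsValueSolution M π Φ γ v vinf w) (o : Option S) :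
    ∫ x, (x.1 + γ * atNext v x.2) ∂(M.stepOrStop π o) = atNext v o := by
  cases o with
  | none =>
    rw [integral_stepOrStop_none]
    simp [atNext]
  | some s => exact (h.v_eq s).symm

theorem one_sub_vinf [Fintype S] (h : IsValueSolution M π Φ γ v vinf w) (o : Option S) :
    1 - atNext vinf o = unmarkedProb Φ o * noMarkProb M π vinf o := by
  unfold noMarkProb
  cases o with
  | none =>
    rw [integral_stepOrStop_none]
    simp [atNext, unmarkedProb]
  | some s =>
    rw [integral_sub (integrable_const _) (integrable_comp_next _ _)]
    have h1 : ∫ x, atNext vinf x.2 ∂(M.stepOrStop π (some s))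
      = ∫ x, atNext vinf x.2 ∂(M.policyStep π s) := rfl
    have h2 : 1 - atNext vinf (some s) = 1 - vinf s := rfl
    rw [h1, h2, integral_const, probReal_univ, one_smul, unmarkedProb]
    linear_combination -h.vinf_eq s

theorem atNext_w (h : IsValueSolution M π Φ γ v vinf w) (o : Option S) :
    atNext w o = unmarkedProb Φ o * noMarkReturn M π γ vinf w o := by
  cases o with
  | none =>
    unfold noMarkReturn
    rw [integral_stepOrStop_none]
    simp [atNext]
  | some s => exact h.w_eq s

end IsValueSolution

end EpisodicMDP

namespace EpisodicMDP

variable {S A : Type*} [Fintype S] [Fintype A] {M : EpisodicMDP S A} {π : S → PMF A}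
  {Φ : S → unitInterval} {γ : ℝ} {v vinf w : S → ℝ} (ρ : PMF S)

theorem integrable_comp_state (μ : Measure (ℕ → Rec S)) [IsFiniteMeasure μ] (g : Option S → ℝ)
    (n : ℕ) : Integrable (fun τ => g (Episode.state n τ)) μ := by
  have hm : Measurable fun y : Rec S => g y.1.2 := (measurable_comp_next g).comp measurable_fst
  exact Integrable.of_bound (hm.comp (measurable_pi_apply n)).aestronglyMeasurable
    (∑ o, |g o|) (Eventually.of_forall fun τ => abs_le_sum_abs g (Episode.state n τ))

theorem abs_setIntegral_comp_state_le (B : Set (ℕ → Rec S)) (g : Option S → ℝ) (n : ℕ) :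
    |∫ τ in B, g (Episode.state n τ) ∂(M.law π Φ ρ)| ≤ ∑ o, |g o| := by
  have h := norm_setIntegral_le_of_norm_le_const (μ := M.law π Φ ρ) (s := B)
    (measure_lt_top _ _) (f := fun τ => g (Episode.state n τ)) (C := ∑ o, |g o|)
    fun τ _ => abs_le_sum_abs g _
  exact h.trans (mul_le_of_le_one_right (Finset.sum_nonneg fun _ _ => abs_nonneg _)
    measureReal_le_one)

/-- The probability of not having seen a mark while the episode goes on decays geometrically. -/
theorem tendsto_noMarkWithin_alive (hΦ : ∀ s, 0 < Φ s) {n : ℕ} {B : Set (ℕ → Rec S)}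
    (hB : MeasurableSet[history S n] B) :
    Tendsto (fun k => ∫ τ in B ∩ noMarkWithin n k,
      (fun o : Option S => o.elim 0 fun _ => (1 : ℝ)) (Episode.state (n + k) τ) ∂(M.law π Φ ρ))
      atTop (𝓝 0) := by
  set f : Option S → ℝ := fun o => o.elim 0 fun _ => (1 : ℝ) with hf
  have hf0 : ∀ o, 0 ≤ f o := fun o => by cases o <;> simp [hf]
  obtain ⟨β, hβ0, hβ1, hβ⟩ := exists_lt_one_forall_le (fun s => 1 - (Φ s : ℝ))
    fun s => sub_lt_self _ (hΦ s)
  have hBk : ∀ k, MeasurableSet[history S (n + k)] (B ∩ noMarkWithin n k) := fun k =>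
    @MeasurableSet.inter _ (history S (n + k)) _ _ ((history S).mono (by omega) _ hB)
      (measurableSet_history_noMarkWithin n k)
  -- Here `f` indicates that the episode is still running; each running state is left unmarked with
  -- probability at most `β`.
  have hstep : ∀ o, ∫ x, unmarkedProb Φ x.2 * f x.2 ∂(M.stepOrStop π o) ≤ β * f o := by
    intro o
    have hp : ∀ o', unmarkedProb Φ o' * f o' ≤ β := fun o' => by
      cases o' with
      | none => simpa [hf] using hβ0
      | some s => simpa [hf, unmarkedProb] using hβ s
    cases o with
    | none => rw [integral_stepOrStop_none]; simp [hf]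
    | some s =>
      have := integral_mono (μ := M.stepOrStop π (some s))
        (integrable_comp_next _ fun o => unmarkedProb Φ o * f o) (integrable_const β)
        fun x => hp x.2
      simpa [hf] using this
  set e : ℕ → ℝ := fun k => ∫ τ in B ∩ noMarkWithin n k, f (Episode.state (n + k) τ)
    ∂(M.law π Φ ρ) with he
  have hrec : ∀ k, e (k + 1) ≤ β * e k := by
    intro k
    have h1 := setIntegral_step_unmarked (M := M) (π := π) (Φ := Φ) ρ (hBk k)
      (measurable_comp_next f) fun o => integrable_comp_next _ f
    rw [Set.inter_assoc, ← noMarkWithin_succ] at h1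
    calc e (k + 1) = _ := h1
      _ ≤ ∫ τ in B ∩ noMarkWithin n k, β * f (Episode.state (n + k) τ) ∂(M.law π Φ ρ) :=
          integral_mono (integrable_comp_state _ (fun o => ∫ x, unmarkedProb Φ x.2 * f x.2
            ∂(M.stepOrStop π o)) _) ((integrable_comp_state _ f _).const_mul β)
            fun τ => hstep _
      _ = β * e k := integral_const_mul _ _
  have hpow : ∀ k, e k ≤ β ^ k * e 0 := by
    intro k
    induction k with
    | zero => simp
    | succ k ih =>
      calc e (k + 1) ≤ β * e k := hrec k
        _ ≤ β * (β ^ k * e 0) := mul_le_mul_of_nonneg_left ih hβ0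
        _ = β ^ (k + 1) * e 0 := by ring
  have hlim : Tendsto (fun k => β ^ k * e 0) atTop (𝓝 0) := by
    simpa using (tendsto_pow_atTop_nhds_zero_of_lt_one hβ0 hβ1).mul_const (e 0)
  exact tendsto_of_tendsto_of_tendsto_of_le_of_le tendsto_const_nhds hlim
    (fun k => integral_nonneg fun τ => hf0 _) hpow

namespace IsValueSolution

/-- `noMarkProb` is the conditional probability of no mark in the future. -/
theorem measureReal_inter_noMarkAfter (h : IsValueSolution M π Φ γ v vinf w)
    (hΦ : ∀ s, 0 < Φ s) {n : ℕ} {B : Set (ℕ → Rec S)} (hB : MeasurableSet[history S n] B) :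
    (M.law π Φ ρ).real (B ∩ noMarkAfter n) =
      ∫ τ in B, noMarkProb M π vinf (Episode.state n τ) ∂(M.law π Φ ρ) := by
  set q := noMarkProb M π vinf with hq
  set μ := M.law π Φ ρ with hμ
  have hBk : ∀ k, MeasurableSet[history S (n + k)] (B ∩ noMarkWithin n k) := fun k =>
    @MeasurableSet.inter _ (history S (n + k)) _ _ ((history S).mono (by omega) _ hB)
      (measurableSet_history_noMarkWithin n k)
  have hBm : ∀ k, MeasurableSet (B ∩ noMarkWithin n k) := fun k =>
    (history S).le _ _ (hBk k)
  -- By `one_sub_vinf`, `q` is harmonic for the process killed at its first mark.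
  have hconst : ∀ k, ∫ τ in B ∩ noMarkWithin n k, q (Episode.state (n + k) τ) ∂μ =
      ∫ τ in B, q (Episode.state n τ) ∂μ := by
    intro k
    induction k with
    | zero => simp [noMarkWithin_zero]
    | succ k ih =>
      rw [← ih]
      have h1 := setIntegral_step_unmarked (M := M) (π := π) (Φ := Φ) ρ (hBk k)
        (measurable_comp_next q) fun o => integrable_comp_next _ q
      rw [Set.inter_assoc, ← noMarkWithin_succ] at h1
      refine (show _ = _ from h1).trans ?_
      simp only [hq, ← h.one_sub_vinf]
      rfl
  have hq0 : q none = 1 := by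
    have := h.one_sub_vinf none
    simpa [atNext, unmarkedProb] using this.symm
  have halive := tendsto_noMarkWithin_alive (M := M) (π := π) ρ hΦ hB
  set f : Option S → ℝ := fun o => o.elim 0 fun _ => (1 : ℝ) with hf
  set C := ∑ o, |1 - q o| with hC
  -- Since `q none = 1`, replacing `q` by `1` costs only on paths still running without a mark,
  -- whose mass vanishes.
  have hdiff : ∀ k, |μ.real (B ∩ noMarkWithin n k) - ∫ τ in B, q (Episode.state n τ) ∂μ| ≤
      C * ∫ τ in B ∩ noMarkWithin n k, f (Episode.state (n + k) τ) ∂μ := by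
    intro k
    have e1 : μ.real (B ∩ noMarkWithin n k) = ∫ τ in B ∩ noMarkWithin n k, (1 : ℝ) ∂μ := by simp
    rw [← hconst k, e1, ← integral_sub (μ := μ.restrict (B ∩ noMarkWithin n k)) (integrable_const _)
      (integrable_comp_state _ q _),
      ← integral_const_mul]
    rw [← Real.norm_eq_abs]
    refine norm_integral_le_of_norm_le
      ((integrable_comp_state (μ.restrict (B ∩ noMarkWithin n k)) f _).const_mul C)
      (Eventually.of_forall fun τ => ?_)
    generalize Episode.state (n + k) τ = o
    cases o with
    | none => simp [hq0, hf]
    | some s =>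
      simp only [hf, Option.elim_some, mul_one, Real.norm_eq_abs]
      exact abs_le_sum_abs (fun o => 1 - q o) (some s)
  have hlim1 : Tendsto (fun k => μ.real (B ∩ noMarkWithin n k)) atTop
      (𝓝 (∫ τ in B, q (Episode.state n τ) ∂μ)) := by
    rw [tendsto_iff_norm_sub_tendsto_zero]
    refine squeeze_zero (fun _ => norm_nonneg _) hdiff ?_
    simpa using halive.const_mul C
  have hanti : Antitone fun k => B ∩ noMarkWithin (S := S) n k :=
    antitone_nat_of_succ_le fun k => by
      rw [noMarkWithin_succ, ← Set.inter_assoc]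
      exact Set.inter_subset_left
  have hlim2 := tendsto_measure_iInter_atTop (μ := μ) (fun k => (hBm k).nullMeasurableSet) hanti
    ⟨0, measure_ne_top _ _⟩
  rw [← Set.inter_iInter, iInter_noMarkWithin] at hlim2
  exact tendsto_nhds_unique ((ENNReal.tendsto_toReal (measure_ne_top _ _)).comp hlim2) hlim1

/-- The expected return on an event of the past. -/
theorem setIntegral_ret (h : IsValueSolution M π Φ γ v vinf w) (hγ0 : 0 ≤ γ) (hγ1 : γ < 1)
    {n : ℕ} {B : Set (ℕ → Rec S)} (hB : MeasurableSet[history S n] B) :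
    ∫ τ in B, Episode.ret γ n τ ∂(M.law π Φ ρ) =
      ∫ τ in B, atNext v (Episode.state n τ) ∂(M.law π Φ ρ) := by
  refine eq_of_hasSum_telescoping (b := fun k => ∫ τ in B, atNext v (Episode.state (n + k) τ)
    ∂(M.law π Φ ρ)) hγ0 hγ1 (fun k => ?_)
    (fun k => abs_setIntegral_comp_state_le ρ B (atNext v) (n + k))
    (hasSum_setIntegral_ret ρ hγ0 hγ1 n B)
  have h1 := setIntegral_step (M := M) (π := π) (Φ := Φ) ρ (n := n + k)
    ((history S).mono (by omega) _ hB)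
    (measurable_fst.add ((measurable_comp_next (atNext v)).const_mul γ))
    fun o => (integrable_stepOrStop M π o).add ((integrable_comp_next _ (atNext v)).const_mul γ)
  have h2 : ∫ τ in B, (Episode.reward (n + k + 1) τ + γ * atNext v (Episode.state (n + k + 1) τ))
      ∂(M.law π Φ ρ) = ∫ τ in B, (∫ x, (x.1 + γ * atNext v x.2)
        ∂(M.stepOrStop π (Episode.state (n + k) τ))) ∂(M.law π Φ ρ) := h1
  simp only [h.integral_v] at h2
  rw [← h2, integral_add (integrable_reward_law ρ _).integrableOn
    ((integrable_comp_state _ (atNext v) _).const_mul γ), integral_const_mul]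
  rfl

/-- The reward is known at time `n + 1`, so it can be taken out of the conditional expectation of
the indicator of no later mark, which is `noMarkProb` of the state. -/
theorem setIntegral_reward_inter_noMarkAfter (h : IsValueSolution M π Φ γ v vinf w)
    (hΦ : ∀ s, 0 < Φ s) {n : ℕ} {B : Set (ℕ → Rec S)}
    (hB : MeasurableSet[history S (n + 1)] B) :
    ∫ τ in B ∩ noMarkAfter (n + 1), Episode.reward (n + 1) τ ∂(M.law π Φ ρ) =
      ∫ τ in B, noMarkProb M π vinf (Episode.state (n + 1) τ) * Episode.reward (n + 1) τ
        ∂(M.law π Φ ρ) := by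
  set q := noMarkProb M π vinf with hq
  set μ := M.law π Φ ρ with hμ
  have hEm := measurableSet_noMarkAfter (S := S) (n + 1)
  set g : (ℕ → Rec S) → ℝ := (noMarkAfter (n + 1)).indicator fun _ => 1 with hg
  have hgi : Integrable g μ := (integrable_const 1).indicator hEm
  have H := hasCondLaw_law (M := M) (π := π) (Φ := Φ) ρ (n + 1)
  have hce : (fun τ => q (Episode.state (n + 1) τ)) =ᵐ[μ] μ[g | history S (n + 1)] := by
    refine ae_eq_condExp_of_forall_setIntegral_eq H.le hgi
      (fun _ _ _ => (integrable_comp_state μ q _).integrableOn) (fun C hC _ => ?_)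
      (H.stronglyMeasurable q).aestronglyMeasurable
    rw [← h.measureReal_inter_noMarkAfter ρ hΦ hC, hg, setIntegral_indicator hEm]
    simp [hμ]
  have hR : Measurable[history S (n + 1)] (Episode.reward (S := S) (n + 1)) :=
    measurable_history (g := fun y : Rec S => y.1.1) (by fun_prop) le_rfl
  have hRg : Episode.reward (n + 1) * g = (noMarkAfter (n + 1)).indicator
      (Episode.reward (S := S) (n + 1)) := by
    ext τ
    by_cases hτ : τ ∈ noMarkAfter (n + 1) <;> simp [hg, hτ]
  have hRi : Integrable (Episode.reward (n + 1) * g) μ := by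
    rw [hRg]; exact (integrable_reward_law ρ n).indicator hEm
  have hpull := condExp_mul_of_stronglyMeasurable_left hR.stronglyMeasurable hRi hgi
  rw [← setIntegral_indicator hEm, ← hRg]
  have h1 := setIntegral_condExp H.le hRi hB
  refine h1.symm.trans (setIntegral_congr_ae (H.le _ hB) ?_)
  filter_upwards [hpull, hce] with τ h2 h3 _
  rw [h2, Pi.mul_apply, ← h3, mul_comm]

/-- The expected return on an event of the past without marks in the future. -/
theorem setIntegral_ret_inter_noMarkAfter (h : IsValueSolution M π Φ γ v vinf w)
    (hγ0 : 0 ≤ γ) (hγ1 : γ < 1) (hΦ : ∀ s, 0 < Φ s) {n : ℕ} {B : Set (ℕ → Rec S)}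
    (hB : MeasurableSet[history S n] B) :
    ∫ τ in B ∩ noMarkAfter n, Episode.ret γ n τ ∂(M.law π Φ ρ) =
      ∫ τ in B, noMarkReturn M π γ vinf w (Episode.state n τ) ∂(M.law π Φ ρ) := by
  set q := noMarkProb M π vinf with hq
  set u := noMarkReturn M π γ vinf w with hu
  have hBk : ∀ k, MeasurableSet[history S (n + k)] (B ∩ noMarkWithin n k) := fun k =>
    @MeasurableSet.inter _ (history S (n + k)) _ _ ((history S).mono (by omega) _ hB)
      (measurableSet_history_noMarkWithin n k)
  have h0 : ∫ τ in B, u (Episode.state n τ) ∂(M.law π Φ ρ) =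
      ∫ τ in B ∩ noMarkWithin n 0, u (Episode.state (n + 0) τ) ∂(M.law π Φ ρ) := by
    simp [noMarkWithin_zero]
  rw [h0]
  refine eq_of_hasSum_telescoping (b := fun k => ∫ τ in B ∩ noMarkWithin n k,
    u (Episode.state (n + k) τ) ∂(M.law π Φ ρ)) hγ0 hγ1 (fun k => ?_)
    (fun k => abs_setIntegral_comp_state_le ρ _ u (n + k))
    (hasSum_setIntegral_ret ρ hγ0 hγ1 n (B ∩ noMarkAfter n))
  have hi : ∀ o, Integrable (fun x : ℝ × Option S => q x.2 * x.1) (M.stepOrStop π o) := fun o =>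
    integrable_comp_next_mul_fst (integrable_stepOrStop M π o) q
  have h1 := setIntegral_step_unmarked (M := M) (π := π) (Φ := Φ) ρ (hBk k)
    (((measurable_comp_next q).mul measurable_fst).add ((measurable_comp_next u).const_mul γ))
    fun o => (hi o).add ((integrable_comp_next _ u).const_mul γ)
  have h2 : ∫ τ in B ∩ noMarkWithin n (k + 1), (q (Episode.state (n + k + 1) τ) *
      Episode.reward (n + k + 1) τ + γ * u (Episode.state (n + k + 1) τ)) ∂(M.law π Φ ρ) =
      ∫ τ in B ∩ noMarkWithin n k, (∫ x, unmarkedProb Φ x.2 * (q x.2 * x.1 + γ * u x.2)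
        ∂(M.stepOrStop π (Episode.state (n + k) τ))) ∂(M.law π Φ ρ) := by
    rw [noMarkWithin_succ, ← Set.inter_assoc]; exact h1
  -- The factor `unmarkedProb` turns `q` into `1 - vinf` and `u` into `w`, which is the integrand of
  -- `noMarkReturn`.
  have h3 : ∀ o, ∫ x, unmarkedProb Φ x.2 * (q x.2 * x.1 + γ * u x.2) ∂(M.stepOrStop π o) = u o := by
    intro o
    refine integral_congr_ae (Eventually.of_forall fun x => ?_)
    simp only
    rw [h.one_sub_vinf, h.atNext_w]
    ring
  simp only [h3] at h2
  rw [← h2, integral_add, integral_const_mul]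
  -- The factor `q` is traded for the event of no later mark; together with `noMarkWithin` this
  -- gives `noMarkAfter n`, which does not depend on `k`.
  · have h4 := h.setIntegral_reward_inter_noMarkAfter (n := n + k) ρ hΦ (hBk (k + 1))
    rw [Set.inter_assoc, show n + k + 1 = n + (k + 1) from rfl,
      noMarkWithin_inter_noMarkAfter n (k + 1)] at h4
    exact congrArg (· + γ * ∫ τ in B ∩ noMarkWithin n (k + 1),
      u (Episode.state (n + (k + 1)) τ) ∂(M.law π Φ ρ)) h4.symm
  · have hm : Measurable fun y : Rec S => q y.1.2 := (measurable_comp_next q).comp measurable_fst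
    exact (integrable_reward_law ρ _).integrableOn.bdd_mul
      (hm.comp (measurable_pi_apply (n + k + 1))).aestronglyMeasurable
      (Eventually.of_forall fun τ => abs_le_sum_abs q (Episode.state (n + k + 1) τ))
  · exact (integrable_comp_state _ u _).const_mul γ

end IsValueSolution

end EpisodicMDP

/-! ### Marks, positivity and the true values -/

namespace EpisodicMDP

section Records

variable {S : Type*} {Φ : S → unitInterval}

theorem markLaw_real_false (o : Option S) : (markLaw Φ o).real {false} = unmarkedProb Φ o := by
  have h := integral_markLaw (Φ := Φ) (({false} : Set Bool).indicator 1) o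
  rw [integral_indicator_one (measurableSet_singleton _)] at h
  simpa using h

theorem measurableSet_inState (t : ℕ) (s : S) : MeasurableSet[history S t] (Episode.inState t s) :=
  measurableSet_history (measurableSet_state_eq (some s)) le_rfl

theorem measurableSet_unmarked_at (t : ℕ) :
    MeasurableSet[history S t] {τ : ℕ → Rec S | (τ t).2 = false} :=
  measurableSet_history measurableSet_unmarked le_rfl

theorem measurableSet_notJustBefore (t : ℕ) :
    MeasurableSet[history S t] (Episode.notJustBefore (S := S) t) := by
  cases t with
  | zero => exact @MeasurableSet.univ _ (history S 0)
  | succ t => exact (history S).mono t.le_succ _ (measurableSet_unmarked_at t)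

end Records

variable {S A : Type*} [Fintype S] [Fintype A] {M : EpisodicMDP S A} {π : S → PMF A}
  {Φ : S → unitInterval} {γ : ℝ} {v vinf w : S → ℝ} (ρ : PMF S)

theorem measureReal_mark_zero (s : S) :
    (M.law π Φ ρ).real (Episode.inState 0 s ∩ {τ | (τ 0).2 = false}) =
      (1 - Φ s) * (M.law π Φ ρ).real (Episode.inState 0 s) := by
  have hG : MeasurableSet {x : ℝ × Option S | x.2 = some s} :=
    measurable_snd (MeasurableSet.of_discrete (s := {some s}))
  have hm : Measurable fun τ : ℕ → Rec S => τ 0 := measurable_pi_apply 0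
  have key : ∀ D : Set Bool, (M.law π Φ ρ) (Episode.inState 0 s ∩ {τ | (τ 0).2 ∈ D}) =
      markLaw Φ (some s) D *
        (∑ s, ρ s • Measure.dirac ((0 : ℝ), some s)) {x : ℝ × Option S | x.2 = some s} := by
    intro D
    have hD : MeasurableSet D := MeasurableSet.of_discrete
    have e : Episode.inState 0 s ∩ {τ : ℕ → Rec S | (τ 0).2 ∈ D}
        = (fun τ => τ 0) ⁻¹' ({x : ℝ × Option S | x.2 = some s} ×ˢ D) := rfl
    have hfin : IsFiniteMeasure (∑ s, ρ s • Measure.dirac ((0 : ℝ), some s)) := by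
      refine ⟨?_⟩
      simp only [Measure.coe_finsetSum, Finset.sum_apply, Measure.smul_apply, measure_univ,
        smul_eq_mul, mul_one]
      exact ENNReal.sum_lt_top.2 fun s _ => (ρ.apply_ne_top s).lt_top
    rw [e, ← Measure.map_apply hm (hG.prod hD), map_zero_law, initLaw,
      Measure.compProd_apply_prod hG hD,
      setLIntegral_congr_fun (g := fun _ => markLaw Φ (some s) D) hG, setLIntegral_const]
    intro x hx
    have hx' : x.2 = some s := hx
    change markLaw Φ x.2 D = _
    simp only [hx']
  have h1 := key {false}
  have h2 := key Set.univ
  simp only [Set.mem_univ, Set.ofPred_true, Set.inter_univ] at h2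
  have h3 : markLaw Φ (some s) Set.univ = 1 :=
    (isMarkovKernel_markKernel Φ).isProbabilityMeasure ((0 : ℝ), some s) |>.measure_univ
  rw [h3, one_mul] at h2
  rw [← h2] at h1
  have h4 := congrArg ENNReal.toReal h1
  rw [ENNReal.toReal_mul] at h4
  exact h4.trans (congrArg (· * _) (markLaw_real_false (some s)))

theorem setIntegral_comp_state_indicator (B : Set (ℕ → Rec S)) (t : ℕ) (o : Option S) :
    ∫ τ in B, ({o} : Set (Option S)).indicator (fun _ => (1 : ℝ)) (Episode.state t τ)
      ∂(M.law π Φ ρ) = (M.law π Φ ρ).real (B ∩ {τ | Episode.state t τ = o}) := by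
  have hm : MeasurableSet {τ : ℕ → Rec S | Episode.state t τ = o} :=
    (history S).le t _ (measurableSet_history (measurableSet_state_eq o) le_rfl)
  have e : (fun τ : ℕ → Rec S => ({o} : Set (Option S)).indicator (fun _ => (1 : ℝ))
      (Episode.state t τ)) = {τ | Episode.state t τ = o}.indicator fun _ => 1 := rfl
  rw [e, setIntegral_indicator hm]
  simp

/-- The steps with and without a mark, applied to the indicator of `s`, differ by the constant
factor `1 - Φ s`. The event `B` may constrain `Z_t`, which is what conditioning on `Z_{t-1} = 0` at
the next time needs. -/
theorem measureReal_mark_succ {t : ℕ} {B : Set (ℕ → Rec S)} (hB : MeasurableSet[history S t] B)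
    (s : S) : (M.law π Φ ρ).real (B ∩ Episode.inState (t + 1) s ∩ {τ | (τ (t + 1)).2 = false}) =
      (1 - Φ s) * (M.law π Φ ρ).real (B ∩ Episode.inState (t + 1) s) := by
  set f : Option S → ℝ := ({some s} : Set (Option S)).indicator fun _ => 1 with hf
  have h1 := setIntegral_step_unmarked (M := M) (π := π) (Φ := Φ) ρ hB (measurable_comp_next f)
    fun o => integrable_comp_next _ f
  have h2 := setIntegral_step (M := M) (π := π) (Φ := Φ) ρ hB (measurable_comp_next f)
    fun o => integrable_comp_next _ f
  have h3 : ∀ o : Option S, unmarkedProb Φ o * f o = (1 - Φ s) * f o := fun o => by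
    by_cases ho : o = some s
    · rw [ho]; rfl
    · simp [hf, ho]
  simp only [h3, integral_const_mul] at h1
  rw [← h2] at h1
  have e1 := setIntegral_comp_state_indicator (M := M) (π := π) (Φ := Φ) ρ
    (B ∩ {τ | (τ (t + 1)).2 = false}) (t + 1) (some s)
  have e2 := setIntegral_comp_state_indicator (M := M) (π := π) (Φ := Φ) ρ B (t + 1) (some s)
  rw [Set.inter_right_comm]
  exact e1.symm.trans (h1.trans (congrArg _ e2))

theorem measureReal_mark_inState (t : ℕ) (s : S) :
    (M.law π Φ ρ).real (Episode.inState t s ∩ {τ | (τ t).2 = false}) =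
      (1 - Φ s) * (M.law π Φ ρ).real (Episode.inState t s) := by
  cases t with
  | zero => exact measureReal_mark_zero ρ s
  | succ t =>
    simpa only [Set.univ_inter] using
      measureReal_mark_succ (M := M) (π := π) (Φ := Φ) ρ (@MeasurableSet.univ _ (history S t)) s

theorem measureReal_mark (t : ℕ) (s : S) :
    (M.law π Φ ρ).real (Episode.inState t s ∩ Episode.notJustBefore t ∩ {τ | (τ t).2 = false}) =
      (1 - Φ s) * (M.law π Φ ρ).real (Episode.inState t s ∩ Episode.notJustBefore t) := by
  cases t with
  | zero =>
    simpa only [Episode.notJustBefore, Set.inter_univ] using measureReal_mark_zero ρ s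
  | succ t =>
    rw [Set.inter_comm (Episode.inState (t + 1) s)]
    exact measureReal_mark_succ ρ (measurableSet_unmarked_at t) s

/-- A state that can be reached can be reached without a mark just before. -/
theorem law_inState_inter_notJustBefore_ne_zero (hΦ : ∀ s, Φ s < 1) {t : ℕ} {s : S}
    (h : M.law π Φ ρ (Episode.inState t s) ≠ 0) :
    M.law π Φ ρ (Episode.inState t s ∩ Episode.notJustBefore t) ≠ 0 := by
  cases t with
  | zero => simpa only [Episode.notJustBefore, Set.inter_univ] using h
  | succ t =>
    intro h0
    apply h
    have H := hasCondLaw_law (M := M) (π := π) (Φ := Φ) ρ t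
    set C : Set (Rec S) := {y | y.1.2 = some s} with hC
    have hCm : MeasurableSet C := measurableSet_state_eq (some s)
    -- Split by the previous state `o`. A null unmarked piece means that `o` cannot lead to `s` or
    -- that `o` is unmarked with probability zero; in the latter case a live `o` is itself
    -- unreachable as `Φ < 1`, and `none` never leads to `s`.
    have hcover : Episode.inState (t + 1) s = ⋃ o : Option S,
        (Set.univ ∩ {τ : ℕ → Rec S | Episode.state t τ = o} ∩ (fun τ => τ (t + 1)) ⁻¹' C) := by
      ext τ
      simp [Episode.inState, Episode.state, hC]
    rw [hcover]
    refine measure_iUnion_null fun o => ?_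
    rw [H.measure_inter o _ (@MeasurableSet.univ _ (history S t)) C hCm, Set.univ_inter]
    have h1 : M.law π Φ ρ ({τ | (τ t).2 = false} ∩ {τ | Episode.state t τ = o} ∩
        (fun τ => τ (t + 1)) ⁻¹' C) = 0 := by
      refine measure_mono_null ?_ h0
      rintro τ ⟨⟨h2, -⟩, h3⟩
      exact ⟨h3, h2⟩
    rw [H.measure_inter o _ (measurableSet_unmarked_at t) C hCm, mul_eq_zero] at h1
    rcases h1 with h1 | h1
    · cases o with
      | none =>
        have h2 : M.nextLaw π Φ none C = 0 := by
          have hG : MeasurableSet {x : ℝ × Option S | x.2 = some s} :=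
            measurable_snd (MeasurableSet.of_discrete (s := {some s}))
          have e : C = Prod.fst ⁻¹' {x : ℝ × Option S | x.2 = some s} := rfl
          rw [e, ← Measure.map_apply measurable_fst hG, map_fst_nextLaw]
          change Measure.dirac ((0 : ℝ), none) {x : ℝ × Option S | x.2 = some s} = 0
          rw [Measure.dirac_apply' _ hG]
          simp
        rw [h2, mul_zero]
      | some s' =>
        have h2 := measureReal_mark_inState (M := M) (π := π) (Φ := Φ) ρ t s'
        rw [Set.inter_comm] at h2
        have h3 : (M.law π Φ ρ).real ({τ | (τ t).2 = false} ∩ Episode.inState t s') = 0 := by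
          rw [measureReal_def]; exact (congrArg ENNReal.toReal h1).trans rfl
        rw [h3] at h2
        have h4 : (M.law π Φ ρ).real (Episode.inState t s') = 0 := by
          have h5 : (Φ s' : ℝ) < 1 := hΦ s'
          rcases mul_eq_zero.1 h2.symm with h6 | h6
          · linarith
          · exact h6
        have h5 : M.law π Φ ρ {τ | Episode.state t τ = some s'} = 0 :=
          (measureReal_eq_zero_iff (measure_ne_top _ _)).1 h4
        rw [h5, zero_mul]
    · rw [h1, mul_zero]

theorem ae_state_zero_law_pure (s : S) :
    ∀ᵐ τ ∂(M.law π Φ (PMF.pure s)), Episode.state 0 τ = some s := by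
  classical
  have hm : Measurable fun τ : ℕ → Rec S => (τ 0).1 := measurable_fst.comp (measurable_pi_apply 0)
  have hG : MeasurableSet {x : ℝ × Option S | x.2 = some s} :=
    measurable_snd (MeasurableSet.of_discrete (s := {some s}))
  have hsum : (∑ s', PMF.pure s s' • Measure.dirac ((0 : ℝ), some s')) =
      Measure.dirac ((0 : ℝ), some s) := by
    simp [PMF.pure_apply, ite_smul]
  have hmap : (M.law π Φ (PMF.pure s)).map (fun τ => (τ 0).1) = Measure.dirac ((0 : ℝ), some s) := by
    have e : (fun τ : ℕ → Rec S => (τ 0).1) = Prod.fst ∘ fun τ => τ 0 := rfl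
    rw [e, ← Measure.map_map measurable_fst (measurable_pi_apply 0), map_zero_law, initLaw, hsum]
    exact Measure.fst_compProd _ _
  have h1 : ∀ᵐ x ∂((M.law π Φ (PMF.pure s)).map fun τ => (τ 0).1), x.2 = some s := by
    rw [hmap, ae_dirac_iff hG]
  exact ae_of_ae_map hm.aemeasurable h1

namespace IsValueSolution

theorem noMarkProb_none (h : IsValueSolution M π Φ γ v vinf w) :
    noMarkProb M π vinf none = 1 := by
  have := h.one_sub_vinf none
  simpa [atNext, unmarkedProb] using this.symm

/-- It is a genuine probability, for the episode started in `s`. -/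
theorem noMarkProb_mem (h : IsValueSolution M π Φ γ v vinf w) (hΦ : ∀ s, 0 < Φ s) (s : S) :
    0 ≤ noMarkProb M π vinf (some s) ∧ noMarkProb M π vinf (some s) ≤ 1 := by
  have h1 := h.measureReal_inter_noMarkAfter (PMF.pure s) hΦ (n := 0)
    (@MeasurableSet.univ _ (history S 0))
  have h2 : ∫ τ in Set.univ, noMarkProb M π vinf (Episode.state 0 τ) ∂(M.law π Φ (PMF.pure s)) =
      noMarkProb M π vinf (some s) := by
    rw [setIntegral_univ, integral_congr_ae (g := fun _ => noMarkProb M π vinf (some s))]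
    · simp
    · filter_upwards [ae_state_zero_law_pure (M := M) (π := π) (Φ := Φ) s] with τ hτ
      rw [hτ]
  rw [← h2, ← h1]
  exact ⟨measureReal_nonneg, measureReal_le_one⟩

theorem noMarkProb_nonneg (h : IsValueSolution M π Φ γ v vinf w) (hΦ : ∀ s, 0 < Φ s)
    (o : Option S) : 0 ≤ noMarkProb M π vinf o := by
  cases o with
  | none => rw [h.noMarkProb_none]; exact zero_le_one
  | some s => exact (h.noMarkProb_mem hΦ s).1

/-- Since episodes end, there is a positive probability of no mark. -/
theorem noMarkProb_pos (h : IsValueSolution M π Φ γ v vinf w) (hΦ : ∀ s, 0 < Φ s ∧ Φ s < 1)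
    (hT : M.Terminates π Φ) (o : Option S) : 0 < noMarkProb M π vinf o := by
  set q := noMarkProb M π vinf with hq
  have hq0 : ∀ o, 0 ≤ q o := h.noMarkProb_nonneg fun s => (hΦ s).1
  refine lt_of_le_of_ne (hq0 o) fun hzero => ?_
  cases o with
  | none => rw [hq, h.noMarkProb_none] at hzero; exact zero_ne_one hzero
  | some s =>
    have hu : ∀ o, 0 < unmarkedProb Φ o := fun o => by
      cases o with
      | none => exact one_pos
      | some s => exact sub_pos.2 (hΦ s).2
    -- The zero set of `q` is absorbing: `q o` is the mean of `unmarkedProb * q` at the next state,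
    -- with `unmarkedProb > 0`. An episode started in it could never end, because `q none = 1`.
    set f : Option S → ℝ := {o | q o ≠ 0}.indicator fun _ => 1 with hf
    have hf0 : ∀ o, 0 ≤ f o := fun o => Set.indicator_nonneg (fun _ _ => zero_le_one) o
    have hstep : ∀ o, q o = 0 → ∫ x, f x.2 ∂(M.stepOrStop π o) = 0 := by
      intro o ho
      have h1 : ∫ x, unmarkedProb Φ x.2 * q x.2 ∂(M.stepOrStop π o) = 0 := by
        simp only [hq, ← h.one_sub_vinf]
        exact ho
      rw [integral_eq_zero_iff_of_nonneg (fun x => mul_nonneg (hu _).le (hq0 _))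
        (integrable_comp_next _ fun o => unmarkedProb Φ o * q o)] at h1
      refine integral_eq_zero_of_ae ?_
      filter_upwards [h1] with x hx
      have : q x.2 = 0 := (mul_eq_zero.1 hx).resolve_left (hu _).ne'
      simp [hf, this]
    have hall : ∀ t, ∀ᵐ τ ∂(M.law π Φ (PMF.pure s)), q (Episode.state t τ) = 0 := by
      intro t
      induction t with
      | zero =>
        filter_upwards [ae_state_zero_law_pure (M := M) (π := π) (Φ := Φ) s] with τ hτ
        rw [hτ]; exact hzero.symm
      | succ t ih =>
        have h1 := setIntegral_step (M := M) (π := π) (Φ := Φ) (PMF.pure s) (n := t)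
          (@MeasurableSet.univ _ (history S t)) (measurable_comp_next f)
          fun o => integrable_comp_next _ f
        rw [setIntegral_univ, setIntegral_univ, integral_eq_zero_of_ae (f := fun τ =>
          ∫ x, f x.2 ∂(M.stepOrStop π (Episode.state t τ))) (ih.mono fun τ hτ => hstep _ hτ)] at h1
        have h2 := (integral_eq_zero_iff_of_nonneg (fun τ => hf0 _)
          (integrable_comp_state (M.law π Φ (PMF.pure s)) f (t + 1))).1 h1
        filter_upwards [h2] with τ hτ
        by_contra hne
        have : f (Episode.state (t + 1) τ) = 1 := Set.indicator_of_mem (by exact hne) _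
        rw [this] at hτ
        exact one_ne_zero hτ
    have hcontra : ∀ᵐ τ ∂(M.law π Φ (PMF.pure s)), False := by
      filter_upwards [ae_all_iff.2 hall, hT s] with τ h1 ⟨t, ht⟩
      have h2 := h1 t
      rw [ht, hq, h.noMarkProb_none] at h2
      exact one_ne_zero h2
    rw [ae_iff] at hcontra
    simp at hcontra

theorem vinf_lt_one (h : IsValueSolution M π Φ γ v vinf w) (hΦ : ∀ s, 0 < Φ s ∧ Φ s < 1)
    (hT : M.Terminates π Φ) (s : S) : vinf s < 1 := by
  have h1 := h.one_sub_vinf (some s)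
  have h2 : 0 < unmarkedProb Φ (some s) * noMarkProb M π vinf (some s) :=
    mul_pos (sub_pos.2 (hΦ s).2) (h.noMarkProb_pos hΦ hT _)
  rw [← h1] at h2
  exact sub_pos.1 h2

theorem vinf_pos (h : IsValueSolution M π Φ γ v vinf w) (hΦ : ∀ s, 0 < Φ s) (s : S) :
    0 < vinf s := by
  have h1 : 1 - vinf s = (1 - Φ s) * noMarkProb M π vinf (some s) := h.one_sub_vinf (some s)
  have h2 := (h.noMarkProb_mem hΦ s).2
  have h3 : (0 : ℝ) < Φ s := hΦ s
  have h4 : (Φ s : ℝ) ≤ 1 := (Φ s).2.2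
  nlinarith

/-- The table of the four value functions. -/
noncomputable def _root_.EpisodicMDP.solutionTable {S : Type*} (v vinf w : S → ℝ) : ValueTable S
  | .v, s => v s
  | .vinf, s => vinf s
  | .v1, s => (v s - w s) / vinf s
  | .v0, s => w s / (1 - vinf s)

/-- Apart from `v`, which conditions on the state alone, the values are ratios of integrals over
parts of `B`. Each integral is a function of `s` times `μ.real B`, which cancels; this removes the
dependence on `ρ` and `t`. -/
theorem trueValue_eq (h : IsValueSolution M π Φ γ v vinf w) (hγ0 : 0 ≤ γ) (hγ1 : γ < 1)
    (hΦ : ∀ s, 0 < Φ s ∧ Φ s < 1) {t : ℕ} {s : S}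
    (hs : M.law π Φ ρ (Episode.inState t s) ≠ 0) (i : ValueKind) :
    M.trueValue π Φ γ ρ t i s = solutionTable v vinf w i s := by
  set μ := M.law π Φ ρ with hμ
  set B := Episode.inState t s ∩ Episode.notJustBefore (S := S) t with hB
  have hΦ0 : ∀ s, 0 < Φ s := fun s => (hΦ s).1
  have hIm := measurableSet_inState t s
  have hBm : MeasurableSet[history S t] B :=
    @MeasurableSet.inter _ (history S t) _ _ hIm (measurableSet_notJustBefore t)
  have hI : MeasurableSet (Episode.inState t s) := (history S).le t _ hIm
  have hB' : MeasurableSet B := (history S).le t _ hBm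
  have hB0 : μ.real B ≠ 0 := by
    rw [measureReal_def, ENNReal.toReal_ne_zero]
    exact ⟨law_inState_inter_notJustBefore_ne_zero ρ (fun s => (hΦ s).2) hs, measure_ne_top _ _⟩
  -- integrals of functions of the state on events contained in `S_t = s`
  have hconst : ∀ (C : Set (ℕ → Rec S)) (g : Option S → ℝ), MeasurableSet[history S t] C →
      C ⊆ Episode.inState t s →
      ∫ τ in C, g (Episode.state t τ) ∂μ = μ.real C * g (some s) := by
    intro C g hC hCs
    rw [setIntegral_congr_fun (g := fun _ => g (some s)) ((history S).le t _ hC)]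
    · simp
    · intro τ hτ
      exact congrArg g (hCs hτ)
  set B₀ := B ∩ {τ | (τ t).2 = false} with hB₀
  have hB₀m : MeasurableSet[history S t] B₀ :=
    @MeasurableSet.inter _ (history S t) _ _ hBm (measurableSet_unmarked_at t)
  have hB₀s : B₀ ⊆ Episode.inState t s := fun τ hτ => hτ.1.1
  have hmark : μ.real B₀ = (1 - Φ s) * μ.real B := measureReal_mark ρ t s
  have hno : B ∩ (Episode.eventually t)ᶜ = B₀ ∩ noMarkAfter t := by
    ext τ
    simp only [Episode.eventually, Set.mem_inter_iff, Set.mem_compl_iff, Set.mem_ofPred_eq,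
      not_exists, not_and, Bool.not_eq_true, hB₀, noMarkAfter]
    constructor
    · exact fun ⟨h1, h2⟩ => ⟨⟨h1, h2 t le_rfl⟩, fun j hj => h2 j hj.le⟩
    · rintro ⟨⟨h1, h2⟩, h3⟩
      refine ⟨h1, fun k hk => ?_⟩
      rcases hk.eq_or_lt with rfl | hk
      · exact h2
      · exact h3 k hk
  have hPno : μ.real (B ∩ (Episode.eventually t)ᶜ) = (1 - vinf s) * μ.real B := by
    have h1 := h.one_sub_vinf (some s)
    rw [hno, h.measureReal_inter_noMarkAfter ρ hΦ0 hB₀m, hconst _ _ hB₀m hB₀s, hmark]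
    have h2 : 1 - vinf s = (1 - Φ s) * noMarkProb M π vinf (some s) := h1
    rw [h2]; ring
  have hGno : ∫ τ in B ∩ (Episode.eventually t)ᶜ, Episode.ret γ t τ ∂μ = w s * μ.real B := by
    have h1 : w s = (1 - Φ s) * noMarkReturn M π γ vinf w (some s) := h.atNext_w (some s)
    rw [hno, h.setIntegral_ret_inter_noMarkAfter ρ hγ0 hγ1 hΦ0 hB₀m, hconst _ _ hB₀m hB₀s, hmark,
      h1]
    ring
  have hG : ∫ τ in B, Episode.ret γ t τ ∂μ = v s * μ.real B := by
    rw [h.setIntegral_ret ρ hγ0 hγ1 hBm, hconst _ _ hBm Set.inter_subset_left, mul_comm]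
    rfl
  have hEm : MeasurableSet (Episode.eventually (S := S) t) := by
    have e : Episode.eventually (S := S) t = ⋃ k, ⋃ (_ : t ≤ k), {τ | (τ k).2 = false}ᶜ := by
      ext τ; simp [Episode.eventually]
    rw [e]
    exact MeasurableSet.iUnion fun k => MeasurableSet.iUnion fun _ =>
      ((history S).le k _ (measurableSet_unmarked_at k)).compl
  -- The subtraction is done term by term in the discounted series, where integrability of single
  -- rewards suffices.
  have hGev : ∫ τ in B ∩ Episode.eventually t, Episode.ret γ t τ ∂μ = (v s - w s) * μ.real B := by
    have h1 := (hasSum_setIntegral_ret (M := M) (π := π) (Φ := Φ) ρ hγ0 hγ1 t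
      (B ∩ Episode.eventually t)).add (hasSum_setIntegral_ret (M := M) (π := π) (Φ := Φ) ρ hγ0 hγ1 t
      (B ∩ (Episode.eventually t)ᶜ))
    have h2 := hasSum_setIntegral_ret (M := M) (π := π) (Φ := Φ) ρ hγ0 hγ1 t B
    have h3 : ∀ k, γ ^ k * ∫ τ in B ∩ Episode.eventually t, Episode.reward (t + k + 1) τ ∂μ +
        γ ^ k * ∫ τ in B ∩ (Episode.eventually t)ᶜ, Episode.reward (t + k + 1) τ ∂μ =
        γ ^ k * ∫ τ in B, Episode.reward (t + k + 1) τ ∂μ := fun k => by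
      rw [← mul_add, ← Set.sdiff_eq, integral_inter_add_sdiff hEm
        (integrable_reward_law ρ _).integrableOn]
    simp only [hμ] at h3
    simp only [h3] at h1
    have h4 := h1.unique h2
    rw [← hμ, hGno, hG] at h4
    linear_combination h4
  have hPev : μ.real (B ∩ Episode.eventually t) = vinf s * μ.real B := by
    have h1 := measureReal_inter_add_sdiff (μ := μ) (s := B) hEm (measure_ne_top _ _)
    rw [Set.sdiff_eq, hPno] at h1
    linear_combination h1
  have hset : ∀ (C : Set (ℕ → Rec S)) (hC : MeasurableSet C) (x p : ℝ),
      ∫ τ in C, Episode.ret γ t τ ∂μ = x * μ.real B → μ.real C = p * μ.real B →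
        ∫ τ, Episode.ret γ t τ ∂(μ[|C]) = x / p := by
    intro C hC x p h1 h2
    rw [ProbabilityTheory.cond, integral_smul_measure, h1, ENNReal.toReal_inv, ← measureReal_def,
      h2, smul_eq_mul]
    rcases eq_or_ne p 0 with rfl | hp
    · simp
    · field_simp
  cases i with
  | v =>
    have hI0 : μ.real (Episode.inState t s) ≠ 0 := by
      rw [measureReal_def, ENNReal.toReal_ne_zero]
      exact ⟨hs, measure_ne_top _ _⟩
    change ∫ τ, Episode.ret γ t τ ∂(μ[|Episode.inState t s]) = v s
    rw [ProbabilityTheory.cond, integral_smul_measure, h.setIntegral_ret ρ hγ0 hγ1 hIm,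
      hconst _ _ hIm subset_rfl, ENNReal.toReal_inv, ← measureReal_def, smul_eq_mul,
      inv_mul_cancel_left₀ hI0]
    rfl
  | vinf =>
    change (μ[|B]).real (Episode.eventually t) = vinf s
    rw [measureReal_def, cond_apply hB', ENNReal.toReal_mul, ENNReal.toReal_inv,
      ← measureReal_def, ← measureReal_def, hPev]
    field_simp
  | v1 =>
    change ∫ τ, Episode.ret γ t τ
      ∂(μ[|Episode.inState t s ∩ Episode.eventually t ∩ Episode.notJustBefore t]) = _
    rw [Set.inter_right_comm]
    exact hset _ (hB'.inter hEm) _ _ hGev hPev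
  | v0 =>
    change ∫ τ, Episode.ret γ t τ
      ∂(μ[|Episode.inState t s ∩ (Episode.eventually t)ᶜ ∩ Episode.notJustBefore t]) = _
    rw [Set.inter_right_comm]
    exact hset _ (hB'.inter hEm.compl) _ _ hGno hPno

end IsValueSolution

end EpisodicMDP

/-! ### The four recursions as one weighted equation -/

section Tables

variable {S : Type*}

/-- The weights in the recursion for one of the four tables. -/
def tableWeight (V : ValueTable S) : ValueKind → Option S → ℝ
  | .v, _ => 1
  | .vinf, _ => 1
  | .v1, o => atNext (V .vinf) o
  | .v0, o => 1 - atNext (V .vinf) o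

/-- The offset in the recursion for one of the four tables. -/
def tableOffset (Φ : S → unitInterval) (V : ValueTable S) : ValueKind → S → ℝ
  | .v, _ => 0
  | .vinf, s => Φ s
  | .v1, s => V .v s * Φ s
  | .v0, _ => 0

/-- The factor of the expectation in the recursion for one of the four tables. -/
def tableFactor (Φ : S → unitInterval) : ValueKind → S → ℝ
  | .v, _ => 1
  | _, s => 1 - Φ s

/-- The factor of the reward in the recursion for one of the four tables. -/
def tableReward : ValueKind → ℝ
  | .vinf => 0
  | _ => 1

/-- The discount factor in the recursion for one of the four tables. -/
def tableDiscount (γ : ℝ) : ValueKind → ℝ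
  | .vinf => 1
  | _ => γ

/-- Valid for every table: a zero denominator gives `0` on both sides. -/
theorem EpisodicMDP.bellman_eq_meanTarget {A : Type*} [Fintype A] (M : EpisodicMDP S A)
    (π : S → PMF A) (Φ : S → unitInterval) (γ : ℝ) (V : ValueTable S) (i : ValueKind) :
    M.bellman π Φ γ V i = meanTarget (M.policyStep π) (tableFactor Φ i) (tableReward i)
      (tableDiscount γ i) (tableWeight V i) (tableOffset Φ V i) (V i) := by
  ext s
  have e : atNext (V .vinf) (some s) = V .vinf s := rfl
  cases i <;> simp only [bellman, meanTarget, tableFactor, tableReward, tableDiscount,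
    tableWeight, tableOffset, one_mul, zero_mul, zero_add, div_one, e] <;> ring

theorem sampleTarget_eq (Φ : S → unitInterval) (γ : ℝ) (V : ValueTable S) (s : S) (r : ℝ)
    (o : Option S) (i : ValueKind) : sampleTarget Φ γ V s r o i =
      (tableOffset Φ V i s + tableFactor Φ i s * (tableWeight V i o *
        (tableReward i * r + tableDiscount γ i * atNext (V i) o))) / tableWeight V i (some s) := by
  have e : atNext (V .vinf) (some s) = V .vinf s := rfl
  cases i <;> simp only [sampleTarget, tableFactor, tableReward, tableDiscount,
    tableWeight, tableOffset, one_mul, zero_mul, zero_add, div_one, e] <;> ring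

end Tables

namespace EpisodicMDP

variable {S A : Type*} [Fintype S] [Fintype A] {M : EpisodicMDP S A} {π : S → PMF A}
  {Φ : S → unitInterval} {γ β : ℝ} {v vinf w : S → ℝ}

/-- The weights clear the denominators: `D * Xs` is `v`, `vinf`, `v - w` or `w`, so the equations
reduce to the linear ones, that for `v^1` being a difference of two. -/
theorem IsValueSolution.isWeightedFixedPoint (h : IsValueSolution M π Φ γ v vinf w)
    (hγ0 : 0 ≤ γ) (hγβ : γ ≤ β) (hΦβ : ∀ s, 1 - (Φ s : ℝ) ≤ β) (hΦ : ∀ s, 0 < Φ s ∧ Φ s < 1)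
    (hT : M.Terminates π Φ) (i : ValueKind) :
    IsWeightedFixedPoint (M.policyStep π) (tableFactor Φ i) (tableReward i) (tableDiscount γ i) β
      (tableWeight (solutionTable v vinf w) i) (tableOffset Φ (solutionTable v vinf w) i)
      (solutionTable v vinf w i) where
  integrable := integrable_policyStep M π
  κ_nonneg s := by
    have := (Φ s).2.2
    cases i <;> simp only [tableFactor] <;> linarith
  κ_le_one s := by
    have := (Φ s).2.1
    cases i <;> simp only [tableFactor] <;> linarith
  disc_nonneg := by cases i <;> simp only [tableDiscount] <;> linarith
  mul_le s := by
    have h0 := (Φ s).2.1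
    have h1 : (1 - (Φ s : ℝ)) * γ ≤ 1 * γ :=
      mul_le_mul_of_nonneg_right (by linarith) hγ0
    have := hΦβ s
    cases i <;> simp only [tableFactor, tableDiscount] <;> linarith
  β_nonneg := hγ0.trans hγβ
  weight_pos s := by
    have h0 := h.vinf_pos (fun s => (hΦ s).1) s
    have h1 := h.vinf_lt_one hΦ hT s
    cases i <;> simp only [tableWeight, atNext, solutionTable] <;> linarith
  eq s := by
    have hpos := fun s => (h.vinf_pos (fun s => (hΦ s).1) s).ne'
    have hlt := fun s => (sub_pos.2 (h.vinf_lt_one hΦ hT s)).ne'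
    cases i with
    | v => simpa [tableWeight, show solutionTable v vinf w .v = v from rfl, tableOffset,
        tableFactor, tableReward, tableDiscount] using h.v_eq s
    | vinf => simpa [tableWeight, show solutionTable v vinf w .vinf = vinf from rfl, tableOffset,
        tableFactor, tableReward, tableDiscount] using h.vinf_eq s
    | v1 =>
      -- At `none` the weight is `0`, and on the right the two copies of the reward cancel.
      have e1 : ∀ x : ℝ × Option S, tableWeight (solutionTable v vinf w) .v1 x.2 *
          (tableReward .v1 * x.1 + tableDiscount γ .v1 *
            atNext (solutionTable v vinf w .v1) x.2) =
          (x.1 + γ * atNext v x.2) - ((1 - atNext vinf x.2) * x.1 + γ * atNext w x.2) := by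
        rintro ⟨r, o⟩
        cases o with
        | none => simp [tableWeight, atNext]
        | some t =>
          have := hpos t
          simp only [tableWeight, tableReward, tableDiscount, atNext, solutionTable]
          field_simp
          ring
      have hi1 : Integrable (fun x : ℝ × Option S => x.1 + γ * atNext v x.2)
          (M.policyStep π s) :=
        (integrable_policyStep M π s).add ((integrable_comp_next _ (atNext v)).const_mul γ)
      have hi2 : Integrable (fun x : ℝ × Option S =>
          (1 - atNext vinf x.2) * x.1 + γ * atNext w x.2) (M.policyStep π s) :=
        (integrable_comp_next_mul_fst (integrable_policyStep M π s)
          fun o => 1 - atNext vinf o).add ((integrable_comp_next _ (atNext w)).const_mul γ)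
      simp only [e1]
      rw [integral_sub hi1 hi2, ← h.v_eq s]
      have e2 : tableWeight (solutionTable v vinf w) .v1 (some s) *
          solutionTable v vinf w .v1 s = v s - w s := mul_div_cancel₀ _ (hpos s)
      have e3 : tableOffset Φ (solutionTable v vinf w) .v1 s = v s * Φ s := rfl
      have e4 : tableFactor Φ .v1 s = 1 - Φ s := rfl
      rw [e2, e3, e4]
      linear_combination -h.w_eq s
    | v0 =>
      have e1 : ∀ x : ℝ × Option S, tableWeight (solutionTable v vinf w) .v0 x.2 *
          (tableReward .v0 * x.1 + tableDiscount γ .v0 *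
            atNext (solutionTable v vinf w .v0) x.2) =
          (1 - atNext vinf x.2) * x.1 + γ * atNext w x.2 := by
        rintro ⟨r, o⟩
        cases o with
        | none => simp [tableWeight, tableReward, atNext]
        | some t =>
          have := hlt t
          simp only [tableWeight, tableReward, tableDiscount, atNext, solutionTable]
          field_simp
      simp only [e1]
      have e2 : tableWeight (solutionTable v vinf w) .v0 (some s) *
          solutionTable v vinf w .v0 s = w s := mul_div_cancel₀ _ (hlt s)
      have e3 : tableOffset Φ (solutionTable v vinf w) .v0 s = 0 := rfl
      have e4 : tableFactor Φ .v0 s = 1 - Φ s := rfl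
      rw [e2, e3, e4, zero_add]
      exact h.w_eq s

theorem IsValueSolution.exists_bellman_rate [DecidableEq S]
    (h : IsValueSolution M π Φ γ v vinf w)
    (hγ0 : 0 ≤ γ) (hγβ : γ ≤ β) (hΦβ : ∀ s, 1 - (Φ s : ℝ) ≤ β) (hΦ : ∀ s, 0 < Φ s ∧ Φ s < 1)
    (hT : M.Terminates π Φ) {r : ℝ} (hβr : β < r) (hr : r < 1) (V₀ : ValueTable S) :
    ∃ C, ∀ i s k,
      |(M.bellman π Φ γ)^[k] V₀ i s - solutionTable v vinf w i s| ≤ C * r ^ k := by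
  have F := h.isWeightedFixedPoint hγ0 hγβ hΦβ hΦ hT
  have hr0 : 0 < r := (hγ0.trans hγβ).trans_lt hβr
  set V : ℕ → ValueTable S := fun k => (M.bellman π Φ γ)^[k] V₀ with hV
  have hrec : ∀ i k, V (k + 1) i = meanTarget (M.policyStep π) (tableFactor Φ i) (tableReward i)
      (tableDiscount γ i) (tableWeight (V k) i) (tableOffset Φ (V k) i) (V k i) := by
    intro i k
    rw [← bellman_eq_meanTarget]
    exact congrFun (Function.iterate_succ_apply' _ _ _) i
  have rate : ∀ i, ∀ c, (∀ k o, |tableWeight (V k) i o -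
      tableWeight (solutionTable v vinf w) i o| ≤ c * r ^ k) →
      (∀ k s, |tableOffset Φ (V k) i s - tableOffset Φ (solutionTable v vinf w) i s| ≤
        c * r ^ k) → ∃ C, 0 ≤ C ∧ ∀ k s, |V k i s - solutionTable v vinf w i s| ≤ C * r ^ k :=
    fun i c h1 h2 => (F i).exists_rate hβr hr (X := fun k => V k i) (hrec i) h1 h2
  -- For `v` and `vinf` the weights and offsets do not depend on the table, so their error is `0`.
  -- The resulting rates are the input for `v1` and `v0`, at the same `r`.
  obtain ⟨C₁, hC₁, h₁⟩ := rate .v 0 (by simp [tableWeight]) (by simp [tableOffset])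
  obtain ⟨C₂, hC₂, h₂⟩ := rate .vinf 0 (by simp [tableWeight]) (by simp [tableOffset])
  have hnext : ∀ k o, |atNext (V k .vinf) o - atNext (solutionTable v vinf w .vinf) o| ≤
      C₂ * r ^ k := by
    intro k o
    cases o with
    | none => simpa [atNext] using mul_nonneg hC₂ (pow_nonneg hr0.le k)
    | some s => exact h₂ k s
  obtain ⟨C₃, hC₃, h₃⟩ := rate .v1 (C₁ + C₂)
    (fun k o => (hnext k o).trans (by gcongr; linarith))
    (fun k s => by
      simp only [tableOffset]
      rw [← sub_mul, abs_mul, abs_of_nonneg (Φ s).2.1]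
      refine (mul_le_of_le_one_right (abs_nonneg _) (Φ s).2.2).trans ((h₁ k s).trans ?_)
      gcongr
      linarith)
  obtain ⟨C₄, hC₄, h₄⟩ := rate .v0 C₂
    (fun k o => by
      have : tableWeight (V k) .v0 o - tableWeight (solutionTable v vinf w) .v0 o =
          -(atNext (V k .vinf) o - atNext (solutionTable v vinf w .vinf) o) := by
        simp only [tableWeight]; ring
      rw [this, abs_neg]
      exact hnext k o)
    (fun k s => by simpa [tableOffset] using mul_nonneg hC₂ (pow_nonneg hr0.le k))
  refine ⟨C₁ + C₂ + C₃ + C₄, fun i s k => ?_⟩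
  have hk := pow_nonneg hr0.le k
  cases i with
  | v => exact (h₁ k s).trans (mul_le_mul_of_nonneg_right (by linarith) hk)
  | vinf => exact (h₂ k s).trans (mul_le_mul_of_nonneg_right (by linarith) hk)
  | v1 => exact (h₃ k s).trans (mul_le_mul_of_nonneg_right (by linarith) hk)
  | v0 => exact (h₄ k s).trans (mul_le_mul_of_nonneg_right (by linarith) hk)

end EpisodicMDP

/-! ### The online method -/

section Online

variable {S A Ω : Type*} {mΩ : MeasurableSpace Ω} {P : Measure Ω}
  {ℱ : Filtration ℕ mΩ} {M : EpisodicMDP S A} {π : S → PMF A} {St : ℕ → Ω → S} {Act : ℕ → Ω → A}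
  {Rew : ℕ → Ω → ℝ} {Nxt : ℕ → Ω → Option S}

theorem IsExperience.measurable_obs (hE : IsExperience M π P ℱ St Act Rew Nxt) (n : ℕ) :
    Measurable[ℱ (n + 1)] fun ω => (Rew n ω, Nxt n ω) :=
  (hE.measurable_reward n).prodMk (hE.measurable_next n)

/-- Summing over the disjoint events given by the action turns the laws `M.step s a` into their
mixture `M.policyStep π s`. -/
theorem IsExperience.hasCondLaw [Fintype A] (hE : IsExperience M π P ℱ St Act Rew Nxt) (n : ℕ) :
    HasCondLaw (ℱ n) P (St n) (fun ω => (Rew n ω, Nxt n ω)) (M.policyStep π) where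
  le := ℱ.le n
  measurableSet_state := hE.measurableSet_state n
  measurable := (hE.measurable_obs n).mono (ℱ.le _) le_rfl
  measure_inter s B hB C hC := by
    have hm : Measurable fun ω => (Rew n ω, Nxt n ω) := (hE.measurable_obs n).mono (ℱ.le _) le_rfl
    have e : B ∩ {ω | St n ω = s} ∩ (fun ω => (Rew n ω, Nxt n ω)) ⁻¹' C =
        ⋃ a, B ∩ {ω | St n ω = s ∧ Act n ω = a ∧ (Rew n ω, Nxt n ω) ∈ C} := by
      ext ω
      simp [and_assoc]
    rw [e, measure_iUnion, tsum_fintype]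
    · simp only [hE.cond_law n B hB s _ C hC, EpisodicMDP.policyStep, Measure.coe_finsetSum,
        Finset.sum_apply, Measure.smul_apply, smul_eq_mul, Finset.mul_sum, mul_assoc]
    · intro a b hab
      refine Set.disjoint_left.2 ?_
      rintro ω ⟨-, -, h1, -⟩ ⟨-, -, h2, -⟩
      exact hab (h1.symm.trans h2)
    · intro a
      exact (ℱ.le n _ hB).inter ((ℱ.le n _ (hE.measurableSet_state n s)).inter
        ((ℱ.le (n + 1) _ (hE.measurableSet_action n a)).inter (hm hC)))

theorem EpisodicMDP.memLp_policyStep {S A : Type*} [Fintype A] {M : EpisodicMDP S A}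
    (π : S → PMF A) (h : ∀ s a, MemLp (fun x : ℝ × Option S => x.1) 2 (M.step s a)) (s : S) :
    MemLp (fun x : ℝ × Option S => x.1) 2 (M.policyStep π s) := by
  rw [memLp_two_iff_integrable_sq measurable_fst.aestronglyMeasurable]
  unfold policyStep
  exact integrable_finsetSum_measure.2 fun a _ =>
    (h s a).integrable_sq.smul_measure (PMF.apply_ne_top _ _)

theorem measurable_apply_of_fintype {O : Type*} [Fintype O] {m : MeasurableSpace Ω}
    {g : O → Ω → ℝ} {N : Ω → O} (hg : ∀ o, Measurable (g o)) (hN : ∀ o, MeasurableSet {ω | N ω = o}) :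
    Measurable fun ω => g (N ω) ω := by
  classical
  have : (fun ω => g (N ω) ω) = fun ω => ∑ o, {ω | N ω = o}.indicator (g o) ω := by
    ext ω; simp [Set.indicator_apply]
  rw [this]
  exact Finset.measurable_fun_sum _ fun o _ => (hg o).indicator (hN o)

variable {Φ : S → unitInterval} {γ : ℝ} {α : ValueKind → ℕ → Ω → ℝ}
  {V₀ : Ω → ValueTable S}

theorem onlineIterate_succ [DecidableEq S] (n : ℕ) (ω : Ω) (i : ValueKind) (s : S) :
    onlineIterate Φ γ α St Rew Nxt V₀ (n + 1) ω i s = if St n ω = s then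
      (1 - α i n ω) * onlineIterate Φ γ α St Rew Nxt V₀ n ω i s + α i n ω *
        ((tableOffset Φ (onlineIterate Φ γ α St Rew Nxt V₀ n ω) i s + tableFactor Φ i s *
          (tableWeight (onlineIterate Φ γ α St Rew Nxt V₀ n ω) i (Nxt n ω) *
            (tableReward i * Rew n ω + tableDiscount γ i *
              atNext (onlineIterate Φ γ α St Rew Nxt V₀ n ω i) (Nxt n ω)))) /
          tableWeight (onlineIterate Φ γ α St Rew Nxt V₀ n ω) i (some s))
      else onlineIterate Φ γ α St Rew Nxt V₀ n ω i s := by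
  rw [← sampleTarget_eq]
  rfl

theorem measurable_atNext {m : MeasurableSpace Ω} {X : Ω → S → ℝ}
    (hX : ∀ s, Measurable fun ω => X ω s) (o : Option S) : Measurable fun ω => atNext (X ω) o := by
  cases o with
  | none => exact measurable_const
  | some s => exact hX s

theorem measurable_tableWeight {m : MeasurableSpace Ω} {V : Ω → ValueTable S}
    (hV : ∀ i s, Measurable fun ω => V ω i s) (i : ValueKind) (o : Option S) :
    Measurable fun ω => tableWeight (V ω) i o := by
  cases i with
  | v => exact measurable_const
  | vinf => exact measurable_const
  | v1 => exact measurable_atNext (hV .vinf) o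
  | v0 => exact (measurable_atNext (hV .vinf) o).const_sub 1

theorem measurable_tableOffset {m : MeasurableSpace Ω} {V : Ω → ValueTable S}
    (hV : ∀ i s, Measurable fun ω => V ω i s) (i : ValueKind) (s : S) :
    Measurable fun ω => tableOffset Φ (V ω) i s := by
  cases i with
  | v => exact measurable_const
  | vinf => exact measurable_const
  | v1 => exact (hV .v s).mul_const _
  | v0 => exact measurable_const

theorem measurable_onlineIterate [Fintype S] [DecidableEq S]
    (hE : IsExperience M π P ℱ St Act Rew Nxt)
    (hα : ∀ i, RobbinsMonro P ℱ St (α i)) (hV₀ : ∀ i s, Measurable[ℱ 0] fun ω => V₀ ω i s)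
    (n : ℕ) (i : ValueKind) (s : S) :
    Measurable[ℱ n] fun ω => onlineIterate Φ γ α St Rew Nxt V₀ n ω i s := by
  induction n generalizing i s with
  | zero => exact hV₀ i s
  | succ n ih =>
    simp only [onlineIterate_succ]
    have hle := ℱ.mono n.le_succ
    have ih' : ∀ i s, Measurable[ℱ (n + 1)] fun ω => onlineIterate Φ γ α St Rew Nxt V₀ n ω i s :=
      fun i s => (ih i s).mono hle le_rfl
    have hN : ∀ o, MeasurableSet[ℱ (n + 1)] {ω | Nxt n ω = o} := fun o =>
      hE.measurable_next n (MeasurableSet.of_discrete (s := {o}))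
    have hα' := ((hα i).measurable n).mono hle le_rfl
    have h1 : Measurable[ℱ (n + 1)] fun ω =>
        tableWeight (onlineIterate Φ γ α St Rew Nxt V₀ n ω) i (Nxt n ω) :=
      measurable_apply_of_fintype
        (g := fun o ω => tableWeight (onlineIterate Φ γ α St Rew Nxt V₀ n ω) i o)
        (fun o => measurable_tableWeight ih' i o) hN
    have h2 : Measurable[ℱ (n + 1)] fun ω =>
        atNext (onlineIterate Φ γ α St Rew Nxt V₀ n ω i) (Nxt n ω) :=
      measurable_apply_of_fintype
        (g := fun o ω => atNext (onlineIterate Φ γ α St Rew Nxt V₀ n ω i) o)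
        (fun o => measurable_atNext (ih' i) o) hN
    refine Measurable.ite (hle _ (hE.measurableSet_state n s)) ?_ (ih' i s)
    refine ((hα'.const_sub 1).mul (ih' i s)).add (hα'.mul ?_)
    exact ((measurable_tableOffset ih' i s).add ((h1.mul (((hE.measurable_reward n).const_mul _).add
      (h2.const_mul _))).const_mul _)).div (measurable_tableWeight ih' i (some s))

/-- Almost sure convergence of the online method to the solution of the recursions. -/
theorem EpisodicMDP.IsValueSolution.tendsto_onlineIterate [Fintype S] [Fintype A]
    [DecidableEq S] [IsProbabilityMeasure P] {β : ℝ}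
    {v vinf w : S → ℝ} (h : IsValueSolution M π Φ γ v vinf w)
    (hγ0 : 0 ≤ γ) (hγβ : γ ≤ β) (hβ : β < 1) (hΦβ : ∀ s, 1 - (Φ s : ℝ) ≤ β)
    (hΦ : ∀ s, 0 < Φ s ∧ Φ s < 1) (hT : M.Terminates π Φ)
    (hR : ∀ s a, MemLp (fun x : ℝ × Option S => x.1) 2 (M.step s a))
    (hE : IsExperience M π P ℱ St Act Rew Nxt)
    (hα : ∀ i, RobbinsMonro P ℱ St (α i)) (hV₀ : ∀ i s, Measurable[ℱ 0] fun ω => V₀ ω i s) :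
    ∀ᵐ ω ∂P, ∀ i s, Tendsto (fun n => onlineIterate Φ γ α St Rew Nxt V₀ n ω i s) atTop
      (𝓝 (solutionTable v vinf w i s)) := by
  set V := onlineIterate Φ γ α St Rew Nxt V₀ with hV
  have hVm : ∀ n i s, Measurable[ℱ n] fun ω => V n ω i s := measurable_onlineIterate hE hα hV₀
  have table : ∀ i, ∀ᵐ ω ∂P, (∀ o, Tendsto (fun n => tableWeight (V n ω) i o) atTop
      (𝓝 (tableWeight (solutionTable v vinf w) i o))) →
      (∀ s, Tendsto (fun n => tableOffset Φ (V n ω) i s) atTop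
        (𝓝 (tableOffset Φ (solutionTable v vinf w) i s))) →
      ∀ s, Tendsto (fun n => V n ω i s) atTop (𝓝 (solutionTable v vinf w i s)) := fun i =>
    (h.isWeightedFixedPoint hγ0 hγβ hΦβ hΦ hT i).tendsto_online hβ (memLp_policyStep π hR)
      hE.hasCondLaw hE.measurable_obs (hα i)
      (D' := fun n ω => tableWeight (V n ω) i) (h' := fun n ω => tableOffset Φ (V n ω) i)
      (X := fun n ω => V n ω i) (fun n o => measurable_tableWeight (hVm n) i o)
      (fun n s => hVm n i s) fun n ω s => onlineIterate_succ n ω i s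
  -- Along a path outside the four null sets, the implications are discharged in order of
  -- dependence: `v` and `vinf`, then `v1` and `v0`.
  filter_upwards [table .v, table .vinf, table .v1, table .v0] with ω t₁ t₂ t₃ t₄
  have h₁ := t₁ (fun _ => tendsto_const_nhds) fun _ => tendsto_const_nhds
  have h₂ := t₂ (fun _ => tendsto_const_nhds) fun _ => tendsto_const_nhds
  have hnext : ∀ o, Tendsto (fun n => atNext (V n ω .vinf) o) atTop
      (𝓝 (atNext (solutionTable v vinf w .vinf) o)) := fun o => by
    cases o with
    | none => exact tendsto_const_nhds
    | some s => exact h₂ s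
  have h₃ := t₃ hnext fun s => (h₁ s).mul_const _
  have h₄ := t₄ (fun o => (hnext o).const_sub 1) fun _ => tendsto_const_nhds
  intro i
  cases i with
  | v => exact h₁
  | vinf => exact h₂
  | v1 => exact h₃
  | v0 => exact h₄

end Online

theorem theorem1 {S A : Type*} [Fintype S] [DecidableEq S] [Fintype A]
    (M : EpisodicMDP S A) (π : S → PMF A) (Φ : S → unitInterval) (γ : ℝ)
    (hγ0 : 0 ≤ γ) (hγ1 : γ < 1) (hΦ : ∀ s, 0 < Φ s ∧ Φ s < 1) (hT : M.Terminates π Φ) :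
    -- (i) geometric convergence of the iterated operators
    (∃ r : ℝ, 0 ≤ r ∧ r < 1 ∧ ∀ V₀ : ValueTable S, ∃ C : ℝ,
      ∀ (i : ValueKind) (s : S) (ρ : PMF S) (t : ℕ), M.law π Φ ρ (Episode.inState t s) ≠ 0 →
        ∀ k : ℕ, |(M.bellman π Φ γ)^[k] V₀ i s - M.trueValue π Φ γ ρ t i s| ≤ C * r ^ k) ∧
    -- (ii) almost sure convergence of the online method
    ((∀ s a, MemLp (fun x : ℝ × Option S => x.1) 2 (M.step s a)) →
      ∀ (Ω : Type*) (mΩ : MeasurableSpace Ω) (P : Measure Ω) [IsProbabilityMeasure P]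
        (ℱ : Filtration ℕ mΩ) (St : ℕ → Ω → S) (Act : ℕ → Ω → A) (Rew : ℕ → Ω → ℝ)
        (Nxt : ℕ → Ω → Option S) (α : ValueKind → ℕ → Ω → ℝ) (V₀ : Ω → ValueTable S),
        IsExperience M π P ℱ St Act Rew Nxt →
        (∀ᵐ ω ∂P, ∀ s, ∃ᶠ n in atTop, St n ω = s) →
        (∀ i, RobbinsMonro P ℱ St (α i)) →
        (∀ i s, Measurable[ℱ 0] (fun ω => V₀ ω i s)) →
        ∀ (i : ValueKind) (s : S) (ρ : PMF S) (t : ℕ), M.law π Φ ρ (Episode.inState t s) ≠ 0 →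
          ∀ᵐ ω ∂P, Tendsto (fun n => onlineIterate Φ γ α St Rew Nxt V₀ n ω i s) atTop
            (𝓝 (M.trueValue π Φ γ ρ t i s))) := by
  obtain ⟨v, vinf, w, h⟩ := EpisodicMDP.exists_isValueSolution M π hγ0 hγ1 fun s => (hΦ s).1
  obtain ⟨β₀, -, hβ₀, hΦβ₀⟩ := exists_lt_one_forall_le (fun s => 1 - (Φ s : ℝ))
    fun s => sub_lt_self _ (hΦ s).1
  -- A common contraction factor for the four tables.
  set β := max γ β₀ with hβdef
  have hβ : β < 1 := max_lt hγ1 hβ₀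
  have hγβ : γ ≤ β := le_max_left _ _
  have hΦβ : ∀ s, 1 - (Φ s : ℝ) ≤ β := fun s => (hΦβ₀ s).trans (le_max_right _ _)
  -- Any `r` strictly between `β` and `1` would do; the gap above `β` absorbs the errors in the
  -- estimated weights.
  refine ⟨⟨(β + 1) / 2, by linarith, by linarith, fun V₀ => ?_⟩, ?_⟩
  · obtain ⟨C, hC⟩ := h.exists_bellman_rate hγ0 hγβ hΦβ hΦ hT
      (by linarith : β < (β + 1) / 2) (by linarith) V₀
    refine ⟨C, fun i s ρ t hs k => ?_⟩
    rw [h.trueValue_eq ρ hγ0 hγ1 hΦ hs]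
    exact hC i s k
  · intro hR Ω mΩ P _ ℱ St Act Rew Nxt α V₀ hE _ hα hV₀ i s ρ t hs
    rw [h.trueValue_eq ρ hγ0 hγ1 hΦ hs]
    filter_upwards [h.tendsto_onlineIterate hγ0 hγβ hβ hΦβ hΦ hT hR hE hα hV₀] with ω hω
    exact hω i s
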